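/- **Corollary 3.** Let $p, q$ be positive integers with $q<2p$ and $\gcd(q,2p)=1$. Let $L=\mathfrak b(2p,q)\subset S^3$ be the two-bridge link with two components $K,K'$ whose branched double covering is the lens space $L(2p,q)$, taken in the following position. Write $S^3$ as the union of two balls $B_1,B_2$ with common boundary sphere $S$. Inside $B_1$ the link consists of two parallel straight chords $UV\subset K$ and $U'V'\subset K'$. Identify $S$ with the pillowcase $\mathbb R^2/\langle (2\mathbb Z)^2,\ (s,t)\mapsto(-s,-t)\rangle$ in such a way that its corners $(1,0),(1,1),(0,0),(0,1)$ are $U,V,U',V'$ and the segments from $(1,0)$ to $(1,1)$ and from $(0,0)$ to $(0,1)$ are parallel in $B_1$ to the two chords. The rest of $K$ and of $K'$ is then the image in $S$ of the segment from $(1,0)$ to $(1+2p,q)$ and of the segment from $(0,0)$ to $(2p,q)$, respectively. Let $\varepsilon_k=(-1)^{\lfloor kq/2p\rfloor}$, and in the free group on $\tilde x,\tilde x'$ put $$w=(\tilde x')^{\varepsilon_1}\,\tilde x^{\varepsilon_2}\,(\tilde x')^{\varepsilon_3}\cdots \tilde x^{\varepsilon_{2p-2}}\,(\tilde x')^{\varepsilon_{2p-1}}.$$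 For every word $z$ in $\tilde x^{\pm1},\tilde x'^{\pm1}$ there is exactly one polynomial in $\mathbb C[\bar x,\bar x',\bar y]$, also denoted by $\operatorname{tr} z$, which for every representation of the free group in $SL_2(\mathbb C)$ gives the trace of $z$ on substituting $\bar x=-\operatorname{tr}\tilde x$, $\bar x'=-\operatorname{tr}\tilde x'$, $\bar y=-\operatorname{tr}(\tilde x\tilde x')$. Put $$\eta=\operatorname{tr}\big(\tilde x^{-1}w\,\tilde x\,\tilde x'^{-1}\big)-\operatorname{tr}\big(w\,\tilde x'^{-1}\big)\in\mathbb C[\bar x,\bar x',\bar y].$$ Then $\eta$ has $\bar y$-degree $p+1$, and its leading coefficient as a polynomial in $\bar y$ is $1$ or $-1$. Moreover, for every base point, the link group $\pi=\pi_1(S^3\setminus L)$ has a meridian $\tilde x$ of $K$ and a meridian $\tilde x'$ of $K'$ with $\pi=\langle \tilde x,\tilde x'\mid \tilde x w=w\tilde x\rangle$ such that the character ring of $L$ is the quotient of $\mathbb C[\bar x,\bar x',\bar y]$ by the ideal generated by $\eta$. That is, there are isomorphisms of $\mathbb C$-algebras from $\mathbb C[\bar x,\bar x',\bar y]/(\eta)$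 that send $\bar x,\bar x',\bar y$ to the negatives of the traces of $\tilde x,\tilde x',\tilde x\tilde x'$, respectively, 1. onto the ring $\mathbb C[\chi(\pi)]$ of regular functions on the $SL_2(\mathbb C)$-character variety $\chi(\pi)$, which is the set of the characters of all representations $\pi\to SL_2(\mathbb C)$, its regular functions being the polynomials in the functions $\operatorname{tr}_g:\chi\mapsto\chi(g)$, $g\in\pi$; and 2. onto the universal $SL_2$-character algebra of $\pi$, which is the commutative $\mathbb C$-algebra generated by symbols $[g]$, $g\in\pi$, the universal traces, with the relations $[1]=2$ and $[g][h]=[gh]+[gh^{-1}]$ (the Kauffman bracket skein algebra of $S^3\setminus L$ at $t=-1$, a knot $g$ being $-[g]$). -/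

import Mathlib

/-- The three-sphere, as the unit sphere of Euclidean four-space with coordinates `x₀, x₁, x₂, x₃`.
The hemisphere `0 ≤ x₃` is a closed ball `B₁` (project it orthogonally to the closed unit ball of
the space of the first three coordinates), the hemisphere `x₃ ≤ 0` is a closed ball `B₂`, and they
meet in the two-sphere `S : x₃ = 0`. -/
abbrev Sphere3 : Type := Metric.sphere (0 : EuclideanSpace ℝ (Fin 4)) 1

/-- `0` is the left side, `1` is the right side. -/
noncomputable def sideSign (i : Fin 2) : ℝ := if i = 0 then -1 else 1

/-- The trivial arcs of the link in the ball `B₁`: seen in the unit ball of the first three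
coordinates they are the two parallel straight chords that join `(±√2/2, √2/2, 0)` to
`(±√2/2, -√2/2, 0)`; the left one for `i = 0` and the right one for `i = 1`. -/
def innerArc (i : Fin 2) : Set Sphere3 :=
  {x | x.1 0 = sideSign i * (√2 / 2) ∧ x.1 2 = 0 ∧ 0 ≤ x.1 3}

/-- The map `(s, t) ↦ (cos πs, cos πt, sin πs sin πt, 0)`. It identifies the quotient of the plane
by the group generated by the translations in `(2ℤ)²` and by `(s, t) ↦ (-s, -t)` with a pillowcase
that is star-shaped about the origin and whose four corners are the images
`(±1, ±1, 0, 0)` of `ℤ²`. It never takes the value `0`. -/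
noncomputable def pillow (s t : ℝ) : EuclideanSpace ℝ (Fin 4) :=
  !₂[Real.cos (Real.pi * s), Real.cos (Real.pi * t),
    Real.sin (Real.pi * s) * Real.sin (Real.pi * t), 0]

/-- The two arcs of the link in the ball `B₂`, placed on its boundary sphere `S`. Identify `S` with
the pillowcase by radial projection; then the arcs are the two disjoint arcs that are covered by
the straight segments from `(1, 0)` to `(1 + 2p, q)` (for `i = 0`, it joins the two corners on the
left) and from `(0, 0)` to `(2p, q)` (for `i = 1`, it joins the two corners on the right). Both are
parallel to trivial arcs in `B₂`. In the same covering, the arcs of `innerArc` are parallel in `B₁`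
to the images of the segments from `(1, 0)` to `(1, 1)` and from `(0, 0)` to `(0, 1)`. -/
noncomputable def outerArc (p q : ℕ) (i : Fin 2) : Set Sphere3 :=
  {x | ∃ τ ∈ Set.Icc (0 : ℝ) 1, ∃ v : EuclideanSpace ℝ (Fin 4),
    v = pillow ((if i = 0 then 1 else 0) + 2 * p * τ) (q * τ) ∧ x.1 = ‖v‖⁻¹ • v}

/-- The component with index `i` of the two-bridge link `𝔟(2p, q)`. -/
noncomputable def linkComponent (p q : ℕ) (i : Fin 2) : Set Sphere3 :=
  innerArc i ∪ outerArc p q i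

/-- The two-bridge link `𝔟(2p, q)` in the three-sphere. -/
noncomputable def twoBridgeLink (p q : ℕ) : Set Sphere3 :=
  linkComponent p q 0 ∪ linkComponent p q 1

/-- The complement of the two-bridge link `𝔟(2p, q)`, a subspace of the three-sphere. -/
abbrev LinkComplement (p q : ℕ) : Type := {x : Sphere3 // x ∉ twoBridgeLink p q}

/-- The last coordinate, squared, of a point of the circle `smallCirclePoint` below. -/
noncomputable def smallCircleHeight (i : Fin 2) (θ : ℝ) : ℝ :=
  1 - (sideSign i * (√2 / 2) + Real.cos (2 * Real.pi * θ) / 4) ^ 2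
    - (Real.sin (2 * Real.pi * θ) / 4) ^ 2

theorem smallCircleHeight_pos (i : Fin 2) (θ : ℝ) : 0 < smallCircleHeight i θ := by
  have h1 := Real.sin_sq_add_cos_sq (2 * Real.pi * θ)
  have h2 : √2 ^ 2 = (2 : ℝ) := Real.sq_sqrt (by norm_num)
  have h3 : 0 ≤ √(2 : ℝ) := Real.sqrt_nonneg 2
  have h4 : √(2 : ℝ) ≤ 3 / 2 := by nlinarith
  have hc1 := Real.cos_le_one (2 * Real.pi * θ)
  have hc2 := Real.neg_one_le_cos (2 * Real.pi * θ)
  have h5 : √(2 : ℝ) * Real.cos (2 * Real.pi * θ) ≤ 3 / 2 := by nlinarith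
  have h6 : -(3 / 2) ≤ √(2 : ℝ) * Real.cos (2 * Real.pi * θ) := by nlinarith
  unfold smallCircleHeight sideSign
  split_ifs <;> nlinarith

/-- In the unit ball of the first three coordinates this is the circle of radius `1/4` around the
midpoint of the chord `innerArc i`, in the plane `x₁ = 0` perpendicular to that chord. It bounds a
round disc in the ball `B₁` that meets the link only in that midpoint. -/
noncomputable def smallCirclePoint (i : Fin 2) (θ : ℝ) : EuclideanSpace ℝ (Fin 4) :=
  !₂[sideSign i * (√2 / 2) + Real.cos (2 * Real.pi * θ) / 4, 0, Real.sin (2 * Real.pi * θ) / 4,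
    √(smallCircleHeight i θ)]

theorem smallCirclePoint_mem (i : Fin 2) (θ : ℝ) :
    smallCirclePoint i θ ∈ Metric.sphere (0 : EuclideanSpace ℝ (Fin 4)) 1 := by
  have h := Real.sq_sqrt (smallCircleHeight_pos i θ).le
  rw [mem_sphere_zero_iff_norm, EuclideanSpace.norm_eq, Real.sqrt_eq_one]
  simp only [smallCirclePoint, Fin.sum_univ_four, Real.norm_eq_abs, sq_abs]
  simp only [Matrix.cons_val, h]
  unfold smallCircleHeight
  ring

theorem smallCirclePoint_notMem (p q : ℕ) (i : Fin 2) (θ : ℝ) :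
    (⟨smallCirclePoint i θ, smallCirclePoint_mem i θ⟩ : Sphere3) ∉ twoBridgeLink p q := by
  have hpos : 0 < √(smallCircleHeight i θ) := Real.sqrt_pos.2 (smallCircleHeight_pos i θ)
  have hout : ∀ j, (⟨smallCirclePoint i θ, smallCirclePoint_mem i θ⟩ : Sphere3) ∉
      outerArc p q j := by
    rintro j ⟨τ, -, v, rfl, h⟩
    have h3 := congrArg (fun u : EuclideanSpace ℝ (Fin 4) => u 3) h
    simp only [smallCirclePoint, pillow, PiLp.smul_apply, PiLp.toLp_apply, Matrix.cons_val,
      smul_eq_mul, mul_zero] at h3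
    exact hpos.ne' h3
  have hin : ∀ j, (⟨smallCirclePoint i θ, smallCirclePoint_mem i θ⟩ : Sphere3) ∉ innerArc j := by
    rintro j ⟨h0, h2, -⟩
    simp only [smallCirclePoint, PiLp.toLp_apply, Matrix.cons_val] at h0 h2
    have hs : Real.sin (2 * Real.pi * θ) = 0 := by linarith
    have h1 := Real.sin_sq_add_cos_sq (2 * Real.pi * θ)
    rw [hs] at h1
    have hsq : √2 ^ 2 = (2 : ℝ) := Real.sq_sqrt (by norm_num)
    have hs0 : 0 ≤ √(2 : ℝ) := Real.sqrt_nonneg 2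
    unfold sideSign at h0
    split_ifs at h0 <;> nlinarith
  rintro ((h | h) | (h | h))
  exacts [hin _ h, hout _ h, hin _ h, hout _ h]

/-- The small circle around the chord `innerArc i`, as a loop in the complement of the link. -/
noncomputable def smallCircle (p q : ℕ) (i : Fin 2) :
    Path (⟨⟨smallCirclePoint i 0, smallCirclePoint_mem i 0⟩, smallCirclePoint_notMem p q i 0⟩ :
      LinkComplement p q)
      ⟨⟨smallCirclePoint i 0, smallCirclePoint_mem i 0⟩, smallCirclePoint_notMem p q i 0⟩ where
  toFun θ := ⟨⟨smallCirclePoint i θ, smallCirclePoint_mem i θ⟩, smallCirclePoint_notMem p q i θ⟩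
  continuous_toFun := by
    refine Continuous.subtype_mk (Continuous.subtype_mk ?_ _) _
    refine (PiLp.continuous_toLp 2 _).comp (continuous_pi fun k => ?_)
    fin_cases k <;> simp [smallCircleHeight] <;> fun_prop
  source' := by simp
  target' := by
    simp [smallCirclePoint, smallCircleHeight]

/-- An element of the link group is a meridian of the component with index `i` if it is represented
by a path to the small circle around that component, followed by the circle in one of its two
directions and by the way back. -/
def IsMeridian (p q : ℕ) (b : LinkComplement p q) (i : Fin 2)
    (g : FundamentalGroup (LinkComplement p q) b) : Prop :=
  ∃ γ : Path b ⟨⟨smallCirclePoint i 0, smallCirclePoint_mem i 0⟩, smallCirclePoint_notMem p q i 0⟩,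
    g = FundamentalGroup.fromPath
        (Path.Homotopic.Quotient.mk ((γ.trans (smallCircle p q i)).trans γ.symm)) ∨
    g = FundamentalGroup.fromPath
        (Path.Homotopic.Quotient.mk ((γ.trans (smallCircle p q i).symm).trans γ.symm))

/-- The letter `x̃` of the free group on two letters. -/
def letterX : FreeGroup (Fin 2) := FreeGroup.of 0

/-- The letter `x̃'` of the free group on two letters. -/
def letterX' : FreeGroup (Fin 2) := FreeGroup.of 1

/-- The exponent `ε_k = (-1) ^ ⌊k q / (2 p)⌋`. -/
def schubertSign (p q k : ℕ) : ℤ := (-1) ^ (k * q / (2 * p))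

/-- The word `w = x̃' ^ ε₁ x̃ ^ ε₂ ⋯ x̃ ^ ε_{2p-2} x̃' ^ ε_{2p-1}`. -/
def schubertWord (p q : ℕ) : FreeGroup (Fin 2) :=
  ((List.range (2 * p - 1)).map fun j =>
    (if Even (j + 1) then letterX else letterX') ^ schubertSign p q (j + 1)).prod

/-- The elements `g` and `g'` of the group `G` present it as `⟨x̃, x̃' ∣ x̃ w = w x̃⟩`. -/
def IsSchubertPresentation (p q : ℕ) {G : Type*} [Group G] (g g' : G) : Prop :=
  Function.Surjective (FreeGroup.lift ![g, g']) ∧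
  (FreeGroup.lift ![g, g']).ker =
    Subgroup.normalClosure {letterX * schubertWord p q * letterX⁻¹ * (schubertWord p q)⁻¹}

/-- The trace of `ρ g` for a representation `ρ` in `SL₂(ℂ)`. -/
noncomputable def repTrace {G : Type*} [Group G]
    (ρ : G →* Matrix.SpecialLinearGroup (Fin 2) ℂ) (g : G) : ℂ :=
  (ρ g : Matrix (Fin 2) (Fin 2) ℂ).trace

/-- The polynomial `P` in the variables `x̄ = X 0`, `x̄' = X 1`, `ȳ = X 2` is the trace of the word
`z` under `tr x̃ = -x̄`, `tr x̃' = -x̄'`, `tr (x̃ x̃') = -ȳ`. -/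
def IsTracePolynomial (z : FreeGroup (Fin 2)) (P : MvPolynomial (Fin 3) ℂ) : Prop :=
  ∀ ρ : FreeGroup (Fin 2) →* Matrix.SpecialLinearGroup (Fin 2) ℂ,
    MvPolynomial.eval
      ![-repTrace ρ letterX, -repTrace ρ letterX', -repTrace ρ (letterX * letterX')] P =
      repTrace ρ z

/-- The `SL₂(ℂ)`-character variety of `G`: the set of the characters of all representations. -/
def characterVariety (G : Type*) [Group G] : Set (G → ℂ) :=
  Set.range fun ρ : G →* Matrix.SpecialLinearGroup (Fin 2) ℂ => repTrace ρ

/-- The coordinate function `χ ↦ χ g` on the character variety. -/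
def traceCoordinate {G : Type*} [Group G] (g : G) : characterVariety G → ℂ := fun χ => χ.1 g

/-- The ring of regular functions on the character variety: all the functions on it that are
polynomials in the coordinate functions. -/
def CharacterRing (G : Type*) [Group G] : Subalgebra ℂ (characterVariety G → ℂ) :=
  Algebra.adjoin ℂ (Set.range traceCoordinate)

/-- The coordinate function of `g`, as an element of the ring of regular functions. -/
def traceFunction {G : Type*} [Group G] (g : G) : CharacterRing G :=
  ⟨traceCoordinate g, Algebra.subset_adjoin ⟨g, rfl⟩⟩

/-- The ideal of the universal trace relations `[1] = 2` and `[g] [h] = [g h] + [g h⁻¹]`. -/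
noncomputable def traceRelations (G : Type*) [Group G] : Ideal (MvPolynomial G ℂ) :=
  Ideal.span ({MvPolynomial.X 1 - 2} ∪
    {r | ∃ g h : G, r = MvPolynomial.X g * MvPolynomial.X h
      - MvPolynomial.X (g * h) - MvPolynomial.X (g * h⁻¹)})

/-- The universal `SL₂`-character algebra of `G` over `ℂ`: it is generated by the symbols `[g]`, the
universal traces, subject to the trace relations. For the fundamental group of a three-manifold
it is the skein algebra at `t = -1`, in which the class of a knot `g` is `-[g]`. -/
abbrev UniversalCharacterRing (G : Type*) [Group G] : Type _ :=
  MvPolynomial G ℂ ⧸ traceRelations G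

/-- The universal trace `[g]`. -/
noncomputable def universalTrace {G : Type*} [Group G] (g : G) : UniversalCharacterRing G :=
  Ideal.Quotient.mk (traceRelations G) (MvPolynomial.X g)

/-! The proof has an algebraic half, valid for every group with the presentation ⟨x, x' | xw = wx⟩,
and a topological half that extracts this presentation from the link.

Algebra. The trace relations contain Cayley–Hamilton, so under a trace function every word of the
free group acts like a combination of 1, x, x', xx' whose coefficients are polynomials in the three
basic traces (`IsTraceFunction.apply_mk_mul`). Hence one polynomial tr z serves all trace functions
with values in all commutative ℂ-algebras (`IsTraceFunction.frickeEval_tracePoly`). Coprimality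
makes w a palindrome, and a palindrome has no xx'-component (`genericForm_palindrome`): w acts as α
+ βx + γx', and xw − wx as γ(xx' − x'x). Moreover tr((xx' − x'x)v) is κ = tr[x,x'] − 2 times the
xx'-coefficient of v. So every trace of the relation is a multiple of γκ, and η = γκ
(`tracePoly_schubertWord_swap`, `tracePoly_sub_eq`). Therefore tr descends modulo η to a trace
function on π, which inverts the map onto the universal algebra. For the character variety, every
zero of η is realised by a representation of π: a diagonal one where κ = 0, and where κ ≠ 0 any one
with these traces, because the trace form is then nondegenerate on its image. By the Nullstellensatz
the vanishing ideal is the radical of (η), and η is squarefree.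

Squarefreeness and the ȳ-degree are read off at x̄ = x̄' = 0, where η becomes ±(ȳ² − 4)S_{p−1}(ȳ)
with the p + 1 simple roots 2cos(kπ/p). A weight bound, with weights 1, 1, 2, shows that the leading
coefficient in ȳ is a constant.

Topology. Each chord cobounds a disc in B₁ with a vertical side of the pillowcase. Four open patches
over star-shaped cones cover the complement: the open upper hemisphere without the two discs, two
side patches that contain the interiors of the discs, and a lower patch that the south pole sees.
The outer arcs cut S down to an open annulus. Its universal cover is a strip between two parallel
lines, with deck translation (4p, 2q). Along the strip one crosses the discs at s = k + 1, k = 0, 1,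
2, …, and reads the letters x or x' with exponent ε_k; one period reads x w x⁻¹ w⁻¹. This loop dies
in the lower patch (`LinkTransport.loop_relator`). Subdividing paths shows that the two letters
generate (`LinkTransport.loop_surjective`), and the holonomy of an explicit cocycle in the presented
group shows that there are no further relations (`LinkTransport.mem_of_loop_eq_id`). This is van
Kampen's argument with disconnected intersections. -/

/-! ### Trace functions on groups and their Cayley–Hamilton identities -/

/-- A trace function: a function on a group that satisfies the trace relations of `SL₂`. -/
structure IsTraceFunction {G A : Type*} [Group G] [CommRing A] (T : G → A) : Prop where
  one : T 1 = 2
  mul : ∀ g h, T g * T h = T (g * h) + T (g * h⁻¹)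

namespace IsTraceFunction

variable {G A : Type*} [Group G] [CommRing A] {T : G → A} (hT : IsTraceFunction T)
include hT

theorem inv (g : G) : T g⁻¹ = T g := by
  have h := hT.mul 1 g
  rw [hT.one, one_mul, one_mul] at h
  linear_combination -h

theorem mul_comm (g h : G) : T (g * h) = T (h * g) := by
  have h1 := hT.mul g h
  have h2 := hT.mul h g
  have h3 := hT.inv (g * h⁻¹)
  rw [mul_inv_rev, inv_inv] at h3
  linear_combination h2 - h1 + h3

theorem inv_mul (g u : G) : T (g⁻¹ * u) = T g * T u - T (g * u) := by
  have h1 := hT.mul g u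
  have h2 := hT.inv (g * u⁻¹)
  rw [mul_inv_rev, inv_inv, hT.mul_comm] at h2
  linear_combination h2 - h1

theorem mul_inv_mul (v g u : G) : T (v * (g⁻¹ * u)) = T g * T (v * u) - T (v * (g * u)) := by
  rw [hT.mul_comm v, hT.mul_comm v, hT.mul_comm v, mul_assoc, hT.inv_mul, mul_assoc]

theorem mul_mul_self (g u : G) : T (g * (g * u)) = T g * T (g * u) - T u := by
  have h := hT.inv_mul g (g * u)
  rw [inv_mul_cancel_left] at h
  linear_combination h

/-- Polarised Cayley–Hamilton, gh + hg = tr(g)h + tr(h)g + tr(gh) − tr(g)tr(h), tested against u. It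
follows from the axioms alone by expanding T(h⁻¹gu) in two ways. -/
theorem mul_mul_swap (g h u : G) :
    T (h * (g * u)) = -T (g * (h * u)) + T g * T (h * u) + T h * T (g * u)
      + (T (g * h) - T g * T h) * T u := by
  have h1 := hT.inv_mul g (h * u)
  have h2 := hT.inv_mul h (g * u)
  have h3 := hT.inv_mul (g⁻¹ * h) u
  have h4 := hT.inv_mul g h
  rw [mul_inv_rev, inv_inv, mul_assoc, mul_assoc, h1, h2, h4] at h3
  linear_combination -h3

/-- Cayley–Hamilton for gh, applied to gu: here (gh)⁻¹gu = h⁻¹u, which is expanded once more. -/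
theorem mul_mul_mul (g h u : G) :
    T (g * (h * (g * u))) = T h⁻¹ * (- T u) + T (g * h) * T (g * u) + T (h * u) := by
  have h1 := hT.inv_mul (g * h) (g * u)
  have h2 := hT.inv_mul h u
  rw [mul_inv_rev, mul_assoc, inv_mul_cancel_left, mul_assoc] at h1
  rw [hT.inv]
  linear_combination h1 - h2

theorem comp {H : Type*} [Group H] (f : H →* G) : IsTraceFunction (T ∘ f) where
  one := by simp [hT.one]
  mul g h := by simp [hT.mul]

end IsTraceFunction

theorem isTraceFunction_repTrace {G : Type*} [Group G]
    (ρ : G →* Matrix.SpecialLinearGroup (Fin 2) ℂ) : IsTraceFunction (repTrace ρ) where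
  one := by simp [repTrace]
  mul g h := by
    simp only [repTrace, map_mul, map_inv, Matrix.SpecialLinearGroup.coe_mul,
      Matrix.SpecialLinearGroup.coe_inv, Matrix.adjugate_fin_two, Matrix.trace_fin_two,
      Matrix.mul_apply, Fin.sum_univ_two, Matrix.of_apply, Matrix.cons_val', Matrix.cons_val_zero,
      Matrix.cons_val_one, Matrix.cons_val_fin_one]
    ring

/-! ### Fricke polynomials of the free group of rank two -/

/-- Polynomials in the negatives `X 0`, `X 1`, `X 2` of the traces of `x̃`, `x̃'`, `x̃ x̃'`. -/
abbrev FrickeRing : Type := MvPolynomial (Fin 3) ℂ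

open MvPolynomial in
/-- The algebra homomorphism that a function on the free group determines on `FrickeRing`. -/
noncomputable def frickeEval {A : Type*} [CommRing A] [Algebra ℂ A] (T : FreeGroup (Fin 2) → A) :
    FrickeRing →ₐ[ℂ] A :=
  aeval ![-T letterX, -T letterX', -T (letterX * letterX')]

/-- The coefficients of a combination of `1`, `x̃`, `x̃'`, `x̃ x̃'`. -/
@[ext] structure FrickeForm (R : Type*) where
  one : R
  x : R
  x' : R
  xx' : R

namespace FrickeForm

variable {R S : Type*} [CommRing R] [CommRing S]

/-- The coefficients after multiplication by a letter from the right, when the traces of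
`x̃`, `x̃'`, `x̃ x̃'` are `a`, `b`, `c`. -/
def step (a b c : R) (q : FrickeForm R) : Fin 2 × Bool → FrickeForm R
  | (0, true) => ⟨-q.x + q.x' * (c - a * b) - q.xx' * b, q.one + a * q.x + b * q.x' + c * q.xx',
      a * q.x' + q.xx', -q.x'⟩
  | (0, false) => ⟨a * q.one - (-q.x + q.x' * (c - a * b) - q.xx' * b),
      a * q.x - (q.one + a * q.x + b * q.x' + c * q.xx'),
      a * q.x' - (a * q.x' + q.xx'), a * q.xx' + q.x'⟩
  | (1, true) => ⟨-q.x', -q.xx', q.one + b * q.x', q.x + b * q.xx'⟩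
  | (1, false) => ⟨b * q.one + q.x', b * q.x + q.xx', b * q.x' - (q.one + b * q.x'),
      b * q.xx' - (q.x + b * q.xx')⟩

/-- The coefficients of a word. -/
def ofWord (a b c : R) (L : List (Fin 2 × Bool)) : FrickeForm R :=
  L.foldl (step a b c) ⟨1, 0, 0, 0⟩

theorem ofWord_concat (a b c : R) (L : List (Fin 2 × Bool)) (l : Fin 2 × Bool) :
    ofWord a b c (L ++ [l]) = step a b c (ofWord a b c L) l := by
  simp [ofWord]

/-- The coefficientwise image of a form. -/
def map (f : R →+* S) (q : FrickeForm R) : FrickeForm S := ⟨f q.one, f q.x, f q.x', f q.xx'⟩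

theorem map_step (f : R →+* S) (a b c : R) (q : FrickeForm R) (l : Fin 2 × Bool) :
    (step a b c q l).map f = step (f a) (f b) (f c) (q.map f) l := by
  obtain ⟨i, s⟩ := l
  fin_cases i <;> cases s <;> simp [step, map]

theorem map_ofWord (f : R →+* S) (a b c : R) (L : List (Fin 2 × Bool)) :
    (ofWord a b c L).map f = ofWord (f a) (f b) (f c) L := by
  induction L using List.reverseRecOn with
  | nil => simp [ofWord, map]
  | append_singleton L l ih => rw [ofWord_concat, ofWord_concat, map_step, ih]

end FrickeForm

theorem freeGroup_mk_concat (L : List (Fin 2 × Bool)) (l : Fin 2 × Bool) :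
    FreeGroup.mk (L ++ [l]) = FreeGroup.mk L * FreeGroup.mk [l] := by
  rw [FreeGroup.mul_mk]

/-- The span of 1, x, x', xx' is stable under right multiplication by letters, up to the
Cayley–Hamilton identities. The arbitrary factor u is what carries the induction: it absorbs the
last letter. -/
theorem IsTraceFunction.apply_mk_mul {A : Type*} [CommRing A] {T : FreeGroup (Fin 2) → A}
    (hT : IsTraceFunction T) (L : List (Fin 2 × Bool)) (u : FreeGroup (Fin 2)) (q : FrickeForm A)
    (hq : q = .ofWord (T letterX) (T letterX') (T (letterX * letterX')) L) :
    T (FreeGroup.mk L * u) = q.one * T u + q.x * T (letterX * u) + q.x' * T (letterX' * u)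
      + q.xx' * T (letterX * (letterX' * u)) := by
  subst hq
  induction L using List.reverseRecOn generalizing u with
  | nil => simp [FrickeForm.ofWord, ← FreeGroup.one_eq_mk]
  | append_singleton L l ih =>
    rw [FrickeForm.ofWord_concat, freeGroup_mk_concat, mul_assoc, ih]
    set q := FrickeForm.ofWord (T letterX) (T letterX') (T (letterX * letterX')) L
    have hx : FreeGroup.mk [((0 : Fin 2), true)] = letterX := rfl
    have hX : FreeGroup.mk [((0 : Fin 2), false)] = letterX⁻¹ := rfl
    have hy : FreeGroup.mk [((1 : Fin 2), true)] = letterX' := rfl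
    have hY : FreeGroup.mk [((1 : Fin 2), false)] = letterX'⁻¹ := rfl
    have e1 : ∀ u, T (letterX * (letterX * u)) = T letterX * T (letterX * u) - T u :=
      hT.mul_mul_self _
    have e2 : ∀ u, T (letterX' * (letterX' * u)) = T letterX' * T (letterX' * u) - T u :=
      hT.mul_mul_self _
    have e3 := hT.mul_mul_swap letterX letterX'
    have e4 := hT.mul_mul_mul letterX letterX'
    rw [hT.inv] at e4
    have e5 : T (letterX * (letterX' * (letterX' * u))) =
        T letterX' * T (letterX * (letterX' * u)) - T (letterX * u) := by
      rw [hT.mul_comm, mul_assoc, mul_assoc, e2, hT.mul_comm letterX, hT.mul_comm letterX,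
        mul_assoc]
    obtain ⟨i, s⟩ := l
    have e6 := hT.mul_inv_mul
    have e7 : ∀ v w g u, T (v * (w * (g⁻¹ * u))) = T g * T (v * (w * u)) - T (v * (w * (g * u))) :=
      fun v w g u => by simpa only [mul_assoc] using e6 (v * w) g u
    fin_cases i <;> cases s <;> simp only [Fin.zero_eta, Fin.mk_one, FrickeForm.step]
    · rw [hX, hT.inv_mul, e6, e6, e7, e1, e3, e4]
      ring
    · rw [hx, e1, e3, e4]
      ring
    · rw [hY, hT.inv_mul, e6, e6, e7, e2, e5]
      ring
    · rw [hy, e2, e5]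
      ring

/-- The trace polynomial of an element of the free group. -/
noncomputable def tracePoly (z : FreeGroup (Fin 2)) : FrickeRing :=
  let q := FrickeForm.ofWord (-MvPolynomial.X 0) (-MvPolynomial.X 1) (-MvPolynomial.X 2 : FrickeRing)
    z.toWord
  2 * q.one - MvPolynomial.X 0 * q.x - MvPolynomial.X 1 * q.x' - MvPolynomial.X 2 * q.xx'

section

variable {A : Type*} [CommRing A] [Algebra ℂ A] {T : FreeGroup (Fin 2) → A}

@[simp] theorem frickeEval_X_zero : frickeEval T (MvPolynomial.X 0) = -T letterX := by
  simp [frickeEval]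

@[simp] theorem frickeEval_X_one : frickeEval T (MvPolynomial.X 1) = -T letterX' := by
  simp [frickeEval]

@[simp] theorem frickeEval_X_two : frickeEval T (MvPolynomial.X 2) = -T (letterX * letterX') := by
  simp [frickeEval]

/-- Universality: the target is any commutative ℂ-algebra, so the polynomial computes universal
traces and regular functions as well as traces of matrices. -/
theorem IsTraceFunction.frickeEval_tracePoly (hT : IsTraceFunction T) (z : FreeGroup (Fin 2)) :
    frickeEval T (tracePoly z) = T z := by
  have h := hT.apply_mk_mul z.toWord 1 _ rfl
  have hm := FrickeForm.map_ofWord (frickeEval T : FrickeRing →+* A) (-MvPolynomial.X 0)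
    (-MvPolynomial.X 1) (-MvPolynomial.X 2) z.toWord
  simp only [RingHom.coe_coe, map_neg, frickeEval_X_zero, frickeEval_X_one, frickeEval_X_two,
    neg_neg] at hm
  rw [FreeGroup.mk_toWord, ← hm, hT.one] at h
  simp only [mul_one] at h
  rw [h]
  simp only [tracePoly, map_sub, map_mul, frickeEval_X_zero, frickeEval_X_one, frickeEval_X_two,
    map_ofNat, FrickeForm.map, RingHom.coe_coe]
  ring

end

theorem eval_eq_frickeEval (ρ : FreeGroup (Fin 2) →* Matrix.SpecialLinearGroup (Fin 2) ℂ)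
    (P : FrickeRing) :
    MvPolynomial.eval
      ![-repTrace ρ letterX, -repTrace ρ letterX', -repTrace ρ (letterX * letterX')] P =
      frickeEval (repTrace ρ) P := by
  rw [frickeEval, MvPolynomial.aeval_eq_eval]

theorem isTracePolynomial_tracePoly (z : FreeGroup (Fin 2)) : IsTracePolynomial z (tracePoly z) :=
  fun ρ => by
    rw [eval_eq_frickeEval, (isTraceFunction_repTrace ρ).frickeEval_tracePoly]

/-- The product of the two explicit matrices has trace t + t⁻¹, so t is taken as a root of t² − ct +
1. Since all of ℂ³ is reached, identities between trace polynomials can be checked on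
representations. -/
theorem exists_repTrace_eq (a b c : ℂ) :
    ∃ ρ : FreeGroup (Fin 2) →* Matrix.SpecialLinearGroup (Fin 2) ℂ,
      repTrace ρ letterX = a ∧ repTrace ρ letterX' = b ∧ repTrace ρ (letterX * letterX') = c := by
  obtain ⟨t, ht⟩ := IsAlgClosed.exists_aeval_eq_zero ℂ
    (Polynomial.X ^ 2 - Polynomial.C c * Polynomial.X + 1 : Polynomial ℂ) (by
      have : (Polynomial.X ^ 2 - Polynomial.C c * Polynomial.X + 1 : Polynomial ℂ).degree = 2 := by
        compute_degree!
      rw [this]; decide)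
  simp only [map_add, map_sub, map_mul, map_pow, Polynomial.aeval_X, Polynomial.aeval_C,
    Algebra.algebraMap_self, RingHom.id_apply, map_one] at ht
  have h0 : t ≠ 0 := by rintro rfl; simp at ht
  refine ⟨FreeGroup.lift ![⟨!![a, -1; 1, 0], by simp⟩, ⟨!![0, t; -t⁻¹, b], by simp [h0]⟩], ?_, ?_, ?_⟩
  · simp [repTrace, letterX, Matrix.trace_fin_two]
  · simp [repTrace, letterX', Matrix.trace_fin_two]
  · simp only [repTrace, letterX, letterX', map_mul, FreeGroup.lift_apply_of,
      Matrix.SpecialLinearGroup.coe_mul, Matrix.trace_fin_two]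
    simp
    field_simp
    linear_combination ht

theorem exists_repTrace_eq_neg (v : Fin 3 → ℂ) :
    ∃ ρ : FreeGroup (Fin 2) →* Matrix.SpecialLinearGroup (Fin 2) ℂ,
      ![-repTrace ρ letterX, -repTrace ρ letterX', -repTrace ρ (letterX * letterX')] = v := by
  obtain ⟨ρ, h0, h1, h2⟩ := exists_repTrace_eq (-v 0) (-v 1) (-v 2)
  refine ⟨ρ, funext fun i => ?_⟩
  fin_cases i <;> simp [h0, h1, h2]

theorem IsTracePolynomial.eq_tracePoly {z : FreeGroup (Fin 2)} {P : FrickeRing}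
    (h : IsTracePolynomial z P) : P = tracePoly z := by
  refine MvPolynomial.funext fun v => ?_
  obtain ⟨ρ, rfl⟩ := exists_repTrace_eq_neg v
  rw [h ρ, isTracePolynomial_tracePoly z ρ]

theorem existsUnique_isTracePolynomial (z : FreeGroup (Fin 2)) :
    ∃! P : FrickeRing, IsTracePolynomial z P :=
  ⟨tracePoly z, isTracePolynomial_tracePoly z, fun _ h => h.eq_tracePoly⟩

/-- Every point of ℂ³ is the trace triple of a representation, and there the identities hold;
polynomials over ℂ that agree everywhere are equal. -/
theorem isTraceFunction_tracePoly : IsTraceFunction tracePoly where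
  one := by
    refine ((show IsTracePolynomial 1 2 from fun ρ => ?_).eq_tracePoly).symm
    simp [(isTraceFunction_repTrace ρ).one]
  mul g h := by
    refine MvPolynomial.funext fun v => ?_
    obtain ⟨ρ, rfl⟩ := exists_repTrace_eq_neg v
    rw [map_mul, map_add, isTracePolynomial_tracePoly _ ρ, isTracePolynomial_tracePoly _ ρ,
      isTracePolynomial_tracePoly _ ρ, isTracePolynomial_tracePoly _ ρ,
      (isTraceFunction_repTrace ρ).mul]

@[simp] theorem tracePoly_letterX : tracePoly letterX = -MvPolynomial.X 0 :=
  (show IsTracePolynomial letterX (-MvPolynomial.X 0) from fun ρ => by simp).eq_tracePoly.symm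

@[simp] theorem tracePoly_letterX' : tracePoly letterX' = -MvPolynomial.X 1 :=
  (show IsTracePolynomial letterX' (-MvPolynomial.X 1) from fun ρ => by simp).eq_tracePoly.symm

@[simp] theorem tracePoly_letterX_mul_letterX' :
    tracePoly (letterX * letterX') = -MvPolynomial.X 2 :=
  (show IsTracePolynomial (letterX * letterX') (-MvPolynomial.X 2) from
    fun ρ => by simp).eq_tracePoly.symm

/-! ### Reversal of words, commutators and palindromes -/

/-- The reversal of words, as a homomorphism to the opposite of the free group. -/
def wordReverse : FreeGroup (Fin 2) →* (FreeGroup (Fin 2))ᵐᵒᵖ :=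
  FreeGroup.lift fun i => MulOpposite.op (FreeGroup.of i)

@[simp] theorem wordReverse_letterX : wordReverse letterX = MulOpposite.op letterX := by
  simp [wordReverse, letterX]

@[simp] theorem wordReverse_letterX' : wordReverse letterX' = MulOpposite.op letterX' := by
  simp [wordReverse, letterX']

theorem wordReverse_unop_wordReverse (z : FreeGroup (Fin 2)) :
    wordReverse (wordReverse z).unop = MulOpposite.op z := by
  have h : (MulEquiv.opOp (FreeGroup (Fin 2))).symm.toMonoidHom.comp
      ((MonoidHom.op wordReverse).comp wordReverse) = MonoidHom.id _ := by
    ext i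
    simp [wordReverse]
  exact congrArg MulOpposite.op (DFunLike.congr_fun h z)

/-- The trace of the reversed word is again a trace function. It agrees with tr on x, x' and, since
tr(x'x) = tr(xx'), also on xx', so universality identifies the two. -/
theorem tracePoly_unop_wordReverse (z : FreeGroup (Fin 2)) :
    tracePoly (wordReverse z).unop = tracePoly z := by
  have hP := isTraceFunction_tracePoly
  have hT : IsTraceFunction fun z => tracePoly (wordReverse z).unop :=
    { one := by simp [hP.one]
      mul := fun g h => by
        simp only [map_mul, map_inv, MulOpposite.unop_mul, MulOpposite.unop_inv]
        have h1 := hP.mul (wordReverse h).unop (wordReverse g).unop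
        have h2 := hP.inv ((wordReverse h).unop * (wordReverse g).unop⁻¹)
        rw [mul_inv_rev, inv_inv, hP.mul_comm] at h2
        linear_combination h1 - h2 }
  rw [← hT.frickeEval_tracePoly]
  simp only [frickeEval, wordReverse_letterX, wordReverse_letterX', map_mul, MulOpposite.unop_mul,
    MulOpposite.unop_op, hP.mul_comm letterX', tracePoly_letterX, tracePoly_letterX',
    tracePoly_letterX_mul_letterX', neg_neg]
  have : (![MvPolynomial.X 0, MvPolynomial.X 1, MvPolynomial.X 2] : Fin 3 → FrickeRing) =
      MvPolynomial.X := by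
    funext i; fin_cases i <;> rfl
  rw [this, MvPolynomial.aeval_X_left_apply]

/-- The coefficients of a word over `FrickeRing`. -/
noncomputable def genericForm (L : List (Fin 2 × Bool)) : FrickeForm FrickeRing :=
  .ofWord (-MvPolynomial.X 0) (-MvPolynomial.X 1) (-MvPolynomial.X 2) L

theorem tracePoly_mk_mul (L : List (Fin 2 × Bool)) (u : FreeGroup (Fin 2)) :
    tracePoly (FreeGroup.mk L * u) = (genericForm L).one * tracePoly u
      + (genericForm L).x * tracePoly (letterX * u) + (genericForm L).x' * tracePoly (letterX' * u)
      + (genericForm L).xx' * tracePoly (letterX * (letterX' * u)) :=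
  isTraceFunction_tracePoly.apply_mk_mul L u _ (by simp [genericForm])

/-- The trace of the commutator of `x̃` and `x̃'` minus two. -/
noncomputable def commutatorPoly : FrickeRing :=
  MvPolynomial.X 0 ^ 2 + MvPolynomial.X 1 ^ 2 + MvPolynomial.X 2 ^ 2
    + MvPolynomial.X 0 * MvPolynomial.X 1 * MvPolynomial.X 2 - 4

/-- Against xx' − x'x the basis elements 1, x, x' have trace zero by cyclicity; only xx'
contributes, with the value κ. -/
theorem tracePoly_commutator (L : List (Fin 2 × Bool)) :
    tracePoly (letterX * (letterX' * FreeGroup.mk L))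
      - tracePoly (letterX' * (letterX * FreeGroup.mk L)) =
      (genericForm L).xx' * commutatorPoly := by
  have hP := isTraceFunction_tracePoly
  have e1 := tracePoly_mk_mul L (letterX * letterX')
  have e2 := tracePoly_mk_mul L (letterX' * letterX)
  rw [hP.mul_comm, mul_assoc] at e1 e2
  have e3 : tracePoly (letterX' * letterX) = tracePoly (letterX * letterX') := hP.mul_comm _ _
  have e4 : tracePoly (letterX * (letterX' * letterX)) =
      tracePoly (letterX * (letterX * letterX')) := by
    rw [hP.mul_comm, mul_assoc, hP.mul_comm, mul_assoc]
  have e5 : tracePoly (letterX' * (letterX * letterX')) =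
      tracePoly (letterX' * (letterX' * letterX)) := by
    rw [hP.mul_comm, mul_assoc, hP.mul_comm, mul_assoc]
  have e6 : tracePoly (letterX * (letterX' * (letterX * letterX'))) =
      MvPolynomial.X 2 ^ 2 - 2 := by
    have := hP.mul_mul_self (letterX * letterX') 1
    rw [mul_one, mul_assoc, hP.one, tracePoly_letterX_mul_letterX'] at this
    rw [this]; ring
  have e7 : tracePoly (letterX * (letterX' * (letterX' * letterX))) =
      - MvPolynomial.X 0 * MvPolynomial.X 1 * MvPolynomial.X 2 - MvPolynomial.X 0 ^ 2
        - MvPolynomial.X 1 ^ 2 + 2 := by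
    have h1 := hP.mul_mul_self letterX (letterX' * letterX')
    have h2 := hP.mul_mul_self letterX' letterX
    have h3 := hP.mul_mul_self letterX' 1
    rw [mul_one, hP.one] at h3
    have h4 : tracePoly (letterX * (letterX' * letterX')) =
        tracePoly (letterX' * (letterX' * letterX)) := by
      rw [hP.mul_comm, mul_assoc]
    have h5 : tracePoly (letterX * (letterX' * (letterX' * letterX))) =
        tracePoly (letterX * (letterX * (letterX' * letterX'))) := by
      rw [hP.mul_comm letterX (letterX * _)]
      simp only [mul_assoc]
    rw [h5, h1, h4, h2, h3, e3, tracePoly_letterX, tracePoly_letterX',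
      tracePoly_letterX_mul_letterX']
    ring
  rw [e1, e2, e3, e4, e5, e6, e7, commutatorPoly]
  ring

theorem commutatorPoly_ne_zero : commutatorPoly ≠ 0 := by
  intro h
  have := congrArg (MvPolynomial.eval (0 : Fin 3 → ℂ)) h
  have h4 : MvPolynomial.eval (0 : Fin 3 → ℂ) 4 = 4 := map_ofNat _ 4
  simp only [commutatorPoly, map_sub, map_add, map_mul, map_pow, MvPolynomial.eval_X, h4] at this
  norm_num at this

/-- Reversal preserves traces, fixes a palindrome and exchanges xx' with x'x. So the palindrome has
equal traces against these two, while their difference is κ times its xx'-coefficient and κ is not a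
zero divisor. -/
theorem genericForm_palindrome {L : List (Fin 2 × Bool)}
    (hL : wordReverse (FreeGroup.mk L) = MulOpposite.op (FreeGroup.mk L)) :
    (genericForm L).xx' = 0 := by
  have hP := isTraceFunction_tracePoly
  set u := letterX * letterX' with hu
  have e1 := tracePoly_mk_mul L u
  have e2 := tracePoly_mk_mul L (wordReverse u).unop
  have h1 : tracePoly (FreeGroup.mk L * (wordReverse u).unop) = tracePoly (FreeGroup.mk L * u) := by
    rw [← tracePoly_unop_wordReverse, map_mul, wordReverse_unop_wordReverse, hL,
      MulOpposite.unop_mul, MulOpposite.unop_op, MulOpposite.unop_op, hP.mul_comm]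
  have h2 : tracePoly (letterX * (wordReverse u).unop) = tracePoly (letterX * u) := by
    rw [← tracePoly_unop_wordReverse, map_mul, wordReverse_unop_wordReverse,
      wordReverse_letterX,
      MulOpposite.unop_mul, MulOpposite.unop_op, MulOpposite.unop_op, hP.mul_comm]
  have h3 : tracePoly (letterX' * (wordReverse u).unop) = tracePoly (letterX' * u) := by
    rw [← tracePoly_unop_wordReverse, map_mul, wordReverse_unop_wordReverse,
      wordReverse_letterX',
      MulOpposite.unop_mul, MulOpposite.unop_op, MulOpposite.unop_op, hP.mul_comm]
  have h4 : (wordReverse u).unop = letterX' * letterX := by simp [hu]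
  rw [h1, e1, h2, h3, tracePoly_unop_wordReverse, h4] at e2
  have e3 := tracePoly_commutator [(0, true), (1, true)]
  have h5 : FreeGroup.mk [((0 : Fin 2), true), (1, true)] = u := rfl
  have h6 : (genericForm [((0 : Fin 2), true), (1, true)]).xx' = 1 := by
    simp [genericForm, FrickeForm.ofWord, FrickeForm.step]
  have h7 : tracePoly (letterX' * (letterX * u)) =
      tracePoly (letterX * (letterX' * (letterX' * letterX))) := by
    rw [hu, hP.mul_comm letterX', hP.mul_comm letterX (letterX' * _)]
    simp only [mul_assoc]
    rw [hP.mul_comm letterX (letterX * _)]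
    simp only [mul_assoc]
    rw [hP.mul_comm letterX (letterX' * _)]
    simp only [mul_assoc]
  rw [h5, h6, h7, one_mul] at e3
  refine (mul_eq_zero.1 ?_).resolve_right commutatorPoly_ne_zero
  linear_combination e2 - (genericForm L).xx' * e3

/-- A word that acts as α + βx + γx' has commutator γ(xx' − x'x) with x. -/
theorem tracePoly_mul_swap {L : List (Fin 2 × Bool)} (hL : (genericForm L).xx' = 0)
    (v : FreeGroup (Fin 2)) :
    tracePoly (letterX * (FreeGroup.mk L * v)) - tracePoly (FreeGroup.mk L * (letterX * v)) =
      (genericForm L).x' *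
        (tracePoly (letterX * (letterX' * v)) - tracePoly (letterX' * (letterX * v))) := by
  have hP := isTraceFunction_tracePoly
  have e1 := tracePoly_mk_mul L (v * letterX)
  have e2 := tracePoly_mk_mul L (letterX * v)
  have e3 : tracePoly (letterX * (v * letterX)) = tracePoly (letterX * (letterX * v)) := by
    rw [hP.mul_comm, mul_assoc, hP.mul_comm, mul_assoc]
  have e4 : tracePoly (letterX' * (v * letterX)) = tracePoly (letterX * (letterX' * v)) := by
    rw [← mul_assoc, hP.mul_comm]
  have e5 : tracePoly (letterX * (FreeGroup.mk L * v)) =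
      tracePoly (FreeGroup.mk L * (v * letterX)) := by
    rw [hP.mul_comm, mul_assoc]
  rw [e5, e1, e2, hP.mul_comm v letterX, e3, e4, hL]
  ring

/-! ### Schubert's word is a palindrome; the factorisation of η -/

/-- The list of the letters of Schubert's word. -/
def schubertList (p q : ℕ) : List (Fin 2 × Bool) :=
  (List.range (2 * p - 1)).map fun j =>
    (if Even (j + 1) then 0 else 1, decide (Even ((j + 1) * q / (2 * p))))

theorem mk_eq_prod (L : List (Fin 2 × Bool)) :
    FreeGroup.mk L = (L.map fun l => FreeGroup.mk [l]).prod := by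
  induction L with
  | nil => rfl
  | cons l L ih =>
    rw [List.map_cons, List.prod_cons, ← ih, FreeGroup.mul_mk, List.singleton_append]

theorem mk_schubertList (p q : ℕ) : FreeGroup.mk (schubertList p q) = schubertWord p q := by
  rw [mk_eq_prod, schubertWord, schubertList, List.map_map]
  congr 1
  refine List.map_congr_left fun j _ => ?_
  have hX : FreeGroup.mk [((0 : Fin 2), false)] = letterX⁻¹ := rfl
  have hY : FreeGroup.mk [((1 : Fin 2), false)] = letterX'⁻¹ := rfl
  have hx : FreeGroup.mk [((0 : Fin 2), true)] = letterX := rfl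
  have hy : FreeGroup.mk [((1 : Fin 2), true)] = letterX' := rfl
  by_cases h1 : Even (j + 1) <;> by_cases h2 : Even ((j + 1) * q / (2 * p)) <;>
    simp [h1, h2, schubertSign, hX, hY, hx, hy, Function.comp]
  all_goals simp [Nat.not_even_iff_odd.1 h2]

theorem wordReverse_mk (L : List (Fin 2 × Bool)) :
    wordReverse (FreeGroup.mk L) = MulOpposite.op (FreeGroup.mk L.reverse) := by
  induction L with
  | nil => exact map_one _
  | cons l L ih =>
    rw [← List.singleton_append, ← FreeGroup.mul_mk, map_mul, ih, List.reverse_append,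
      ← FreeGroup.mul_mk, MulOpposite.op_mul]
    congr 1
    obtain ⟨i, _ | _⟩ := l
    · rw [show FreeGroup.mk [(i, false)] = (FreeGroup.of i)⁻¹ from rfl, map_inv]
      simp [wordReverse, FreeGroup.of]
      rfl
    · rw [show FreeGroup.mk [(i, true)] = FreeGroup.of i from rfl]
      simp [wordReverse, FreeGroup.of]

/-- The numbers jq and kq add up to 2pq and neither is divisible by 2p, so their remainders are
positive and add up to exactly 2p. -/
theorem mul_div_add_mul_div {p q : ℕ} (hcop : Nat.Coprime q (2 * p)) {j k : ℕ}
    (hj : 0 < j) (hk : 0 < k) (h : j + k = 2 * p) :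
    j * q / (2 * p) + k * q / (2 * p) + 1 = q := by
  have hn : 0 < 2 * p := by omega
  have hmod : ∀ i, 0 < i → i < 2 * p → i * q % (2 * p) ≠ 0 := fun i h0 h1 h2 =>
    absurd (Nat.le_of_dvd h0 (hcop.symm.dvd_of_dvd_mul_right (Nat.dvd_of_mod_eq_zero h2)))
      (by omega)
  have h1 := hmod j hj (by omega)
  have h2 := hmod k hk (by omega)
  have l1 := Nat.mod_lt (j * q) hn
  have l2 := Nat.mod_lt (k * q) hn
  have d1 := Nat.div_add_mod (j * q) (2 * p)
  have d2 := Nat.div_add_mod (k * q) (2 * p)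
  have e : j * q + k * q = 2 * p * q := by rw [← add_mul, h]
  set A := j * q / (2 * p)
  set B := k * q / (2 * p)
  set a := j * q % (2 * p)
  set b := k * q % (2 * p)
  set n := 2 * p
  have e2 : n * (A + B) + (a + b) = n * q := by rw [mul_add]; omega
  have hlt : A + B < q := by
    by_contra hc
    have := Nat.mul_le_mul_left n (not_lt.1 hc)
    omega
  have hgt : q < A + B + 2 := by
    by_contra hc
    have := Nat.mul_le_mul_left n (not_lt.1 hc)
    rw [mul_add] at this
    omega
  omega

theorem odd_of_coprime_two_mul {p q : ℕ} (hcop : Nat.Coprime q (2 * p)) : Odd q :=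
  Nat.coprime_two_right.1 (Nat.Coprime.coprime_mul_right_right hcop)

/-- The floors at j and 2p − j add up to q − 1, which is even because q is odd; so ε_j = ε_{2p−j}.
The parity of j, which selects the letter, is symmetric as well. -/
theorem schubertList_reverse {p q : ℕ} (hcop : Nat.Coprime q (2 * p)) :
    (schubertList p q).reverse = schubertList p q := by
  have hq := odd_of_coprime_two_mul hcop
  refine List.ext_getElem (by simp) fun i h1 h2 => ?_
  simp only [schubertList, List.getElem_reverse, List.getElem_map, List.getElem_range,
    List.length_map, List.length_range, Prod.mk.injEq, decide_eq_decide] at h2 ⊢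
  have hd := mul_div_add_mul_div hcop (j := 2 * p - 1 - 1 - i + 1) (k := i + 1) (by omega)
    (by omega) (by omega)
  constructor
  · congr 1
    rw [eq_iff_iff]
    simp only [Nat.even_iff]
    omega
  · rw [Nat.odd_iff] at hq
    simp only [Nat.even_iff]
    omega

/-- The factor of Schubert's polynomial that vanishes at the irreducible characters. -/
noncomputable def rileyPoly (p q : ℕ) : FrickeRing := (genericForm (schubertList p q)).x'

section

variable {p q : ℕ} (hcop : Nat.Coprime q (2 * p))
include hcop

theorem wordReverse_schubertWord :
    wordReverse (schubertWord p q) = MulOpposite.op (schubertWord p q) := by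
  rw [← mk_schubertList, wordReverse_mk, schubertList_reverse hcop]

theorem genericForm_schubertList : (genericForm (schubertList p q)).xx' = 0 :=
  genericForm_palindrome (by rw [mk_schubertList, wordReverse_schubertWord hcop])

/-- The key identity, used twice: one particular L gives η itself, and arbitrary L show that the
relation xw = wx has no trace consequences outside the ideal (η). -/
theorem tracePoly_schubertWord_swap (L : List (Fin 2 × Bool)) :
    tracePoly (letterX * (schubertWord p q * FreeGroup.mk L))
      - tracePoly (schubertWord p q * (letterX * FreeGroup.mk L)) =
      (genericForm L).xx' * (rileyPoly p q * commutatorPoly) := by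
  rw [← mk_schubertList, tracePoly_mul_swap (genericForm_schubertList hcop), tracePoly_commutator,
    rileyPoly]
  ring

theorem tracePoly_sub_eq :
    tracePoly (letterX⁻¹ * schubertWord p q * letterX * letterX'⁻¹)
      - tracePoly (schubertWord p q * letterX'⁻¹) = rileyPoly p q * commutatorPoly := by
  have hP := isTraceFunction_tracePoly
  -- The test word x'⁻¹x⁻¹ has xx'-coefficient −1, and by cyclicity the two traces become those in
  -- the definition of η in the opposite order.
  have h := tracePoly_schubertWord_swap hcop [(1, false), (0, false)]
  have h1 : (genericForm [(1, false), (0, false)]).xx' = -1 := by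
    simp [genericForm, FrickeForm.ofWord, FrickeForm.step]
  have h2 : FreeGroup.mk [((1 : Fin 2), false), (0, false)] = letterX'⁻¹ * letterX⁻¹ := rfl
  rw [h1, h2, hP.mul_comm letterX, ← mul_assoc, ← mul_assoc, inv_mul_cancel_right, ← mul_assoc,
    ← mul_assoc, hP.mul_comm _ letterX⁻¹] at h
  simp only [mul_assoc] at h ⊢
  linear_combination -h

end

/-! ### Weighted degree -/

/-- The weighted degree of the polynomial, with weights `1`, `1`, `2`, is at most `n`. -/
def WeightLE (n : ℤ) (P : FrickeRing) : Prop :=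
  ∀ d ∈ P.support, (d 0 + d 1 + 2 * d 2 : ℤ) ≤ n

namespace WeightLE

variable {m n : ℤ} {P Q : FrickeRing}

theorem mono (h : WeightLE m P) (hmn : m ≤ n) : WeightLE n P := fun d hd => (h d hd).trans hmn

theorem zero (n : ℤ) : WeightLE n 0 := fun d hd => by simp at hd

theorem add (hP : WeightLE n P) (hQ : WeightLE n Q) : WeightLE n (P + Q) := fun d hd => by
  classical
  rcases Finset.mem_union.1 (MvPolynomial.support_add hd) with h | h
  exacts [hP d h, hQ d h]

theorem neg (hP : WeightLE n P) : WeightLE n (-P) := fun d hd => hP d (by simpa using hd)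

theorem sub (hP : WeightLE n P) (hQ : WeightLE n Q) : WeightLE n (P - Q) := by
  rw [sub_eq_add_neg]; exact hP.add hQ.neg

theorem mul (hP : WeightLE m P) (hQ : WeightLE n Q) : WeightLE (m + n) (P * Q) := fun d hd => by
  classical
  obtain ⟨a, ha, b, hb, rfl⟩ := Finset.mem_add.1 (MvPolynomial.support_mul P Q hd)
  have h1 := hP a ha
  have h2 := hQ b hb
  simp only [Finsupp.add_apply]
  push_cast
  linarith

theorem C (c : ℂ) : WeightLE 0 (MvPolynomial.C c) := fun d hd => by
  classical
  rw [MvPolynomial.mem_support_iff, MvPolynomial.coeff_C] at hd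
  have : d = 0 := by by_contra h; exact hd (if_neg (Ne.symm h))
  simp [this]

theorem one : WeightLE 0 1 := by simpa using C 1

theorem X (i : Fin 3) : WeightLE (if i = 2 then 2 else 1) (MvPolynomial.X i) := fun d hd => by
  rw [MvPolynomial.support_X, Finset.mem_singleton] at hd
  subst hd
  fin_cases i <;> simp

theorem X_zero : WeightLE 1 (MvPolynomial.X 0) := X 0

theorem X_one : WeightLE 1 (MvPolynomial.X 1) := X 1

theorem X_two : WeightLE 2 (MvPolynomial.X 2) := X 2

end WeightLE

/-- If 1, x, x', xx' carry the weights 0, 1, 1, 2, then multiplication by a letter raises the total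
weight by at most one. The bounds are integers so that a negative one can express the vanishing of a
coefficient of the empty word. -/
theorem weightLE_genericForm (L : List (Fin 2 × Bool)) :
    WeightLE (L.length : ℤ) (genericForm L).one ∧ WeightLE (L.length - 1) (genericForm L).x ∧
      WeightLE (L.length - 1) (genericForm L).x' ∧ WeightLE (L.length - 2) (genericForm L).xx' := by
  induction L using List.reverseRecOn with
  | nil => exact ⟨WeightLE.one, WeightLE.zero _, WeightLE.zero _, WeightLE.zero _⟩
  | append_singleton L l ih =>
    obtain ⟨h1, h2, h3, h4⟩ := ih
    rw [genericForm, FrickeForm.ofWord_concat, ← genericForm, List.length_append,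
      List.length_singleton]
    push_cast
    set n : ℤ := (L.length : ℤ)
    set q := genericForm L
    have ha := WeightLE.X_zero.neg
    have hb := WeightLE.X_one.neg
    have hc := WeightLE.X_two.neg
    have hab := (hc.sub ((ha.mul hb).mono (by norm_num)))
    have k1 : WeightLE (n + 1) (-q.x + q.x' * (-MvPolynomial.X 2 - -MvPolynomial.X 0 *
        -MvPolynomial.X 1) - q.xx' * -MvPolynomial.X 1) :=
      (((h2.neg).mono (by linarith)).add ((h3.mul hab).mono (by linarith))).sub
        ((h4.mul hb).mono (by linarith))
    have k2 : WeightLE n (q.one + -MvPolynomial.X 0 * q.x + -MvPolynomial.X 1 * q.x' +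
        -MvPolynomial.X 2 * q.xx') :=
      ((h1.add ((ha.mul h2).mono (by linarith))).add ((hb.mul h3).mono (by linarith))).add
        ((hc.mul h4).mono (by linarith))
    have k3 : WeightLE n (-MvPolynomial.X 0 * q.x' + q.xx') :=
      ((ha.mul h3).mono (by linarith)).add (h4.mono (by linarith))
    have k4 : WeightLE n (q.one + -MvPolynomial.X 1 * q.x') :=
      h1.add ((hb.mul h3).mono (by linarith))
    have k5 : WeightLE (n - 1) (q.x + -MvPolynomial.X 1 * q.xx') :=
      h2.add ((hb.mul h4).mono (by linarith))
    obtain ⟨i, s⟩ := l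
    fin_cases i <;> cases s <;> simp only [FrickeForm.step]
    · exact ⟨((ha.mul h1).mono (by linarith)).sub k1,
        (((ha.mul h2).mono (by linarith)).sub k2).mono (by linarith),
        (((ha.mul h3).mono (by linarith)).sub k3).mono (by linarith),
        (((ha.mul h4).mono (by linarith)).add h3).mono (by linarith)⟩
    · exact ⟨k1, k2.mono (by linarith), k3.mono (by linarith), h3.neg.mono (by linarith)⟩
    · exact ⟨((hb.mul h1).mono (by linarith)).add (h3.mono (by linarith)),
        ((hb.mul h2).mono (by linarith)).add (h4.mono (by linarith)),
        (((hb.mul h3).mono (by linarith)).sub k4).mono (by linarith),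
        (((hb.mul h4).mono (by linarith)).sub k5).mono (by linarith)⟩
    · exact ⟨h3.neg.mono (by linarith), h4.neg.mono (by linarith), k4.mono (by linarith),
        k5.mono (by linarith)⟩

theorem weightLE_commutatorPoly : WeightLE 4 commutatorPoly := by
  have h0 := WeightLE.X_zero
  have h1 := WeightLE.X_one
  have h2 := WeightLE.X_two
  rw [commutatorPoly, pow_two, pow_two, pow_two]
  exact ((((h0.mul h0).mono (by norm_num)).add ((h1.mul h1).mono (by norm_num))).add
    ((h2.mul h2).mono (by norm_num))).add (((h0.mul h1).mul h2).mono (by norm_num)) |>.sub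
    ((WeightLE.C 4).mono (by norm_num))

/-- Schubert's polynomial, the product of its irreducible and its reducible factor. -/
noncomputable def schubertPoly (p q : ℕ) : FrickeRing := rileyPoly p q * commutatorPoly

theorem weightLE_schubertPoly {p : ℕ} (hp : 0 < p) (q : ℕ) :
    WeightLE (2 * p + 2) (schubertPoly p q) := by
  refine ((weightLE_genericForm _).2.2.1.mul weightLE_commutatorPoly).mono ?_
  rw [schubertList, List.length_map, List.length_range]
  omega

/-! ### The specialisation x̄ = x̄' = 0, Chebyshev polynomials and squarefreeness -/

open Polynomial in
/-- The specialisation at `x̄ = x̄' = 0`. -/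
noncomputable def specialize : FrickeRing →ₐ[ℂ] ℂ[X] := MvPolynomial.aeval ![0, 0, X]

open Polynomial Polynomial.Chebyshev in
-- Letters of trace zero satisfy x⁻¹ = −x, so all exponents collapse into one global sign and the
-- word becomes ±x'(xx')ⁿ, which Cayley–Hamilton for xx' turns into the Chebyshev recursion.
theorem ofWord_alternating (s : ℕ → Bool) (n : ℕ) : ∃ e : ℂ[X], (e = 1 ∨ e = -1) ∧
    FrickeForm.ofWord (0 : ℂ[X]) 0 (-X)
      ((List.range (2 * n + 1)).map fun j => (if Even (j + 1) then 0 else 1, s j)) =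
      ⟨0, -e * S ℂ (n - 1), e * S ℂ n, 0⟩ := by
  induction n with
  | zero =>
    cases h : s 0
    · exact ⟨-1, .inr rfl, by simp [FrickeForm.ofWord, FrickeForm.step, h]⟩
    · exact ⟨1, .inl rfl, by simp [FrickeForm.ofWord, FrickeForm.step, h]⟩
  | succ n ih =>
    obtain ⟨e, he, h⟩ := ih
    rw [show 2 * (n + 1) + 1 = 2 * n + 1 + 1 + 1 by ring, List.range_succ, List.range_succ,
      List.map_append, List.map_append, List.map_singleton, List.map_singleton,
      FrickeForm.ofWord_concat, FrickeForm.ofWord_concat, h]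
    have h1 : Even (2 * n + 1 + 1) := ⟨n + 1, by ring⟩
    have h2 : ¬Even (2 * n + 1 + 1 + 1) := by rw [Nat.not_even_iff_odd]; exact ⟨n + 1, by ring⟩
    rw [if_pos h1, if_neg h2]
    have hS := S_add_one ℂ n
    push_cast
    rw [add_sub_cancel_right, hS]
    cases s (2 * n + 1) <;> cases s (2 * n + 1 + 1)
    · refine ⟨-e, by rcases he with rfl | rfl <;> simp, ?_⟩
      simp only [FrickeForm.step]
      ext1 <;> dsimp only <;> ring
    · refine ⟨e, he, ?_⟩
      simp only [FrickeForm.step]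
      ext1 <;> dsimp only <;> ring
    · refine ⟨e, he, ?_⟩
      simp only [FrickeForm.step]
      ext1 <;> dsimp only <;> ring
    · refine ⟨-e, by rcases he with rfl | rfl <;> simp, ?_⟩
      simp only [FrickeForm.step]
      ext1 <;> dsimp only <;> ring

open Polynomial Polynomial.Chebyshev in
theorem specialize_schubertPoly {p : ℕ} (hp : 0 < p) (q : ℕ) : ∃ e : ℂ, (e = 1 ∨ e = -1) ∧
    specialize (schubertPoly p q) = Polynomial.C e * ((X ^ 2 - 4) * S ℂ (p - 1)) := by
  obtain ⟨n, rfl⟩ : ∃ n, p = n + 1 := ⟨p - 1, by omega⟩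
  obtain ⟨e, he, h⟩ := ofWord_alternating (fun j => decide (Even ((j + 1) * q / (2 * (n + 1))))) n
  have hm := FrickeForm.map_ofWord (specialize : FrickeRing →+* ℂ[X]) (-MvPolynomial.X 0)
    (-MvPolynomial.X 1) (-MvPolynomial.X 2) (schubertList (n + 1) q)
  have e0 : specialize (MvPolynomial.X 0) = 0 := by simp [specialize]
  have e1 : specialize (MvPolynomial.X 1) = 0 := by simp [specialize]
  have e2 : specialize (MvPolynomial.X 2) = X := by simp [specialize]
  rw [schubertList, show 2 * (n + 1) - 1 = 2 * n + 1 by omega] at hm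
  simp only [RingHom.coe_coe, map_neg, e0, e1, e2, neg_zero] at hm
  rw [h] at hm
  have hr : specialize (rileyPoly (n + 1) q) = e * S ℂ n := congrArg FrickeForm.x' hm
  have hk : specialize commutatorPoly = X ^ 2 - 4 := by
    have e4 : specialize 4 = 4 := map_ofNat _ 4
    simp [commutatorPoly, e0, e1, e2, e4]
  rw [schubertPoly, map_mul, hr, hk]
  push_cast
  rw [add_sub_cancel_right]
  rcases he with rfl | rfl
  · exact ⟨1, .inl rfl, by simp; ring⟩
  · exact ⟨-1, .inr rfl, by simp; ring⟩

open Polynomial Polynomial.Chebyshev in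
theorem monic_chebyshev_S (n : ℕ) : (S ℂ n).Monic ∧ (S ℂ n).natDegree = n := by
  induction n using Nat.twoStepInduction with
  | zero => simp
  | one => simp
  | more n h1 h2 =>
    have hS := S_add_two ℂ n
    push_cast at h2 ⊢
    have hm : (X * S ℂ (n + 1)).Monic := monic_X.mul h2.1
    have hd : (X * S ℂ (n + 1)).natDegree = n + 2 := by
      rw [monic_X.natDegree_mul h2.1, h2.2, natDegree_X]; ring
    have hlt : (S ℂ n).degree < (X * S ℂ (n + 1)).degree := by
      apply degree_lt_degree
      rw [hd, h1.2]; omega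
    rw [hS]
    refine ⟨hm.sub_of_left hlt, ?_⟩
    rw [natDegree_sub_eq_left_of_natDegree_lt (by rw [hd, h1.2]; omega), hd]

open Polynomial Polynomial.Chebyshev in
theorem monic_specialization {p : ℕ} (hp : 0 < p) :
    ((X ^ 2 - 4) * S ℂ (p - 1)).Monic ∧ ((X ^ 2 - 4) * S ℂ (p - 1)).natDegree = p + 1 := by
  obtain ⟨n, rfl⟩ : ∃ n, p = n + 1 := ⟨p - 1, by omega⟩
  push_cast
  rw [add_sub_cancel_right]
  have hm : (X ^ 2 - 4 : ℂ[X]).Monic := monic_X_pow_sub_C 4 two_ne_zero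
  have hd : (X ^ 2 - 4 : ℂ[X]).natDegree = 2 := natDegree_X_pow_sub_C (r := 4)
  have hS := monic_chebyshev_S n
  exact ⟨hm.mul hS.1, by rw [hm.natDegree_mul hS.1, hd, hS.2]; ring⟩

open Polynomial Polynomial.Chebyshev in
-- The polynomial is monic of degree p + 1 and has p + 1 distinct roots, so it is the product of the
-- corresponding linear factors.
theorem squarefree_specialization {p : ℕ} (hp : 0 < p) :
    Squarefree ((X ^ 2 - 4) * S ℂ (p - 1)) := by
  obtain ⟨hm, hd⟩ := monic_specialization hp
  set F := (X ^ 2 - 4) * S ℂ (p - 1) with hF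
  -- The indices 0 and p give the roots ±2 of X² − 4; the others give the roots of the Chebyshev
  -- factor.
  let r : Fin (p + 1) → ℂ := fun k => ((2 * Real.cos (k * Real.pi / p) : ℝ) : ℂ)
  have hp' : (0 : ℝ) < p := Nat.cast_pos.2 hp
  have hr : Function.Injective r := by
    intro j k h
    have h1 : Real.cos (j * Real.pi / p) = Real.cos (k * Real.pi / p) := by
      have := Complex.ofReal_injective h
      linarith
    have hmem : ∀ k : Fin (p + 1), (k * Real.pi / p : ℝ) ∈ Set.Icc 0 Real.pi := fun k => by
      have hk : (k : ℝ) ≤ p := Nat.cast_le.2 (Nat.lt_succ_iff.1 k.2)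
      refine ⟨by positivity, ?_⟩
      rw [div_le_iff₀ hp', mul_comm]
      exact mul_le_mul_of_nonneg_left hk Real.pi_pos.le
    have h2 := Real.injOn_cos (hmem j) (hmem k) h1
    have h3 : (j : ℝ) = k := by
      have := Real.pi_pos
      field_simp at h2
      exact h2
    exact Fin.ext (by exact_mod_cast h3)
  have hroot : ∀ k, F.eval (r k) = 0 := by
    intro k
    rw [hF, eval_mul]
    set θ : ℝ := k * Real.pi / p
    have hs := S_two_mul_complex_cos (θ : ℂ) (p - 1)
    have hpθ : (((p - 1 : ℤ) : ℂ) + 1) * (θ : ℂ) = k * Real.pi := by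
      have : (p : ℂ) ≠ 0 := Nat.cast_ne_zero.2 hp.ne'
      simp only [θ]
      push_cast
      field_simp
      ring
    rw [hpθ, Complex.sin_nat_mul_pi] at hs
    have hrk : r k = 2 * Complex.cos θ := by simp [r, θ]
    rw [hrk]
    rcases mul_eq_zero.1 hs with h | h
    · rw [h, mul_zero]
    · have h4 : (X ^ 2 - 4 : ℂ[X]).eval (2 * Complex.cos θ) = 0 := by
        have h5 := Complex.sin_sq_add_cos_sq θ
        rw [h] at h5
        have h6 : (4 : ℂ[X]).eval (2 * Complex.cos θ) = 4 := eval_ofNat 4 _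
        rw [eval_sub, eval_pow, eval_X, h6]
        linear_combination 4 * h5
      rw [h4, zero_mul]
  have hsep : (∏ k, (X - Polynomial.C (r k))).Separable := separable_prod_X_sub_C_iff.2 hr
  have hdvd : (∏ k, (X - Polynomial.C (r k))) ∣ F :=
    Finset.prod_dvd_of_coprime
      (fun i _ j _ hij => pairwise_coprime_X_sub_C hr hij)
      fun k _ => dvd_iff_isRoot.2 (hroot k)
  have hpm : (∏ k, (X - Polynomial.C (r k))).Monic := monic_prod_of_monic _ _
    fun k _ => monic_X_sub_C _
  have heq := eq_of_monic_of_dvd_of_natDegree_le hpm hm hdvd (by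
    rw [hd, natDegree_prod_of_monic _ _ fun k _ => monic_X_sub_C _]; simp)
  rw [heq]
  exact hsep.squarefree

open Polynomial in
theorem coeff_specialize (P : FrickeRing) (k : ℕ) :
    (specialize P).coeff k = MvPolynomial.coeff (Finsupp.single 2 k) P := by
  classical
  induction P using MvPolynomial.induction_on' with
  | monomial d c =>
    have h : specialize (MvPolynomial.monomial d c) =
        Polynomial.C c * (0 ^ d 0 * 0 ^ d 1 * X ^ d 2) := by
      rw [specialize, MvPolynomial.aeval_monomial, Finsupp.prod_fintype _ _ (by simp),
        Fin.prod_univ_three]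
      rfl
    rw [h, MvPolynomial.coeff_monomial]
    have hd : d = Finsupp.single 2 k ↔ d 0 = 0 ∧ d 1 = 0 ∧ d 2 = k := by
      refine ⟨by rintro rfl; simp, fun ⟨h0, h1, h2⟩ => Finsupp.ext fun i => ?_⟩
      fin_cases i <;> simp [h0, h1, h2]
    by_cases h0 : d 0 = 0
    · by_cases h1 : d 1 = 0
      · simp [hd, h0, h1, coeff_X_pow, eq_comm]
      · simp [hd, h0, h1]
    · simp [hd, h0]
  | add P Q hP hQ => rw [map_add, coeff_add, hP, hQ, MvPolynomial.coeff_add]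

theorem coeff_schubertPoly {p : ℕ} (hp : 0 < p) (q : ℕ) : ∃ e : ℂ, (e = 1 ∨ e = -1) ∧
    MvPolynomial.coeff (Finsupp.single 2 (p + 1)) (schubertPoly p q) = e := by
  obtain ⟨e, he, h⟩ := specialize_schubertPoly hp q
  obtain ⟨hm, hd⟩ := monic_specialization hp
  refine ⟨e, he, ?_⟩
  rw [← coeff_specialize, h, Polynomial.coeff_C_mul, ← hd, hm.coeff_natDegree, mul_one]

/-- The weight is at most 2p + 2 and ȳ weighs 2, so a monomial with ȳ-exponent p + 1 has no room for
x̄ or x̄'. The only such monomial is the pure power, whose coefficient survives the specialisation.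
-/
theorem degreeOf_schubertPoly {p : ℕ} (hp : 0 < p) (q : ℕ) :
    MvPolynomial.degreeOf 2 (schubertPoly p q) = p + 1 ∧ ∃ c : ℂ, (c = 1 ∨ c = -1) ∧
      MvPolynomial.degreeOf 2
        (schubertPoly p q - MvPolynomial.C c * MvPolynomial.X 2 ^ (p + 1)) < p + 1 := by
  classical
  obtain ⟨e, he, h⟩ := coeff_schubertPoly hp q
  have he0 : e ≠ 0 := by rcases he with rfl | rfl <;> norm_num
  have hw := weightLE_schubertPoly hp q
  refine ⟨le_antisymm ?_ ?_, e, he, ?_⟩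
  · rw [MvPolynomial.degreeOf_le_iff]
    intro d hd
    have := hw d hd
    omega
  · have := MvPolynomial.monomial_le_degreeOf 2 (MvPolynomial.mem_support_iff.2 (h.trans_ne he0))
    simpa using this
  · rw [MvPolynomial.degreeOf_lt_iff (by omega)]
    intro d hd
    by_contra hlt
    rw [MvPolynomial.X_pow_eq_monomial, MvPolynomial.C_mul_monomial, mul_one,
      MvPolynomial.mem_support_iff, MvPolynomial.coeff_sub, MvPolynomial.coeff_monomial] at hd
    by_cases hs : Finsupp.single 2 (p + 1) = d
    · rw [if_pos hs, ← hs, h, sub_self] at hd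
      exact hd rfl
    · rw [if_neg hs, sub_zero] at hd
      have := hw d (MvPolynomial.mem_support_iff.2 hd)
      refine hs (Finsupp.ext fun i => ?_)
      fin_cases i
      · simp; omega
      · simp; omega
      · simp; omega

open Polynomial in
-- A repeated factor divides a polynomial with unit leading coefficient, so its own leading
-- coefficient is a unit and its degree survives the reduction. There it is a unit, hence of degree
-- zero; so it equals its leading coefficient.
theorem squarefree_of_squarefree_map {B K : Type*} [CommRing B] [IsDomain B] [Field K] (f : B →+* K)
    {H : B[X]} (hu : IsUnit H.leadingCoeff) (hH : Squarefree (H.map f)) : Squarefree H := by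
  rintro d ⟨e, rfl⟩
  rw [leadingCoeff_mul, leadingCoeff_mul] at hu
  have hd : IsUnit d.leadingCoeff := isUnit_of_mul_isUnit_left (isUnit_of_mul_isUnit_left hu)
  have h1 : IsUnit (d.map f) := hH _ ⟨e.map f, by simp⟩
  have h2 : (d.map f).natDegree = d.natDegree :=
    natDegree_map_of_leadingCoeff_ne_zero f (hd.map f).ne_zero
  have h3 : d.natDegree = 0 := h2 ▸ natDegree_eq_zero_of_isUnit h1
  rw [leadingCoeff, h3] at hd
  rw [eq_C_of_natDegree_eq_zero h3]
  exact hd.map C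

open Polynomial in
/-- `FrickeRing` as a ring of polynomials in its last variable. -/
noncomputable def lastVariableEquiv : FrickeRing ≃ₐ[ℂ] (MvPolynomial (Fin 2) ℂ)[X] :=
  -- `finSuccEquiv` singles out the variable 0, so ȳ is moved there.
  (MvPolynomial.renameEquiv ℂ (Equiv.swap 0 2)).trans (MvPolynomial.finSuccEquiv ℂ 2)

theorem natDegree_lastVariableEquiv (P : FrickeRing) :
    (lastVariableEquiv P).natDegree = MvPolynomial.degreeOf 2 P := by
  rw [lastVariableEquiv, AlgEquiv.trans_apply, MvPolynomial.natDegree_finSuccEquiv,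
    MvPolynomial.renameEquiv_apply]
  exact MvPolynomial.degreeOf_rename_of_injective (p := P) (Equiv.swap (0 : Fin 3) 2).injective 2

theorem lastVariableEquiv_X_two : lastVariableEquiv (MvPolynomial.X 2) = Polynomial.X := by
  simp [lastVariableEquiv, MvPolynomial.finSuccEquiv_X_zero]

theorem map_lastVariableEquiv (P : FrickeRing) :
    (lastVariableEquiv P).map (MvPolynomial.eval 0) = specialize P := by
  have h : ((Polynomial.mapRingHom (MvPolynomial.eval (0 : Fin 2 → ℂ))).comp
      (lastVariableEquiv : FrickeRing →+* _)) = (specialize : FrickeRing →+* _) := by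
    refine MvPolynomial.ringHom_ext (fun c => ?_) fun i => ?_
    · simp [lastVariableEquiv, specialize, MvPolynomial.finSuccEquiv_apply]
    · have h1 : (Equiv.swap (0 : Fin 3) 2) 1 = Fin.succ 0 := by decide
      have h2 : (2 : Fin 3) = Fin.succ 1 := rfl
      fin_cases i
      · simp [lastVariableEquiv, specialize]
        rw [h2, MvPolynomial.finSuccEquiv_X_succ]
        simp
      · simp [lastVariableEquiv, specialize, h1]
        rw [show (1 : Fin 3) = Fin.succ 0 from rfl, MvPolynomial.finSuccEquiv_X_succ]
        simp
      · simp [lastVariableEquiv, specialize, MvPolynomial.finSuccEquiv_X_zero]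
  exact DFunLike.congr_fun h P

theorem squarefree_schubertPoly {p : ℕ} (hp : 0 < p) (q : ℕ) : Squarefree (schubertPoly p q) := by
  obtain ⟨-, c, hc, hlt⟩ := degreeOf_schubertPoly hp q
  have hc0 : c ≠ 0 := by rcases hc with rfl | rfl <;> norm_num
  set P := schubertPoly p q
  have hsq : Squarefree (lastVariableEquiv P) := by
    refine squarefree_of_squarefree_map (MvPolynomial.eval 0) ?_ ?_
    · have h1 := natDegree_lastVariableEquiv (P - MvPolynomial.C c * MvPolynomial.X 2 ^ (p + 1))
      have h2 : lastVariableEquiv P = lastVariableEquiv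
          (P - MvPolynomial.C c * MvPolynomial.X 2 ^ (p + 1)) +
          Polynomial.C (MvPolynomial.C c) * Polynomial.X ^ (p + 1) := by
        rw [map_sub, map_mul, map_pow, lastVariableEquiv_X_two]
        have : lastVariableEquiv (MvPolynomial.C c) = Polynomial.C (MvPolynomial.C c) :=
          lastVariableEquiv.commutes c
        rw [this, sub_add_cancel]
      have h3 : (Polynomial.C (MvPolynomial.C c : MvPolynomial (Fin 2) ℂ) *
          Polynomial.X ^ (p + 1)).natDegree = p + 1 :=
        Polynomial.natDegree_C_mul_X_pow _ _ (by simpa using hc0)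
      rw [h2, Polynomial.leadingCoeff_add_of_degree_lt (Polynomial.degree_lt_degree (by omega)),
        Polynomial.leadingCoeff_C_mul_X_pow]
      exact (isUnit_iff_ne_zero.2 hc0).map MvPolynomial.C
    · rw [map_lastVariableEquiv]
      obtain ⟨e, he, h⟩ := specialize_schubertPoly hp q
      have he0 : e ≠ 0 := by rcases he with rfl | rfl <;> norm_num
      rw [h]
      have hu : IsUnit (Polynomial.C e) := (isUnit_iff_ne_zero.2 he0).map Polynomial.C
      exact (squarefree_specialization hp).squarefree_of_dvd
        ((associated_unit_mul_left _ _ hu).dvd)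
  intro d hd
  have := hsq (lastVariableEquiv d) (by simpa using map_dvd lastVariableEquiv hd)
  exact (MulEquiv.isUnit_map lastVariableEquiv).1 this

/-! ### Representations at the zeros of η -/

theorem coe_map_mul {G : Type*} [Group G] (ρ : G →* Matrix.SpecialLinearGroup (Fin 2) ℂ) (g h : G) :
    (ρ (g * h) : Matrix (Fin 2) (Fin 2) ℂ) = (ρ g : Matrix (Fin 2) (Fin 2) ℂ) * ρ h := by
  rw [map_mul]
  rfl

open Matrix in
-- The matrices are those that realise arbitrary traces. When κ ≠ 0, the images of 1, x, x', xx'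
-- span all 2×2 matrices, so only the zero matrix is trace-orthogonal to the image.
theorem exists_representation_nondegenerate (v : Fin 3 → ℂ) :
    ∃ ρ : FreeGroup (Fin 2) →* Matrix.SpecialLinearGroup (Fin 2) ℂ,
      ![-repTrace ρ letterX, -repTrace ρ letterX', -repTrace ρ (letterX * letterX')] = v ∧
      (MvPolynomial.eval v commutatorPoly ≠ 0 → ∀ D : Matrix (Fin 2) (Fin 2) ℂ,
        (∀ u, (D * (ρ u : Matrix (Fin 2) (Fin 2) ℂ)).trace = 0) → D = 0) := by
  obtain ⟨t, ht⟩ := IsAlgClosed.exists_aeval_eq_zero ℂ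
    (Polynomial.X ^ 2 - Polynomial.C (-v 2) * Polynomial.X + 1 : Polynomial ℂ) (by
      have : (Polynomial.X ^ 2 - Polynomial.C (-v 2) * Polynomial.X + 1 : Polynomial ℂ).degree
          = 2 := by compute_degree!
      rw [this]; decide)
  simp only [map_add, map_sub, map_mul, map_pow, Polynomial.aeval_X, Polynomial.aeval_C,
    Algebra.algebraMap_self, RingHom.id_apply, map_one] at ht
  have h0 : t ≠ 0 := by rintro rfl; simp at ht
  obtain ⟨s, hs⟩ : ∃ s, s = t⁻¹ := ⟨_, rfl⟩
  have hst : t * s = 1 := by rw [hs, mul_inv_cancel₀ h0]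
  have hv2 : v 2 = -(t + s) := by
    linear_combination s * ht + (-t - v 2) * hst
  set ρ : FreeGroup (Fin 2) →* Matrix.SpecialLinearGroup (Fin 2) ℂ := FreeGroup.lift
    ![⟨!![-v 0, -1; 1, 0], by simp⟩, ⟨!![0, t; -s, -v 1], by simp [hst]⟩] with hρ
  have hx : (ρ letterX : Matrix (Fin 2) (Fin 2) ℂ) = !![-v 0, -1; 1, 0] := by
    simp [hρ, letterX]
  have hy : (ρ letterX' : Matrix (Fin 2) (Fin 2) ℂ) = !![0, t; -s, -v 1] := by
    simp [hρ, letterX']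
  have hxy : (ρ (letterX * letterX') : Matrix (Fin 2) (Fin 2) ℂ) =
      !![s, -v 0 * t + v 1; 0, t] := by
    rw [coe_map_mul, hx, hy]
    simp
  refine ⟨ρ, funext fun i => ?_, fun hk D hD => ?_⟩
  · fin_cases i
    · simp [repTrace, hx, trace_fin_two]
    · simp [repTrace, hy, trace_fin_two]
    · change -repTrace ρ (letterX * letterX') = v 2
      rw [repTrace, hxy, trace_fin_two, hv2]
      simp
      ring
  · have e1 : D 0 0 + D 1 1 = 0 := by simpa [trace_fin_two] using hD 1
    have e2 := hD letterX
    have e3 := hD letterX'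
    have e4 := hD (letterX * letterX')
    rw [hx] at e2
    rw [hy] at e3
    rw [hxy] at e4
    simp only [trace_fin_two, Matrix.mul_apply,
      Fin.sum_univ_two, of_apply, cons_val', cons_val_zero, cons_val_one, cons_val_fin_one]
      at e2 e3 e4
    have h4 : MvPolynomial.eval v (4 : FrickeRing) = 4 := map_ofNat _ 4
    simp only [commutatorPoly, map_sub, map_add, map_mul, map_pow, MvPolynomial.eval_X, h4] at hk
    have f1 : D 1 1 = -D 0 0 := by linear_combination e1
    have f2 : D 0 1 = D 1 0 + v 0 * D 0 0 := by linear_combination e2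
    have f3 : D 1 0 * (t - s) + D 0 0 * (v 1 - s * v 0) = 0 := by
      rw [f1, f2] at e3; linear_combination e3
    have f4 : D 0 0 * (s - t) + D 1 0 * (v 1 - v 0 * t) = 0 := by
      rw [f1] at e4; linear_combination e4
    -- Up to sign this is the determinant of the system `f3`, `f4` in the two remaining entries of
    -- D; since st = 1, it is the value of κ at v.
    have hdet : (v 1 - s * v 0) * (v 1 - v 0 * t) + (t - s) ^ 2 ≠ 0 := by
      intro h; apply hk; rw [hv2]
      linear_combination h + (4 - v 0 ^ 2) * hst
    have g1 : D 0 0 = 0 := by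
      refine (mul_eq_zero.1 ?_).resolve_right hdet
      linear_combination (v 1 - v 0 * t) * f3 - (t - s) * f4
    have g2 : D 1 0 = 0 := by
      refine (mul_eq_zero.1 ?_).resolve_right hdet
      linear_combination (t - s) * f3 + (v 1 - s * v 0) * f4
    ext i j
    fin_cases i <;> fin_cases j <;> simp [f1, f2, g1, g2]

/-- The diagonal matrices of determinant one. -/
def diagonalRep : ℂˣ →* Matrix.SpecialLinearGroup (Fin 2) ℂ where
  toFun u := ⟨!![(u : ℂ), 0; 0, (u⁻¹ : ℂˣ)], by simp⟩
  map_one' := by ext i j; fin_cases i <;> fin_cases j <;> simp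
  map_mul' u v := Subtype.ext (by
    change _ = !![(u : ℂ), 0; 0, (u⁻¹ : ℂˣ)] * !![(v : ℂ), 0; 0, (v⁻¹ : ℂˣ)]
    simp [mul_comm])

theorem coe_diagonalRep (u : ℂˣ) :
    (diagonalRep u : Matrix (Fin 2) (Fin 2) ℂ) = !![(u : ℂ), 0; 0, (u⁻¹ : ℂˣ)] := rfl

theorem exists_add_inv_eq (a : ℂ) : ∃ s : ℂˣ, (s : ℂ) + (s⁻¹ : ℂˣ) = a := by
  obtain ⟨t, ht⟩ := IsAlgClosed.exists_aeval_eq_zero ℂ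
    (Polynomial.X ^ 2 - Polynomial.C a * Polynomial.X + 1 : Polynomial ℂ) (by
      have : (Polynomial.X ^ 2 - Polynomial.C a * Polynomial.X + 1 : Polynomial ℂ).degree = 2 := by
        compute_degree!
      rw [this]; decide)
  simp only [map_add, map_sub, map_mul, map_pow, Polynomial.aeval_X, Polynomial.aeval_C,
    Algebra.algebraMap_self, RingHom.id_apply, map_one] at ht
  have h0 : t ≠ 0 := by rintro rfl; simp at ht
  refine ⟨Units.mk0 t h0, ?_⟩
  simp
  field_simp
  linear_combination ht

/-- For −v₀ = s + s⁻¹ and −v₁ = t + t⁻¹, κ is the product of v₂ + st + s⁻¹t⁻¹ and v₂ + st⁻¹ + s⁻¹t.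
Diagonal matrices with entries s and t serve for the first factor; replacing t by t⁻¹ serves for the
second. -/
theorem exists_commutative_representation (v : Fin 3 → ℂ)
    (hv : MvPolynomial.eval v commutatorPoly = 0) :
    ∃ ρ : FreeGroup (Fin 2) →* Matrix.SpecialLinearGroup (Fin 2) ℂ,
      ![-repTrace ρ letterX, -repTrace ρ letterX', -repTrace ρ (letterX * letterX')] = v ∧
      ∀ u z, ρ (u * z) = ρ (z * u) := by
  have key : ∀ s t : ℂˣ, -(s + (s⁻¹ : ℂˣ) : ℂ) = v 0 → -(t + (t⁻¹ : ℂˣ) : ℂ) = v 1 →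
      -(s * t + (s⁻¹ : ℂˣ) * (t⁻¹ : ℂˣ) : ℂ) = v 2 →
      ∃ ρ : FreeGroup (Fin 2) →* Matrix.SpecialLinearGroup (Fin 2) ℂ,
      ![-repTrace ρ letterX, -repTrace ρ letterX', -repTrace ρ (letterX * letterX')] = v ∧
      ∀ u z, ρ (u * z) = ρ (z * u) := by
    intro s t h0 h1 h2
    refine ⟨diagonalRep.comp (FreeGroup.lift ![s, t]), funext fun i => ?_, fun u z => ?_⟩
    · fin_cases i
      · refine Eq.trans ?_ h0
        simp [repTrace, coe_diagonalRep, letterX, Matrix.trace_fin_two]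
      · refine Eq.trans ?_ h1
        simp [repTrace, coe_diagonalRep, letterX', Matrix.trace_fin_two]
      · refine Eq.trans ?_ h2
        simp only [repTrace, coe_map_mul]
        simp [coe_diagonalRep, letterX, letterX', Matrix.trace_fin_two]
    · simp only [MonoidHom.comp_apply]
      rw [map_mul, map_mul (FreeGroup.lift ![s, t]) z, mul_comm]
  obtain ⟨s, hs⟩ := exists_add_inv_eq (-v 0)
  obtain ⟨t, ht⟩ := exists_add_inv_eq (-v 1)
  have h4 : MvPolynomial.eval v (4 : FrickeRing) = 4 := map_ofNat _ 4
  simp only [commutatorPoly, map_sub, map_add, map_mul, map_pow, MvPolynomial.eval_X, h4] at hv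
  have hss : (s : ℂ) * (s⁻¹ : ℂˣ) = 1 := s.mul_inv
  have htt : (t : ℂ) * (t⁻¹ : ℂˣ) = 1 := t.mul_inv
  generalize hs' : ((s⁻¹ : ℂˣ) : ℂ) = s' at *
  generalize ht' : ((t⁻¹ : ℂˣ) : ℂ) = t' at *
  have hprod : (v 2 + (s * t + s' * t')) * (v 2 + (s * t' + s' * t)) = 0 := by
    have e0 : v 0 = -(s + s') := by rw [hs]; ring
    have e1 : v 1 = -(t + t') := by rw [ht]; ring
    rw [e0, e1] at hv
    linear_combination hv + (t ^ 2 + t' ^ 2 - 2) * hss + (s ^ 2 + s' ^ 2 - 2) * htt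
  rcases mul_eq_zero.1 hprod with h | h
  · exact key s t (by rw [hs', hs]; ring) (by rw [ht', ht]; ring)
      (by rw [hs', ht']; linear_combination -h)
  · exact key s t⁻¹ (by rw [hs', hs]; ring) (by rw [inv_inv, ht', add_comm, ht]; ring)
      (by rw [hs', inv_inv, ht']; linear_combination -h)

/-- Where κ = 0, commuting matrices satisfy the relation. Elsewhere γ = 0, so the commutator of the
images of x and w is trace-orthogonal to the whole image and vanishes by nondegeneracy. -/
theorem exists_representation_of_eval_schubertPoly_eq_zero {p q : ℕ}
    (hcop : Nat.Coprime q (2 * p)) (v : Fin 3 → ℂ)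
    (hv : MvPolynomial.eval v (schubertPoly p q) = 0) :
    ∃ ρ : FreeGroup (Fin 2) →* Matrix.SpecialLinearGroup (Fin 2) ℂ,
      ![-repTrace ρ letterX, -repTrace ρ letterX', -repTrace ρ (letterX * letterX')] = v ∧
      ρ (letterX * schubertWord p q) = ρ (schubertWord p q * letterX) := by
  by_cases hk : MvPolynomial.eval v commutatorPoly = 0
  · obtain ⟨ρ, h1, h2⟩ := exists_commutative_representation v hk
    exact ⟨ρ, h1, h2 _ _⟩
  · rw [schubertPoly, map_mul, mul_eq_zero, or_iff_left hk] at hv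
    obtain ⟨ρ, h1, h2⟩ := exists_representation_nondegenerate v
    refine ⟨ρ, h1, Subtype.ext (sub_eq_zero.1 (h2 hk _ fun u => ?_))⟩
    have h := congrArg (MvPolynomial.eval v)
      (tracePoly_mul_swap (genericForm_schubertList hcop) u)
    rw [map_mul, ← rileyPoly, hv, zero_mul, map_sub, ← h1, isTracePolynomial_tracePoly _ ρ,
      isTracePolynomial_tracePoly _ ρ, mk_schubertList] at h
    rw [Matrix.sub_mul, Matrix.trace_sub, ← coe_map_mul, ← coe_map_mul, mul_assoc, mul_assoc]
    exact h

/-! ### The two algebras of a group with Schubert's presentation -/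

theorem isTraceFunction_universalTrace (G : Type*) [Group G] :
    IsTraceFunction (universalTrace : G → UniversalCharacterRing G) where
  one := by
    rw [universalTrace, ← map_ofNat (Ideal.Quotient.mk (traceRelations G)) 2, Ideal.Quotient.eq]
    exact Ideal.subset_span (.inl rfl)
  mul g h := by
    simp only [universalTrace]
    rw [← map_mul, ← map_add, Ideal.Quotient.eq, ← sub_sub]
    exact Ideal.subset_span (.inr ⟨g, h, rfl⟩)

theorem isTraceFunction_traceFunction (G : Type*) [Group G] :
    IsTraceFunction (traceFunction : G → CharacterRing G) where
  one := by
    refine Subtype.ext (funext fun ⟨χ, ρ, hρ⟩ => ?_)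
    subst hρ
    exact (isTraceFunction_repTrace ρ).one
  mul g h := by
    refine Subtype.ext (funext fun ⟨χ, ρ, hρ⟩ => ?_)
    subst hρ
    exact (isTraceFunction_repTrace ρ).mul g h

section

variable {p q : ℕ} {G : Type*} [Group G] {g g' : G}

theorem IsSchubertPresentation.lift_relation (h : IsSchubertPresentation p q g g') :
    FreeGroup.lift ![g, g'] (letterX * schubertWord p q) =
      FreeGroup.lift ![g, g'] (schubertWord p q * letterX) := by
  have : letterX * schubertWord p q * letterX⁻¹ * (schubertWord p q)⁻¹ ∈
      (FreeGroup.lift ![g, g']).ker := by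
    rw [h.2]; exact Subgroup.subset_normalClosure rfl
  rw [MonoidHom.mem_ker, map_mul, map_mul, map_inv, map_inv, mul_inv_eq_one, mul_inv_eq_iff_eq_mul]
    at this
  rw [this, map_mul]

theorem lift_letterX : FreeGroup.lift ![g, g'] letterX = g := by simp [letterX]

theorem lift_letterX' : FreeGroup.lift ![g, g'] letterX' = g' := by simp [letterX']

/-- A trace function on a group with Schubert's presentation kills Schubert's polynomial. -/
theorem IsSchubertPresentation.frickeEval_schubertPoly (hcop : Nat.Coprime q (2 * p))
    (h : IsSchubertPresentation p q g g') {A : Type*} [CommRing A] [Algebra ℂ A] {T : G → A}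
    (hT : IsTraceFunction T) :
    frickeEval (T ∘ FreeGroup.lift ![g, g']) (schubertPoly p q) = 0 := by
  rw [schubertPoly, ← tracePoly_sub_eq hcop, map_sub, (hT.comp _).frickeEval_tracePoly,
    (hT.comp _).frickeEval_tracePoly, sub_eq_zero, Function.comp, Function.comp,
    mul_assoc letterX⁻¹]
  simp only [map_mul _ (_ * _) letterX'⁻¹, map_mul _ letterX⁻¹, map_mul _ (schubertWord p q) letterX'⁻¹]
  rw [← h.lift_relation, map_mul, map_inv, inv_mul_cancel_left]

/-- A polynomial that vanishes on all characters vanishes on the zero locus of η, because each zero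
comes from a representation that factors through G. The Nullstellensatz puts a power of it into (η),
and squarefreeness removes the power. -/
theorem IsSchubertPresentation.exists_algEquiv_characterRing (hp : 0 < p)
    (hcop : Nat.Coprime q (2 * p)) (h : IsSchubertPresentation p q g g') :
    ∃ Φ : (FrickeRing ⧸ Ideal.span {schubertPoly p q}) ≃ₐ[ℂ] CharacterRing G,
      Φ (Ideal.Quotient.mk _ (MvPolynomial.X 0)) = -traceFunction g ∧
      Φ (Ideal.Quotient.mk _ (MvPolynomial.X 1)) = -traceFunction g' ∧
      Φ (Ideal.Quotient.mk _ (MvPolynomial.X 2)) = -traceFunction (g * g') := by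
  set φ := FreeGroup.lift ![g, g'] with hφ
  have hT : IsTraceFunction ((traceFunction : G → CharacterRing G) ∘ φ) :=
    (isTraceFunction_traceFunction G).comp φ
  set F := frickeEval ((traceFunction : G → CharacterRing G) ∘ φ) with hF
  have heval : ∀ (ρ : G →* Matrix.SpecialLinearGroup (Fin 2) ℂ) (P : FrickeRing),
      (F P).1 ⟨repTrace ρ, ρ, rfl⟩ = frickeEval (repTrace (ρ.comp φ)) P := by
    intro ρ P
    have : ((Pi.evalAlgHom ℂ (fun _ : characterVariety G => ℂ) ⟨repTrace ρ, ρ, rfl⟩).comp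
        (CharacterRing G).val).comp F = frickeEval (repTrace (ρ.comp φ)) := by
      refine MvPolynomial.algHom_ext fun i => ?_
      fin_cases i
      · simp [hF, frickeEval]; rfl
      · simp [hF, frickeEval]; rfl
      · simp [hF, frickeEval, -map_mul]; rfl
    exact DFunLike.congr_fun this P
  have hsurj : Function.Surjective F := by
    have hle : CharacterRing G ≤ ((CharacterRing G).val.comp F).range := by
      refine Algebra.adjoin_le ?_
      rintro _ ⟨k, rfl⟩
      obtain ⟨z, rfl⟩ := h.1 k
      exact ⟨tracePoly z, congrArg Subtype.val (hT.frickeEval_tracePoly z)⟩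
    rintro ⟨f, hf⟩
    obtain ⟨P, hP⟩ := hle hf
    exact ⟨P, Subtype.ext hP⟩
  have hker : RingHom.ker F = Ideal.span {schubertPoly p q} := by
    refine le_antisymm (fun P hP => ?_) ?_
    · have hvan : P ∈ MvPolynomial.vanishingIdeal ℂ
          (MvPolynomial.zeroLocus ℂ (Ideal.span {schubertPoly p q})) := by
        intro v hv
        have hv0 : MvPolynomial.eval v (schubertPoly p q) = 0 := by
          simpa using hv _ (Ideal.mem_span_singleton_self _)
        obtain ⟨ρ, hρ, hrel⟩ := exists_representation_of_eval_schubertPoly_eq_zero hcop v hv0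
        have hkerle : φ.ker ≤ ρ.ker := by
          rw [h.2]
          refine Subgroup.normalClosure_le_normal ?_
          rintro _ rfl
          rw [SetLike.mem_coe, MonoidHom.mem_ker, map_mul, map_mul, map_inv, map_inv, mul_inv_eq_one,
            mul_inv_eq_iff_eq_mul, ← map_mul, hrel, map_mul]
        let σ := φ.liftOfSurjective h.1 ⟨ρ, hkerle⟩
        have hσ : σ.comp φ = ρ := MonoidHom.liftOfRightInverse_comp _ _ _ ⟨ρ, hkerle⟩
        have h1 := heval σ P
        rw [hσ, (RingHom.mem_ker).1 hP, ← eval_eq_frickeEval, hρ] at h1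
        rw [MvPolynomial.aeval_eq_eval]
        exact h1.symm
      rw [MvPolynomial.vanishingIdeal_zeroLocus_eq_radical] at hvan
      obtain ⟨n, hn⟩ := hvan
      rw [Ideal.mem_span_singleton] at hn ⊢
      exact (squarefree_schubertPoly hp q).isRadical n _ hn
    · rw [Ideal.span_singleton_le_iff_mem, RingHom.mem_ker]
      exact h.frickeEval_schubertPoly hcop (isTraceFunction_traceFunction G)
  let Φ := (Ideal.quotientEquivAlgOfEq ℂ hker.symm).trans
    (Ideal.quotientKerAlgEquivOfSurjective hsurj)
  have hΦ : ∀ P, Φ (Ideal.Quotient.mk _ P) = F P := fun P => rfl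
  refine ⟨Φ, ?_, ?_, ?_⟩
  · rw [hΦ, hF, frickeEval_X_zero, Function.comp, lift_letterX]
  · rw [hΦ, hF, frickeEval_X_one, Function.comp, lift_letterX']
  · rw [hΦ, hF, frickeEval_X_two, Function.comp, map_mul, lift_letterX, lift_letterX']

/-- The elements that do not change the traces of products modulo an ideal. -/
def traceStabilizer (I : Ideal FrickeRing) : Subgroup (FreeGroup (Fin 2)) where
  carrier := {n | ∀ u, tracePoly (n * u) - tracePoly u ∈ I}
  one_mem' u := by simp
  mul_mem' {m n} hm hn u := by
    have := I.add_mem (hm (n * u)) (hn u)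
    rwa [sub_add_sub_cancel, ← mul_assoc] at this
  inv_mem' {n} hn u := by
    have := hn (n⁻¹ * u)
    rw [mul_inv_cancel_left] at this
    rw [← neg_sub]
    exact I.neg_mem this

instance traceStabilizer_normal (I : Ideal FrickeRing) : (traceStabilizer I).Normal where
  conj_mem n hn k u := by
    have h := hn (k⁻¹ * u * k)
    rw [← isTraceFunction_tracePoly.mul_comm k] at h
    have e1 : tracePoly (k * n * k⁻¹ * u) = tracePoly (n * (k⁻¹ * u * k)) := by
      rw [isTraceFunction_tracePoly.mul_comm n]
      simp only [mul_assoc]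
      rw [isTraceFunction_tracePoly.mul_comm k]
      simp only [mul_assoc]
      rw [isTraceFunction_tracePoly.mul_comm n]
      simp only [mul_assoc]
    rw [e1]
    simpa only [mul_assoc, mul_inv_cancel_left] using h

theorem normalClosure_le_traceStabilizer (hcop : Nat.Coprime q (2 * p)) :
    Subgroup.normalClosure {letterX * schubertWord p q * letterX⁻¹ * (schubertWord p q)⁻¹} ≤
      traceStabilizer (Ideal.span {schubertPoly p q}) := by
  refine Subgroup.normalClosure_le_normal ?_
  rintro _ rfl u
  -- With the test word x⁻¹w⁻¹u the two sides of the swap become the relator times u, and u.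
  have h := tracePoly_schubertWord_swap hcop (letterX⁻¹ * (schubertWord p q)⁻¹ * u).toWord
  rw [FreeGroup.mk_toWord, ← schubertPoly] at h
  simp only [mul_assoc, mul_inv_cancel_left] at h ⊢
  rw [h]
  exact Ideal.mul_mem_left _ _ (Ideal.mem_span_singleton_self _)

/-- The inverse sends [k] to the trace polynomial, modulo η, of any word that represents k; the
relator lies in the trace stabiliser, so the choice does not matter. No Nullstellensatz enters, so
nilpotents of the universal algebra are not discarded. -/
theorem IsSchubertPresentation.exists_algEquiv_universalCharacterRing
    (hcop : Nat.Coprime q (2 * p)) (h : IsSchubertPresentation p q g g') :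
    ∃ Ψ : (FrickeRing ⧸ Ideal.span {schubertPoly p q}) ≃ₐ[ℂ] UniversalCharacterRing G,
      Ψ (Ideal.Quotient.mk _ (MvPolynomial.X 0)) = -universalTrace g ∧
      Ψ (Ideal.Quotient.mk _ (MvPolynomial.X 1)) = -universalTrace g' ∧
      Ψ (Ideal.Quotient.mk _ (MvPolynomial.X 2)) = -universalTrace (g * g') := by
  set φ := FreeGroup.lift ![g, g'] with hφ
  set I : Ideal FrickeRing := Ideal.span {schubertPoly p q} with hI
  have hT : IsTraceFunction ((universalTrace : G → UniversalCharacterRing G) ∘ φ) :=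
    (isTraceFunction_universalTrace G).comp φ
  set F := frickeEval ((universalTrace : G → UniversalCharacterRing G) ∘ φ) with hF
  have hFI : ∀ P ∈ I, F P = 0 := by
    have hle : I ≤ RingHom.ker F := by
      rw [hI, Ideal.span_singleton_le_iff_mem, RingHom.mem_ker]
      exact h.frickeEval_schubertPoly hcop (isTraceFunction_universalTrace G)
    exact fun P hP => hle hP
  let Ψ : (FrickeRing ⧸ I) →ₐ[ℂ] UniversalCharacterRing G := Ideal.Quotient.liftₐ I F hFI
  have hΨ : ∀ P, Ψ (Ideal.Quotient.mk _ P) = F P := fun P => rfl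
  obtain ⟨s, hs⟩ := h.1.hasRightInverse
  obtain ⟨t, ht'⟩ : ∃ t : G → FrickeRing ⧸ I, ∀ k, t k = Ideal.Quotient.mk I (tracePoly (s k)) :=
    ⟨_, fun _ => rfl⟩
  have ht : ∀ z, t (φ z) = Ideal.Quotient.mk I (tracePoly z) := by
    intro z
    have h1 := hs (φ z)
    rw [ht']
    set y := s (φ z) with hy
    have h2 : y * z⁻¹ ∈ φ.ker := by
      rw [MonoidHom.mem_ker, map_mul, map_inv, mul_inv_eq_one, hφ, h1]
    rw [h.2] at h2
    have h3 := normalClosure_le_traceStabilizer hcop h2 z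
    rw [inv_mul_cancel_right] at h3
    exact Ideal.Quotient.eq.2 h3
  have htT : IsTraceFunction t :=
    { one := by
        rw [← map_one φ, ht, isTraceFunction_tracePoly.one, map_ofNat]
      mul := fun a b => by
        obtain ⟨y, rfl⟩ := h.1 a
        obtain ⟨z, rfl⟩ := h.1 b
        change t (φ y) * t (φ z) = t (φ y * φ z) + t (φ y * (φ z)⁻¹)
        rw [← map_inv, ← map_mul, ← map_mul, ht, ht, ht, ht, ← map_mul, ← map_add,
          isTraceFunction_tracePoly.mul] }
  have hker : ∀ P ∈ traceRelations G, MvPolynomial.aeval (R := ℂ) t P = 0 := by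
    have hle : traceRelations G ≤ RingHom.ker (MvPolynomial.aeval (R := ℂ) t) := by
      refine Ideal.span_le.2 ?_
      rintro _ (rfl | ⟨a, b, rfl⟩)
      · simp [RingHom.mem_ker, htT.one]
      · simp [RingHom.mem_ker, htT.mul]
    exact fun P hP => hle hP
  let Θ : UniversalCharacterRing G →ₐ[ℂ] (FrickeRing ⧸ I) :=
    Ideal.Quotient.liftₐ _ (MvPolynomial.aeval t) hker
  have hΘ : ∀ k, Θ (universalTrace k) = t k := fun k => MvPolynomial.aeval_X t k
  have hΘφ : ∀ z, Θ (universalTrace (φ z)) = Ideal.Quotient.mk I (tracePoly z) :=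
    fun z => (hΘ _).trans (ht z)
  have hX0 : F (MvPolynomial.X 0) = -universalTrace (φ letterX) := frickeEval_X_zero
  have hX1 : F (MvPolynomial.X 1) = -universalTrace (φ letterX') := frickeEval_X_one
  have hX2 : F (MvPolynomial.X 2) = -universalTrace (φ (letterX * letterX')) := frickeEval_X_two
  refine ⟨AlgEquiv.ofAlgHom Ψ Θ ?_ ?_, ?_, ?_, ?_⟩
  · refine Ideal.Quotient.algHom_ext ℂ (MvPolynomial.algHom_ext fun k => ?_)
    change Ψ (Θ (universalTrace k)) = universalTrace k
    obtain ⟨z, rfl⟩ := h.1 k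
    change Ψ (Θ (universalTrace (φ z))) = universalTrace (φ z)
    rw [hΘφ, hΨ, hF, hT.frickeEval_tracePoly]
    rfl
  · refine Ideal.Quotient.algHom_ext ℂ (MvPolynomial.algHom_ext fun i => ?_)
    change Θ (F (MvPolynomial.X i)) = Ideal.Quotient.mk I (MvPolynomial.X i)
    fin_cases i
    · exact (congrArg Θ hX0).trans (by rw [map_neg, hΘφ]; simp)
    · exact (congrArg Θ hX1).trans (by rw [map_neg, hΘφ]; simp)
    · exact (congrArg Θ hX2).trans (by rw [map_neg, hΘφ]; simp)
  · exact hX0.trans (by rw [hφ, lift_letterX])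
  · exact hX1.trans (by rw [hφ, lift_letterX'])
  · exact hX2.trans (by rw [hφ, map_mul, lift_letterX, lift_letterX'])

end

/-! ### The pillowcase as a star-shaped quotient of the plane -/

/-- The first three coordinates of `pillow`. -/
noncomputable def pillowPoint (k : ℝ × ℝ) : ℝ × ℝ × ℝ :=
  (Real.cos (Real.pi * k.1), Real.cos (Real.pi * k.2),
    Real.sin (Real.pi * k.1) * Real.sin (Real.pi * k.2))

/-- The vector `v` is a positive multiple of the point of the pillowcase with parameters `k`. -/
def OnRay (v : ℝ × ℝ × ℝ) (k : ℝ × ℝ) : Prop := ∃ r : ℝ, 0 < r ∧ v = r • pillowPoint k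

theorem continuous_pillowPoint : Continuous pillowPoint := by
  unfold pillowPoint
  fun_prop

theorem pillowPoint_sq (k : ℝ × ℝ) :
    (pillowPoint k).2.2 ^ 2 = (1 - (pillowPoint k).1 ^ 2) * (1 - (pillowPoint k).2.1 ^ 2) := by
  have h1 := Real.sin_sq_add_cos_sq (Real.pi * k.1)
  have h2 := Real.sin_sq_add_cos_sq (Real.pi * k.2)
  simp only [pillowPoint, mul_pow]
  linear_combination Real.sin (Real.pi * k.1) ^ 2 * h2 +
    (1 - Real.cos (Real.pi * k.2) ^ 2) * h1

theorem pillowPoint_fst_sq_le (k : ℝ × ℝ) : (pillowPoint k).1 ^ 2 ≤ 1 := Real.cos_sq_le_one _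

theorem pillowPoint_snd_sq_le (k : ℝ × ℝ) : (pillowPoint k).2.1 ^ 2 ≤ 1 := Real.cos_sq_le_one _

/-- The pillowcase satisfies Z² = (1 − X²)(1 − Y²) with |X|, |Y| ≤ 1. Comparing this equation at a
point and at its r-fold, with r > 1, forces r²X²Y² = 1, against (rX)²(rY)² ≤ 1. Thus a ray meets the
surface at most once. -/
theorem le_one_of_smul_pillowPoint {k k' : ℝ × ℝ} {r : ℝ} (hr : 0 < r)
    (h : pillowPoint k' = r • pillowPoint k) : r ≤ 1 := by
  by_contra! hlt
  have e1 := congrArg Prod.fst h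
  have e2 := congrArg (fun v => v.2.1) h
  have e3 := congrArg (fun v => v.2.2) h
  simp only [Prod.smul_fst, Prod.smul_snd, smul_eq_mul] at e1 e2 e3
  have s1 := pillowPoint_sq k
  have s2 := pillowPoint_sq k'
  have b1 := pillowPoint_fst_sq_le k'
  have b2 := pillowPoint_snd_sq_le k'
  rw [e1] at b1
  rw [e2] at b2
  rw [e1, e2, e3] at s2
  set X := (pillowPoint k).1
  set Y := (pillowPoint k).2.1
  set Z := (pillowPoint k).2.2
  have hm : 0 < r ^ 2 - 1 := by nlinarith
  have h1 : (r ^ 2 - 1) * (r ^ 2 * X ^ 2 * Y ^ 2 - 1) = 0 := by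
    have : r ^ 2 * Z ^ 2 = (1 - (r * X) ^ 2) * (1 - (r * Y) ^ 2) := by linear_combination s2
    rw [s1] at this
    linear_combination -this
  have h2 : r ^ 2 * X ^ 2 * Y ^ 2 = 1 := by
    have := (mul_eq_zero.1 h1).resolve_left hm.ne'
    linarith
  nlinarith [sq_nonneg X, sq_nonneg Y]

theorem sin_pi_mul_eq_zero {s : ℝ} (h : Real.sin (Real.pi * s) = 0) : ∃ n : ℤ, s = n := by
  obtain ⟨n, hn⟩ := Real.sin_eq_zero_iff.1 h
  refine ⟨n, ?_⟩
  have := Real.pi_ne_zero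
  have h2 : Real.pi * s = Real.pi * n := by linarith
  exact mul_left_cancel₀ this h2

theorem cos_pi_mul_eq {s s' : ℝ} (h : Real.cos (Real.pi * s) = Real.cos (Real.pi * s')) :
    ∃ n : ℤ, s' = s + 2 * n ∨ s' = -s + 2 * n := by
  obtain ⟨n, hn⟩ := Real.cos_eq_cos_iff.1 h
  refine ⟨n, hn.imp (fun h => ?_) fun h => ?_⟩ <;>
  · refine mul_left_cancel₀ Real.pi_ne_zero ?_
    rw [h]; ring

theorem sin_pi_mul_add (s : ℝ) (n : ℤ) :
    Real.sin (Real.pi * (s + 2 * n)) = Real.sin (Real.pi * s) := by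
  rw [show Real.pi * (s + 2 * n) = Real.pi * s + n * (2 * Real.pi) by ring,
    Real.sin_add_int_mul_two_pi]

theorem sin_pi_mul_neg_add (s : ℝ) (n : ℤ) :
    Real.sin (Real.pi * (-s + 2 * n)) = -Real.sin (Real.pi * s) := by
  rw [sin_pi_mul_add, mul_neg, Real.sin_neg]

/-- The points `k` and `k'` of the plane have the same image in the pillowcase. -/
def PillowEquiv (k k' : ℝ × ℝ) : Prop := ∃ m n : ℤ,
  (k'.1 = k.1 + 2 * m ∧ k'.2 = k.2 + 2 * n) ∨ (k'.1 = -k.1 + 2 * m ∧ k'.2 = -k.2 + 2 * n)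

theorem PillowEquiv.pillowPoint_eq {k k' : ℝ × ℝ} (h : PillowEquiv k k') :
    pillowPoint k' = pillowPoint k := by
  have c1 : ∀ (s : ℝ) (n : ℤ), Real.cos (Real.pi * (s + 2 * n)) = Real.cos (Real.pi * s) :=
    fun s n => by
      rw [show Real.pi * (s + 2 * n) = Real.pi * s + n * (2 * Real.pi) by ring,
        Real.cos_add_int_mul_two_pi]
  have c2 : ∀ (s : ℝ) (n : ℤ), Real.cos (Real.pi * (-s + 2 * n)) = Real.cos (Real.pi * s) :=
    fun s n => by rw [c1, mul_neg, Real.cos_neg]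
  obtain ⟨m, n, ⟨h1, h2⟩ | ⟨h1, h2⟩⟩ := h
  · simp only [pillowPoint, h1, h2, c1, sin_pi_mul_add]
  · simp only [pillowPoint, h1, h2, c2, sin_pi_mul_neg_add, neg_mul_neg]

/-- The cosines determine s and t up to independent signs modulo 2. The product of the sines couples
the signs unless a sine vanishes, and then that coordinate is an integer and equals its negative
modulo 2. -/
theorem pillowEquiv_of_pillowPoint_eq {k k' : ℝ × ℝ} (h : pillowPoint k' = pillowPoint k) :
    PillowEquiv k k' := by
  have e1 : Real.cos (Real.pi * k'.1) = Real.cos (Real.pi * k.1) := congrArg Prod.fst h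
  have e2 : Real.cos (Real.pi * k'.2) = Real.cos (Real.pi * k.2) := congrArg (fun v => v.2.1) h
  have e3 : Real.sin (Real.pi * k'.1) * Real.sin (Real.pi * k'.2) =
    Real.sin (Real.pi * k.1) * Real.sin (Real.pi * k.2) := congrArg (fun v => v.2.2) h
  obtain ⟨m, hm⟩ := cos_pi_mul_eq e1.symm
  obtain ⟨n, hn⟩ := cos_pi_mul_eq e2.symm
  rcases hm with hm | hm <;> rcases hn with hn | hn
  · exact ⟨m, n, .inl ⟨hm, hn⟩⟩
  · rw [hm, hn, sin_pi_mul_add, sin_pi_mul_neg_add] at e3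
    rcases mul_eq_zero.1 (show Real.sin (Real.pi * k.1) * Real.sin (Real.pi * k.2) = 0 by linarith)
      with h0 | h0
    · obtain ⟨j, hj⟩ := sin_pi_mul_eq_zero h0
      exact ⟨m + j, n, .inr ⟨by rw [hm]; push_cast; linarith, hn⟩⟩
    · obtain ⟨j, hj⟩ := sin_pi_mul_eq_zero h0
      exact ⟨m, n - j, .inl ⟨hm, by rw [hn]; push_cast; linarith⟩⟩
  · rw [hm, hn, sin_pi_mul_neg_add, sin_pi_mul_add] at e3
    rcases mul_eq_zero.1 (show Real.sin (Real.pi * k.1) * Real.sin (Real.pi * k.2) = 0 by linarith)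
      with h0 | h0
    · obtain ⟨j, hj⟩ := sin_pi_mul_eq_zero h0
      exact ⟨m - j, n, .inl ⟨by rw [hm]; push_cast; linarith, hn⟩⟩
    · obtain ⟨j, hj⟩ := sin_pi_mul_eq_zero h0
      exact ⟨m, n + j, .inr ⟨hm, by rw [hn]; push_cast; linarith⟩⟩
  · exact ⟨m, n, .inr ⟨hm, hn⟩⟩

theorem OnRay.pillowEquiv {v : ℝ × ℝ × ℝ} {k k' : ℝ × ℝ} (h : OnRay v k) (h' : OnRay v k') :
    PillowEquiv k k' := by
  obtain ⟨r, hr, rfl⟩ := h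
  obtain ⟨r', hr', e⟩ := h'
  have e1 : pillowPoint k' = (r'⁻¹ * r) • pillowPoint k := by
    rw [mul_smul, e, smul_smul, inv_mul_cancel₀ hr'.ne', one_smul]
  have e2 : pillowPoint k = (r⁻¹ * r') • pillowPoint k' := by
    rw [mul_smul, ← e, smul_smul, inv_mul_cancel₀ hr.ne', one_smul]
  have l1 := le_one_of_smul_pillowPoint (by positivity) e1
  have l2 := le_one_of_smul_pillowPoint (by positivity) e2
  rw [inv_mul_le_iff₀ hr', mul_one] at l1
  rw [inv_mul_le_iff₀ hr, mul_one] at l2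
  rw [le_antisymm l1 l2, inv_mul_cancel₀ hr'.ne', one_smul] at e1
  exact pillowEquiv_of_pillowPoint_eq e1

theorem OnRay.congr {v : ℝ × ℝ × ℝ} {k k' : ℝ × ℝ} (h : OnRay v k) (hk : PillowEquiv k k') :
    OnRay v k' := by
  obtain ⟨r, hr, rfl⟩ := h
  exact ⟨r, hr, by rw [hk.pillowPoint_eq]⟩

theorem onRay_pillowPoint (k : ℝ × ℝ) : OnRay (pillowPoint k) k := ⟨1, one_pos, (one_smul _ _).symm⟩

theorem OnRay.smul {v : ℝ × ℝ × ℝ} {k : ℝ × ℝ} (h : OnRay v k) {r : ℝ} (hr : 0 < r) :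
    OnRay (r • v) k := by
  obtain ⟨c, hc, rfl⟩ := h
  exact ⟨r * c, mul_pos hr hc, by rw [smul_smul]⟩

theorem pillowPoint_ne_zero (k : ℝ × ℝ) : pillowPoint k ≠ 0 := by
  intro h
  have s := pillowPoint_sq k
  rw [h] at s
  norm_num at s

theorem OnRay.ne_zero {v : ℝ × ℝ × ℝ} {k : ℝ × ℝ} (h : OnRay v k) : v ≠ 0 := by
  obtain ⟨r, hr, rfl⟩ := h
  exact smul_ne_zero hr.ne' (pillowPoint_ne_zero k)

/-- Intermediate values along the ray: the defining function is −1 at the origin and nonnegative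
where the ray leaves |X|, |Y| ≤ 1. If a = b = 0 the ray never leaves, and r = 1/|c| works. -/
theorem exists_smul_mem_pillow {a b c : ℝ} (h : (a, b, c) ≠ ((0, 0, 0) : ℝ × ℝ × ℝ)) :
    ∃ r : ℝ, 0 < r ∧ (r * a) ^ 2 ≤ 1 ∧ (r * b) ^ 2 ≤ 1 ∧
      (r * c) ^ 2 = (1 - (r * a) ^ 2) * (1 - (r * b) ^ 2) := by
  set M := max |a| |b| with hM
  have ha : |a| ≤ M := le_max_left _ _
  have hb : |b| ≤ M := le_max_right _ _
  rcases (le_max_of_le_left (abs_nonneg a) : 0 ≤ M).eq_or_lt with h0 | h0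
  · have ha0 : a = 0 := abs_nonpos_iff.1 (by linarith)
    have hb0 : b = 0 := abs_nonpos_iff.1 (by linarith)
    have hc0 : c ≠ 0 := by rintro rfl; exact h (by rw [ha0, hb0])
    refine ⟨|c|⁻¹, by positivity, by simp [ha0], by simp [hb0], ?_⟩
    rw [ha0, hb0, mul_pow, inv_pow, sq_abs, inv_mul_cancel₀ (by positivity)]
    ring
  · let f : ℝ → ℝ := fun r => (r * c) ^ 2 - (1 - (r * a) ^ 2) * (1 - (r * b) ^ 2)
    have hbound : ∀ r ∈ Set.Icc 0 M⁻¹, (r * a) ^ 2 ≤ 1 ∧ (r * b) ^ 2 ≤ 1 := by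
      intro r hr
      have key : ∀ d : ℝ, |d| ≤ M → (r * d) ^ 2 ≤ 1 := fun d hd => by
        rw [sq_le_one_iff_abs_le_one, abs_mul, abs_of_nonneg hr.1]
        calc r * |d| ≤ M⁻¹ * M := mul_le_mul hr.2 hd (abs_nonneg _) (by positivity)
          _ = 1 := inv_mul_cancel₀ h0.ne'
      exact ⟨key a ha, key b hb⟩
    have hf1 : 0 ≤ f M⁻¹ := by
      have hprod : (1 - (M⁻¹ * a) ^ 2) * (1 - (M⁻¹ * b) ^ 2) = 0 := by
        rcases max_choice |a| |b| with hc | hc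
        · rw [mul_pow, ← sq_abs a, ← hc, ← hM, ← mul_pow, inv_mul_cancel₀ h0.ne']; ring
        · rw [mul_pow M⁻¹ b, ← sq_abs b, ← hc, ← hM, ← mul_pow, inv_mul_cancel₀ h0.ne']; ring
      simp only [f, hprod, sub_zero]
      positivity
    have hf0 : f 0 ≤ 0 := by simp [f]
    obtain ⟨r, hr, hfr⟩ := intermediate_value_Icc (f := f) (by positivity : (0 : ℝ) ≤ M⁻¹)
      (by fun_prop) ⟨hf0, hf1⟩
    have hr0 : r ≠ 0 := by
      rintro rfl
      simp [f] at hfr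
    exact ⟨r, lt_of_le_of_ne hr.1 hr0.symm, (hbound r hr).1, (hbound r hr).2, sub_eq_zero.1 hfr⟩

theorem exists_onRay {v : ℝ × ℝ × ℝ} (hv : v ≠ 0) :
    ∃ k ∈ Set.Icc (0 : ℝ) 1 ×ˢ Set.Icc (-1 : ℝ) 1, OnRay v k := by
  obtain ⟨a, b, c⟩ := v
  obtain ⟨r, hr, h1, h2, h3⟩ := exists_smul_mem_pillow (a := a) (b := b) (c := c) hv
  have hpi := Real.pi_pos
  have key : ∀ d : ℝ, d ^ 2 ≤ 1 → ∃ s ∈ Set.Icc (0 : ℝ) 1, Real.cos (Real.pi * s) = d ∧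
      0 ≤ Real.sin (Real.pi * s) ∧ Real.sin (Real.pi * s) ^ 2 = 1 - d ^ 2 := by
    intro d hd
    obtain ⟨l, u⟩ := abs_le.1 ((sq_le_one_iff_abs_le_one d).1 hd)
    have e : Real.pi * (Real.arccos d / Real.pi) = Real.arccos d := by field_simp
    refine ⟨Real.arccos d / Real.pi, ⟨div_nonneg (Real.arccos_nonneg d) hpi.le,
      (div_le_one hpi).2 (Real.arccos_le_pi d)⟩, ?_, ?_, ?_⟩
    · rw [e, Real.cos_arccos l u]
    · rw [e]; exact Real.sin_nonneg_of_nonneg_of_le_pi (Real.arccos_nonneg d) (Real.arccos_le_pi d)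
    · rw [e, Real.sin_arccos, Real.sq_sqrt (by linarith)]
  obtain ⟨s, hs, es, ps, qs⟩ := key _ h1
  obtain ⟨t, ht, et, pt, qt⟩ := key _ h2
  have habs : (Real.sin (Real.pi * s) * Real.sin (Real.pi * t)) = |r * c| := by
    rw [← abs_of_nonneg (mul_nonneg ps pt), ← sq_eq_sq_iff_abs_eq_abs, mul_pow, qs, qt, h3]
  have hrv : ∀ k, pillowPoint k = r • (a, b, c) → OnRay (a, b, c) k := fun k hk =>
    ⟨r⁻¹, by positivity, by rw [hk, smul_smul, inv_mul_cancel₀ hr.ne', one_smul]⟩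
  rcases le_total 0 c with hc | hc
  · refine ⟨(s, t), ⟨hs, by linarith [ht.1], ht.2⟩, hrv _ ?_⟩
    simp only [pillowPoint, es, et, habs, abs_of_nonneg (mul_nonneg hr.le hc), Prod.smul_mk,
      smul_eq_mul]
  · refine ⟨(s, -t), ⟨hs, by simp only; linarith [ht.2], by simp only; linarith [ht.1]⟩, hrv _ ?_⟩
    simp only [pillowPoint, es, mul_neg, Real.cos_neg, Real.sin_neg, et, habs,
      abs_of_nonpos (mul_nonpos_of_nonneg_of_nonpos hr.le hc), Prod.smul_mk, smul_eq_mul, neg_neg]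

/-- A cone is open if its preimage in the plane that covers the pillowcase is open. -/
theorem isOpen_of_isOpen_pillowPoint_preimage {A : Set (ℝ × ℝ × ℝ)}
    (hcone : ∀ v ∈ A, ∀ r : ℝ, 0 < r → r • v ∈ A) (h0 : (0 : ℝ × ℝ × ℝ) ∉ A)
    (hA : IsOpen (pillowPoint ⁻¹' A)) : IsOpen A := by
  let nrm : ℝ × ℝ × ℝ → ℝ × ℝ × ℝ := fun v => ‖v‖⁻¹ • v
  have hn : ContinuousOn nrm {v | v ≠ 0} := fun v hv =>
    ((continuousAt_id.norm.inv₀ (norm_ne_zero_iff.2 hv)).smul continuousAt_id).continuousWithinAt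
  -- The part of a compact fundamental domain that misses A. Its radial image is compact, and A is
  -- the cone over the complement of that image.
  set K : Set (ℝ × ℝ) := (Set.Icc (0 : ℝ) 1 ×ˢ Set.Icc (-1 : ℝ) 1) ∩ (pillowPoint ⁻¹' A)ᶜ
  have hK : IsCompact K := (isCompact_Icc.prod isCompact_Icc).inter_right hA.isClosed_compl
  have hC : IsClosed (nrm '' (pillowPoint '' K)) := by
    refine ((hK.image continuous_pillowPoint).image_of_continuousOn (hn.mono ?_)).isClosed
    rintro _ ⟨k, -, rfl⟩
    exact pillowPoint_ne_zero k
  have hpos : ∀ v : ℝ × ℝ × ℝ, v ≠ 0 → 0 < ‖v‖⁻¹ := fun v hv => inv_pos.2 (norm_pos_iff.2 hv)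
  have heq : A = {v | v ≠ 0} ∩ nrm ⁻¹' (nrm '' (pillowPoint '' K))ᶜ := by
    ext v
    constructor
    · intro hv
      have hv0 : v ≠ 0 := fun h => h0 (h ▸ hv)
      refine ⟨hv0, ?_⟩
      rintro ⟨_, ⟨k, hk, rfl⟩, e⟩
      refine hk.2 ?_
      have e1 : pillowPoint k = ‖pillowPoint k‖ • (‖v‖⁻¹ • v) := by
        change ‖pillowPoint k‖⁻¹ • pillowPoint k = ‖v‖⁻¹ • v at e
        rw [← e, smul_smul, mul_inv_cancel₀ (norm_ne_zero_iff.2 (pillowPoint_ne_zero k)), one_smul]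
      rw [Set.mem_preimage, e1]
      exact hcone _ (hcone _ hv _ (hpos v hv0)) _ (norm_pos_iff.2 (pillowPoint_ne_zero k))
    · rintro ⟨hv0, hv⟩
      obtain ⟨k, hk, r, hr, rfl⟩ := exists_onRay hv0
      by_contra hnA
      refine hv ⟨_, ⟨k, ⟨hk, fun hkA => hnA (hcone _ hkA r hr)⟩, rfl⟩, ?_⟩
      change ‖pillowPoint k‖⁻¹ • pillowPoint k = ‖r • pillowPoint k‖⁻¹ • r • pillowPoint k
      rw [norm_smul, Real.norm_of_nonneg hr.le, smul_smul, mul_inv, mul_right_comm,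
        inv_mul_cancel₀ hr.ne', one_mul]
  rw [heq]
  exact hn.isOpen_inter_preimage (isOpen_ne) hC.isOpen_compl

/-! ### The outer arcs and the strip that covers their complement -/

/-- A linear form whose values at the points over the two outer arcs of the link are the integers:
the even ones for the first, the odd ones for the second arc. -/
def pillowLevel (p q : ℕ) (k : ℝ × ℝ) : ℝ := 2 * p * k.2 - q * (k.1 - 1)

theorem continuous_pillowLevel (p q : ℕ) : Continuous (pillowLevel p q) := by
  unfold pillowLevel
  fun_prop

section

variable {p q : ℕ}

theorem exists_int_combination (hcop : Nat.Coprime q (2 * p)) (j : ℤ) :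
    ∃ m n : ℤ, 2 * p * n - q * m = j := by
  have h := Int.isCoprime_iff_gcd_eq_one.2 (show Int.gcd (q : ℤ) ((2 * p : ℕ) : ℤ) = 1 from hcop)
  obtain ⟨a, b, hab⟩ := h
  push_cast at hab
  exact ⟨-(j * a), j * b, by linear_combination j * hab⟩

theorem exists_pillowEquiv_add (hcop : Nat.Coprime q (2 * p)) (k : ℝ × ℝ) (j : ℤ) :
    ∃ k', PillowEquiv k k' ∧ pillowLevel p q k' = pillowLevel p q k + 2 * j := by
  obtain ⟨m, n, h⟩ := exists_int_combination hcop j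
  refine ⟨(k.1 + 2 * m, k.2 + 2 * n), ⟨m, n, .inl ⟨rfl, rfl⟩⟩, ?_⟩
  have h' : (2 * p * n - q * m : ℝ) = j := by exact_mod_cast h
  simp only [pillowLevel]
  linear_combination 2 * h'

/-- By Bézout, translations change the level by every even integer, and half-turns negate it up to
an even integer. So every noninteger level can be folded into (0, 1), with a half-turn when its
floor is odd. -/
theorem exists_pillowEquiv_strip (hcop : Nat.Coprime q (2 * p)) {k : ℝ × ℝ}
    (hk : ∀ n : ℤ, pillowLevel p q k ≠ n) :
    ∃ k', PillowEquiv k k' ∧ 0 < pillowLevel p q k' ∧ pillowLevel p q k' < 1 := by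
  have h1 := Int.floor_le (pillowLevel p q k)
  have h2 := Int.lt_floor_add_one (pillowLevel p q k)
  have h3 := lt_of_le_of_ne h1 (hk _).symm
  rcases Int.even_or_odd' ⌊pillowLevel p q k⌋ with ⟨a, ha | ha⟩
  · obtain ⟨k', hk', e⟩ := exists_pillowEquiv_add hcop k (-a)
    rw [ha] at h2 h3
    push_cast at h2 h3 e
    exact ⟨k', hk', by linarith, by linarith⟩
  · obtain ⟨m, n, h⟩ := exists_int_combination hcop (a + 1 - q)
    refine ⟨(-k.1 + 2 * m, -k.2 + 2 * n), ⟨m, n, .inr ⟨rfl, rfl⟩⟩, ?_⟩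
    have h' : (2 * p * n - q * m : ℝ) = a + 1 - q := by exact_mod_cast h
    have e : pillowLevel p q (-k.1 + 2 * m, -k.2 + 2 * n) = -pillowLevel p q k + 2 * a + 2 := by
      simp only [pillowLevel]
      linear_combination 2 * h'
    rw [ha] at h2 h3
    push_cast at h2 h3
    rw [e]
    exact ⟨by linarith, by linarith⟩

/-- A half-turn would make the sum of two levels in (0, 1) an even integer, so only translations
along the strip remain, the multiples of (4p, 2q). In other words, the complement of the arcs in the
pillowcase is an annulus covered by the strip. -/
theorem pillowEquiv_strip_unique (hp : 0 < p) (hcop : Nat.Coprime q (2 * p)) {k k' : ℝ × ℝ}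
    (h : PillowEquiv k k') (h0 : 0 < pillowLevel p q k) (h1 : pillowLevel p q k < 1)
    (h0' : 0 < pillowLevel p q k') (h1' : pillowLevel p q k' < 1) :
    ∃ a : ℤ, k'.1 = k.1 + 4 * p * a ∧ k'.2 = k.2 + 2 * q * a := by
  obtain ⟨m, n, ⟨e1, e2⟩ | ⟨e1, e2⟩⟩ := h
  · have e : pillowLevel p q k' = pillowLevel p q k + 2 * (2 * p * n - q * m : ℤ) := by
      simp only [pillowLevel, e1, e2]
      push_cast
      ring
    have hz : (2 * p * n - q * m : ℤ) = 0 := by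
      have l1 : (-1 : ℝ) < (2 * p * n - q * m : ℤ) := by linarith
      have l2 : ((2 * p * n - q * m : ℤ) : ℝ) < 1 := by linarith
      have l1' : (-1 : ℤ) < (2 * p * n - q * m : ℤ) := by exact_mod_cast l1
      have l2' : (2 * p * n - q * m : ℤ) < 1 := by exact_mod_cast l2
      omega
    have hc : IsCoprime ((2 * p : ℕ) : ℤ) (q : ℤ) :=
      Int.isCoprime_iff_gcd_eq_one.2 (show Int.gcd ((2 * p : ℕ) : ℤ) (q : ℤ) = 1 from hcop.symm)
    obtain ⟨a, ha⟩ : ((2 * p : ℕ) : ℤ) ∣ m := by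
      refine hc.dvd_of_dvd_mul_left ⟨n, ?_⟩
      push_cast
      linarith
    push_cast at ha
    have hp' : (2 * p : ℤ) ≠ 0 := by omega
    have hn : n = q * a := by
      refine mul_left_cancel₀ hp' ?_
      rw [ha] at hz
      linear_combination hz
    refine ⟨a, ?_, ?_⟩
    · rw [e1, ha]; push_cast; ring
    · rw [e2, hn]; push_cast; ring
  · exfalso
    have e : pillowLevel p q k' = -pillowLevel p q k + 2 * (2 * p * n - q * m + q : ℤ) := by
      simp only [pillowLevel, e1, e2]
      push_cast
      ring
    have l1 : (0 : ℝ) < (2 * p * n - q * m + q : ℤ) := by linarith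
    have l2 : ((2 * p * n - q * m + q : ℤ) : ℝ) < 1 := by linarith
    have l1' : (0 : ℤ) < (2 * p * n - q * m + q : ℤ) := by exact_mod_cast l1
    have l2' : (2 * p * n - q * m + q : ℤ) < 1 := by exact_mod_cast l2
    omega

/-- The parameter τ of the whole line can be shifted by even integers, which brings it into [−1, 1],
and half-turns about the lattice points on the line change its sign. -/
theorem exists_pillowEquiv_unitInterval (s₀ : ℤ) (hq : 0 < q) {k : ℝ × ℝ}
    (hk : 2 * p * k.2 = q * (k.1 - s₀)) :
    ∃ τ ∈ Set.Icc (0 : ℝ) 1, PillowEquiv k (s₀ + 2 * p * τ, q * τ) := by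
  have hq' : (q : ℝ) ≠ 0 := Nat.cast_ne_zero.2 hq.ne'
  obtain ⟨τ, hτ⟩ : ∃ τ, τ = k.2 / q := ⟨_, rfl⟩
  have e2 : k.2 = q * τ := by rw [hτ]; field_simp
  have e1 : k.1 = s₀ + 2 * p * τ := by
    rw [e2] at hk
    have : q * (2 * p * τ) = q * (k.1 - s₀) := by linarith
    linarith [mul_left_cancel₀ hq' this]
  obtain ⟨l, u⟩ := abs_le.1 (abs_sub_round (τ / 2))
  set b := round (τ / 2)
  rcases le_total 0 (τ - 2 * b) with h | h
  · refine ⟨τ - 2 * b, ⟨h, by linarith⟩, -(2 * p * b), -(q * b), .inl ⟨?_, ?_⟩⟩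
    · simp only [e1]; push_cast; ring
    · simp only [e2]; push_cast; ring
  · refine ⟨-(τ - 2 * b), ⟨by linarith, by linarith⟩, s₀ + 2 * p * b, q * b, .inr ⟨?_, ?_⟩⟩
    · simp only [e1]; push_cast; ring
    · simp only [e2]; push_cast; ring

/-- The first three coordinates. -/
def firstThree (x : EuclideanSpace ℝ (Fin 4)) : ℝ × ℝ × ℝ := (x 0, x 1, x 2)

theorem continuous_firstThree : Continuous firstThree := by
  unfold firstThree
  fun_prop

theorem firstThree_smul_pillow (r s t : ℝ) :
    firstThree (r • pillow s t) = r • pillowPoint (s, t) := by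
  simp [firstThree, pillow, pillowPoint]

theorem sphere3_norm (x : Sphere3) : ‖x.1‖ = 1 := mem_sphere_zero_iff_norm.1 x.2

theorem mem_outerArc_iff (i : Fin 2) (x : Sphere3) :
    x ∈ outerArc p q i ↔ x.1 3 = 0 ∧ ∃ τ ∈ Set.Icc (0 : ℝ) 1,
      OnRay (firstThree x.1) ((if i = 0 then 1 else 0) + 2 * p * τ, q * τ) := by
  constructor
  · rintro ⟨τ, hτ, v, rfl, hx⟩
    set v := pillow ((if i = 0 then 1 else 0) + 2 * p * τ) (q * τ)
    have hv : v ≠ 0 := by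
      intro h
      have := sphere3_norm x
      rw [hx, h] at this
      simp at this
    refine ⟨by rw [hx]; simp [v, pillow], τ, hτ, ‖v‖⁻¹, inv_pos.2 (norm_pos_iff.2 hv), ?_⟩
    rw [hx, firstThree_smul_pillow]
  · rintro ⟨h3, τ, hτ, r, hr, hx⟩
    refine ⟨τ, hτ, _, rfl, ?_⟩
    set v := pillow ((if i = 0 then 1 else 0) + 2 * p * τ) (q * τ) with hv
    have hxv : x.1 = r • v := by
      rw [← firstThree_smul_pillow] at hx
      simp only [firstThree, Prod.mk.injEq] at hx
      ext j
      fin_cases j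
      · exact hx.1
      · exact hx.2.1
      · exact hx.2.2
      · simpa [v, pillow] using h3
    have hn := sphere3_norm x
    rw [hxv, norm_smul, Real.norm_of_nonneg hr.le] at hn
    rw [hxv, eq_inv_of_mul_eq_one_left hn]

theorem mem_outerArcs_iff (hq : 0 < q) (hcop : Nat.Coprime q (2 * p)) (x : Sphere3) :
    (x ∈ outerArc p q 0 ∨ x ∈ outerArc p q 1) ↔
      x.1 3 = 0 ∧ ∃ k, OnRay (firstThree x.1) k ∧ ∃ n : ℤ, pillowLevel p q k = n := by
  rw [mem_outerArc_iff, mem_outerArc_iff]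
  constructor
  · rintro (⟨h3, τ, hτ, h⟩ | ⟨h3, τ, hτ, h⟩)
    · exact ⟨h3, _, h, 0, by simp [pillowLevel]; ring⟩
    · exact ⟨h3, _, h, q, by simp [pillowLevel]; ring⟩
  · rintro ⟨h3, k, h, n, hn⟩
    obtain ⟨b, hb⟩ := odd_of_coprime_two_mul hcop
    rcases Int.even_or_odd' n with ⟨a, rfl | rfl⟩
    · left
      obtain ⟨k', hk', e⟩ := exists_pillowEquiv_add hcop k (-a)
      have e' : 2 * p * k'.2 = q * (k'.1 - (1 : ℤ)) := by
        rw [hn] at e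
        simp only [pillowLevel] at e
        push_cast at e ⊢
        linarith
      obtain ⟨τ, hτ, hk''⟩ := exists_pillowEquiv_unitInterval 1 hq e'
      refine ⟨h3, τ, hτ, ?_⟩
      simpa using (h.congr hk').congr hk''
    · right
      -- The second arc is parametrised at level q = 2b + 1, so the level 2a + 1 has to be shifted
      -- by 2(b − a).
      obtain ⟨k', hk', e⟩ := exists_pillowEquiv_add hcop k (b - a)
      have e' : 2 * p * k'.2 = q * (k'.1 - (0 : ℤ)) := by
        rw [hn] at e
        simp only [pillowLevel] at e
        have hb' : (q : ℝ) = 2 * b + 1 := by exact_mod_cast hb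
        push_cast at e ⊢
        linarith
      obtain ⟨τ, hτ, hk''⟩ := exists_pillowEquiv_unitInterval 0 hq e'
      refine ⟨h3, τ, hτ, ?_⟩
      simpa using (h.congr hk').congr hk''

/-- The cone over the complement of the outer arcs in the pillowcase. -/
def outerCone (p q : ℕ) : Set (ℝ × ℝ × ℝ) :=
  {v | ∃ k, OnRay v k ∧ 0 < pillowLevel p q k ∧ pillowLevel p q k < 1}

theorem pillowLevel_equiv {k k' : ℝ × ℝ} (h : PillowEquiv k k') (hk : ∃ n : ℤ, pillowLevel p q k = n) :
    ∃ n : ℤ, pillowLevel p q k' = n := by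
  obtain ⟨c, hc⟩ := hk
  obtain ⟨m, n, ⟨e1, e2⟩ | ⟨e1, e2⟩⟩ := h
  · refine ⟨c + 2 * (2 * p * n - q * m), ?_⟩
    push_cast
    rw [← hc, pillowLevel, pillowLevel, e1, e2]
    ring
  · refine ⟨-c + 2 * (2 * p * n - q * m + q), ?_⟩
    push_cast
    rw [← hc, pillowLevel, pillowLevel, e1, e2]
    ring

theorem not_int_of_mem_Ioo {a : ℝ} (h0 : 0 < a) (h1 : a < 1) (n : ℤ) : a ≠ n := by
  rintro rfl
  have h0' : 0 < n := by exact_mod_cast h0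
  have h1' : n < 1 := by exact_mod_cast h1
  omega

theorem notMem_outerCone_iff (hcop : Nat.Coprime q (2 * p)) {v : ℝ × ℝ × ℝ} {k : ℝ × ℝ}
    (hk : OnRay v k) : v ∉ outerCone p q ↔ ∃ n : ℤ, pillowLevel p q k = n := by
  constructor
  · intro h
    by_contra! hn
    obtain ⟨k', h1, h2⟩ := exists_pillowEquiv_strip hcop hn
    exact h ⟨k', hk.congr h1, h2⟩
  · rintro hn ⟨k', h1, h2, h3⟩
    obtain ⟨n, hn⟩ := pillowLevel_equiv (hk.pillowEquiv h1) hn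
    exact not_int_of_mem_Ioo h2 h3 n hn

theorem outerCone_smul {v : ℝ × ℝ × ℝ} (hv : v ∈ outerCone p q) {r : ℝ} (hr : 0 < r) :
    r • v ∈ outerCone p q := by
  obtain ⟨k, h, hk⟩ := hv
  exact ⟨k, h.smul hr, hk⟩

/-- A cone in `outerCone` is open if its preimage in the strip that covers `outerCone` is open. -/
theorem isOpen_of_isOpen_strip (hcop : Nat.Coprime q (2 * p)) {A : Set (ℝ × ℝ × ℝ)}
    (hsub : A ⊆ outerCone p q) (hcone : ∀ v ∈ A, ∀ r : ℝ, 0 < r → r • v ∈ A)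
    (hA : ∀ k, 0 < pillowLevel p q k → pillowLevel p q k < 1 → pillowPoint k ∈ A →
      ∀ᶠ k' in nhds k, pillowPoint k' ∈ A) : IsOpen A := by
  refine isOpen_of_isOpen_pillowPoint_preimage hcone ?_ ?_
  · intro h
    obtain ⟨k, hk, -⟩ := hsub h
    exact hk.ne_zero rfl
  · rw [isOpen_iff_mem_nhds]
    intro k hk
    have hn : ∀ n : ℤ, pillowLevel p q k ≠ n := by
      intro n hn
      exact (notMem_outerCone_iff hcop (onRay_pillowPoint k)).2 ⟨n, hn⟩ (hsub hk)
    obtain ⟨k', hk', h0, h1⟩ := exists_pillowEquiv_strip hcop hn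
    have hA' := hA k' h0 h1 (by rw [hk'.pillowPoint_eq]; exact hk)
    obtain ⟨m, n, h⟩ := hk'
    rcases h with ⟨e1, e2⟩ | ⟨e1, e2⟩
    · have hc : Continuous fun l : ℝ × ℝ => ((l.1 + 2 * m, l.2 + 2 * n) : ℝ × ℝ) := by fun_prop
      have ht := hc.tendsto k
      rw [← e1, ← e2] at ht
      filter_upwards [ht.eventually hA'] with l hl
      have he : PillowEquiv l (l.1 + 2 * m, l.2 + 2 * n) := ⟨m, n, .inl ⟨rfl, rfl⟩⟩
      rwa [he.pillowPoint_eq] at hl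
    · have hc : Continuous fun l : ℝ × ℝ => ((-l.1 + 2 * m, -l.2 + 2 * n) : ℝ × ℝ) := by fun_prop
      have ht := hc.tendsto k
      rw [← e1, ← e2] at ht
      filter_upwards [ht.eventually hA'] with l hl
      have he : PillowEquiv l (-l.1 + 2 * m, -l.2 + 2 * n) := ⟨m, n, .inr ⟨rfl, rfl⟩⟩
      rwa [he.pillowPoint_eq] at hl

theorem isOpen_outerCone (hcop : Nat.Coprime q (2 * p)) : IsOpen (outerCone p q) := by
  refine isOpen_of_isOpen_strip hcop subset_rfl (fun v hv r hr => outerCone_smul hv hr) ?_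
  intro k h0 h1 _
  have hc := (continuous_pillowLevel p q).tendsto k
  filter_upwards [hc.eventually (lt_mem_nhds h0), hc.eventually (gt_mem_nhds h1)] with l l0 l1
  exact ⟨l, onRay_pillowPoint l, l0, l1⟩

end

/-! ### Four star-shaped cones that cover the complement -/

/-- The names of four open sets that cover the complement of the link. -/
inductive Patch
  | upper | left | right | lower

/-- The cones over the four open sets. -/
def patchCone (p q : ℕ) : Patch → Set (EuclideanSpace ℝ (Fin 4))
  | .upper => {v | 0 < v 3 ∧ ¬(v 2 = 0 ∧ v 1 ^ 2 + v 3 ^ 2 ≤ v 0 ^ 2)}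
  | .left => {v | 0 < v 3 ∧ v 0 < 0 ∧ v 1 ^ 2 + v 3 ^ 2 < v 0 ^ 2}
  | .right => {v | 0 < v 3 ∧ 0 < v 0 ∧ v 1 ^ 2 + v 3 ^ 2 < v 0 ^ 2}
  | .lower => {v | v 3 < 0 ∨ firstThree v ∈ outerCone p q ∧
      ¬(v 2 = 0 ∧ v 1 ^ 2 ≤ v 0 ^ 2 ∧ v 0 ^ 2 ≤ v 1 ^ 2 + v 3 ^ 2)}

section

variable {p q : ℕ}

theorem isOpen_patchCone (hcop : Nat.Coprime q (2 * p)) (i : Patch) : IsOpen (patchCone p q i) := by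
  have h0 : Continuous fun v : EuclideanSpace ℝ (Fin 4) => v 0 := by fun_prop
  have h1 : Continuous fun v : EuclideanSpace ℝ (Fin 4) => v 1 := by fun_prop
  have h2 : Continuous fun v : EuclideanSpace ℝ (Fin 4) => v 2 := by fun_prop
  have h3 : Continuous fun v : EuclideanSpace ℝ (Fin 4) => v 3 := by fun_prop
  cases i
  · exact (isOpen_lt continuous_const h3).inter ((isClosed_eq h2 continuous_const).inter
      (isClosed_le ((h1.pow 2).add (h3.pow 2)) (h0.pow 2))).isOpen_compl
  · exact (isOpen_lt continuous_const h3).inter ((isOpen_lt h0 continuous_const).inter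
      (isOpen_lt ((h1.pow 2).add (h3.pow 2)) (h0.pow 2)))
  · exact (isOpen_lt continuous_const h3).inter ((isOpen_lt continuous_const h0).inter
      (isOpen_lt ((h1.pow 2).add (h3.pow 2)) (h0.pow 2)))
  · exact (isOpen_lt h3 continuous_const).union
      (((isOpen_outerCone hcop).preimage continuous_firstThree).inter
        ((isClosed_eq h2 continuous_const).inter ((isClosed_le (h1.pow 2) (h0.pow 2)).inter
          (isClosed_le (h0.pow 2) ((h1.pow 2).add (h3.pow 2))))).isOpen_compl)

theorem smul_mem_patchCone {i : Patch} {v : EuclideanSpace ℝ (Fin 4)} (hv : v ∈ patchCone p q i)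
    {r : ℝ} (hr : 0 < r) : r • v ∈ patchCone p q i := by
  have e : ∀ j, (r • v) j = r * v j := fun j => rfl
  have hr2 : 0 < r ^ 2 := by positivity
  cases i
  · obtain ⟨h1, h2⟩ := hv
    refine ⟨by rw [e]; positivity, fun ⟨h3, h4⟩ => h2 ⟨?_, ?_⟩⟩
    · exact (mul_eq_zero.1 h3).resolve_left hr.ne'
    · simp only [e] at h4
      nlinarith
  · obtain ⟨h1, h2, h3⟩ := hv
    refine ⟨by rw [e]; positivity, by rw [e]; exact mul_neg_of_pos_of_neg hr h2, ?_⟩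
    simp only [e]
    nlinarith
  · obtain ⟨h1, h2, h3⟩ := hv
    refine ⟨by rw [e]; positivity, by rw [e]; positivity, ?_⟩
    simp only [e]
    nlinarith
  · rcases hv with h | ⟨h1, h2⟩
    · exact .inl (by rw [e]; exact mul_neg_of_pos_of_neg hr h)
    · refine .inr ⟨outerCone_smul h1 hr, fun ⟨h3, h4, h5⟩ => h2 ⟨?_, ?_, ?_⟩⟩
      · exact (mul_eq_zero.1 h3).resolve_left hr.ne'
      · simp only [e] at h4; nlinarith
      · simp only [e] at h5; nlinarith

theorem sphere3_sum_sq (x : Sphere3) : x.1 0 ^ 2 + x.1 1 ^ 2 + x.1 2 ^ 2 + x.1 3 ^ 2 = 1 := by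
  have h := sphere3_norm x
  rw [EuclideanSpace.norm_eq, Real.sqrt_eq_one, Fin.sum_univ_four] at h
  simpa only [Real.norm_eq_abs, sq_abs] using h

/-- On the unit sphere with x₂ = 0 the condition x₀² = 1/2 is equivalent to the homogeneous x₀² =
x₁² + x₃², and a homogeneous condition can be compared with the cones. -/
theorem mem_innerArcs_iff (x : Sphere3) :
    (x ∈ innerArc 0 ∨ x ∈ innerArc 1) ↔ x.1 2 = 0 ∧ 0 ≤ x.1 3 ∧
      x.1 0 ^ 2 = x.1 1 ^ 2 + x.1 3 ^ 2 := by
  have h := sphere3_sum_sq x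
  have h2 : √2 ^ 2 = (2 : ℝ) := Real.sq_sqrt (by norm_num)
  have hs0 : sideSign 0 = -1 := rfl
  have hs1 : sideSign 1 = 1 := rfl
  constructor
  · rintro (⟨h0, hz, h3⟩ | ⟨h0, hz, h3⟩)
    · rw [hs0] at h0
      exact ⟨hz, h3, by rw [hz] at h; rw [h0] at h ⊢; linarith⟩
    · rw [hs1] at h0
      exact ⟨hz, h3, by rw [hz] at h; rw [h0] at h ⊢; linarith⟩
  · rintro ⟨hz, h3, h0⟩
    rw [hz] at h
    have : (x.1 0 + √2 / 2) * (x.1 0 - √2 / 2) = 0 := by nlinarith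
    rcases mul_eq_zero.1 this with h' | h'
    · exact .inl ⟨by rw [hs0]; linarith, hz, h3⟩
    · exact .inr ⟨by rw [hs1]; linarith, hz, h3⟩

theorem notMem_twoBridgeLink_iff (x : Sphere3) : x ∉ twoBridgeLink p q ↔
    ¬(x ∈ innerArc 0 ∨ x ∈ innerArc 1) ∧ ¬(x ∈ outerArc p q 0 ∨ x ∈ outerArc p q 1) := by
  rw [twoBridgeLink, linkComponent, linkComponent]
  simp only [Set.mem_union]
  tauto

theorem notMem_twoBridgeLink_of_mem_patchCone (hq : 0 < q) (hcop : Nat.Coprime q (2 * p))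
    {x : Sphere3} {i : Patch} (h : x.1 ∈ patchCone p q i) : x ∉ twoBridgeLink p q := by
  rw [notMem_twoBridgeLink_iff, mem_innerArcs_iff, mem_outerArcs_iff hq hcop]
  have hs := sphere3_sum_sq x
  cases i
  · obtain ⟨h1, h2⟩ := h
    exact ⟨fun ⟨a, b, c⟩ => h2 ⟨a, c.ge⟩, fun ⟨a, _⟩ => h1.ne' a⟩
  · obtain ⟨h1, h2, h3⟩ := h
    exact ⟨fun ⟨a, b, c⟩ => h3.ne' c, fun ⟨a, _⟩ => h1.ne' a⟩
  · obtain ⟨h1, h2, h3⟩ := h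
    exact ⟨fun ⟨a, b, c⟩ => h3.ne' c, fun ⟨a, _⟩ => h1.ne' a⟩
  · rcases h with h | ⟨h1, h2⟩
    · exact ⟨fun ⟨a, b, c⟩ => absurd b (not_le.2 h), fun ⟨a, _⟩ => h.ne a⟩
    · refine ⟨fun ⟨a, b, c⟩ => h2 ⟨a, by nlinarith, c.le⟩, fun ⟨a, k, hk, hn⟩ => ?_⟩
      exact (notMem_outerCone_iff hcop hk).2 hn h1

theorem exists_mem_patchCone (hq : 0 < q) (hcop : Nat.Coprime q (2 * p)) {x : Sphere3}
    (hx : x ∉ twoBridgeLink p q) : ∃ i, x.1 ∈ patchCone p q i := by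
  rw [notMem_twoBridgeLink_iff, mem_innerArcs_iff, mem_outerArcs_iff hq hcop] at hx
  obtain ⟨h1, h2⟩ := hx
  have hs := sphere3_sum_sq x
  rcases lt_trichotomy (x.1 3) 0 with h | h | h
  · exact ⟨.lower, .inl h⟩
  · refine ⟨.lower, .inr ⟨?_, ?_⟩⟩
    · by_contra hc
      have hv : firstThree x.1 ≠ 0 := by
        intro h0
        simp only [firstThree, Prod.mk_eq_zero] at h0
        rw [h0.1, h0.2.1, h0.2.2, h] at hs
        norm_num at hs
      obtain ⟨k, -, hk⟩ := exists_onRay hv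
      exact h2 ⟨h, k, hk, (notMem_outerCone_iff hcop hk).1 hc⟩
    · rintro ⟨a, b, c⟩
      refine h1 ⟨a, h.ge, le_antisymm c ?_⟩
      rw [h] at c ⊢
      linarith
  · by_cases hc : x.1 2 = 0 ∧ x.1 1 ^ 2 + x.1 3 ^ 2 ≤ x.1 0 ^ 2
    · have hlt : x.1 1 ^ 2 + x.1 3 ^ 2 < x.1 0 ^ 2 :=
        lt_of_le_of_ne hc.2 fun he => h1 ⟨hc.1, h.le, he.symm⟩
      rcases lt_trichotomy (x.1 0) 0 with h0 | h0 | h0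
      · exact ⟨.left, h, h0, hlt⟩
      · rw [h0] at hlt
        nlinarith [sq_nonneg (x.1 1), sq_nonneg (x.1 3)]
      · exact ⟨.right, h, h0, hlt⟩
    · exact ⟨.upper, h, hc⟩

/-- Centres of the four cones, with respect to which they are star-shaped. -/
noncomputable def patchCentre : Patch → EuclideanSpace ℝ (Fin 4)
  | .upper => !₂[0, 0, 0, 1]
  | .left => !₂[-2, 0, 0, 1]
  | .right => !₂[2, 0, 0, 1]
  | .lower => !₂[0, 0, 0, -1]

theorem patchCentre_mem (i : Patch) : patchCentre i ∈ patchCone p q i := by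
  cases i <;> simp [patchCentre, patchCone]

theorem side_ineq {a b x y z : ℝ} (ha : 0 ≤ a) (hb : 0 ≤ b) (hab : a + b = 1) (hz : 0 < z)
    (hx : 0 < x) (h : y ^ 2 + z ^ 2 < x ^ 2) :
    (b * y) ^ 2 + (a + b * z) ^ 2 < (2 * a + b * x) ^ 2 := by
  have hzx : z < x := by nlinarith
  rcases hb.eq_or_lt with rfl | hb
  · have : a = 1 := by linarith
    subst this
    norm_num
  · have h1 : 0 < b ^ 2 * (x ^ 2 - y ^ 2 - z ^ 2) := by
      have : 0 < x ^ 2 - y ^ 2 - z ^ 2 := by linarith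
      positivity
    have h2 : 0 ≤ a * b * (x - z) := by
      have : 0 ≤ x - z := by linarith
      positivity
    have h3 : 0 ≤ a * b * x := by positivity
    nlinarith [sq_nonneg a]

/-- Both discs lie behind the inner arcs as seen from the north pole, so removing them leaves a
star. From the south pole, what lies behind the outer arcs is everything over them, and what lies
behind the inner arcs is the piece of the plane v₂ = 0 beyond them; `lower` omits exactly these. The
side cones are Lorentz cones cut by v₃ > 0. -/
theorem starConvex_patchCone (i : Patch) : StarConvex ℝ (patchCentre i) (patchCone p q i) := by
  intro v hv a b ha hb hab
  have e : ∀ j, (a • patchCentre i + b • v) j = a * patchCentre i j + b * v j := fun j => rfl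
  have hpos : ∀ z : ℝ, 0 < z → 0 < a + b * z := fun z hz => by
    rcases hb.eq_or_lt with rfl | hb
    · linarith
    · have := mul_pos hb hz
      linarith
  cases i
  · obtain ⟨h1, h2⟩ := hv
    have e0 := e 0
    have e1 := e 1
    have e2 := e 2
    have e3 := e 3
    simp only [patchCentre, PiLp.toLp_apply, Matrix.cons_val, mul_zero, zero_add, mul_one]
      at e0 e1 e2 e3
    refine ⟨by rw [patchCentre, e3]; exact hpos _ h1, ?_⟩
    rw [patchCentre, e0, e1, e2, e3]
    rintro ⟨h3, h4⟩
    rcases hb.eq_or_lt with rfl | hb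
    · have : a = 1 := by linarith
      subst this
      norm_num at h4
    · refine h2 ⟨(mul_eq_zero.1 h3).resolve_left hb.ne', ?_⟩
      have h5 : 0 ≤ a * (b * v 3) := by positivity
      have hb2 : 0 < b ^ 2 := by positivity
      have h6 : b ^ 2 * (v 1 ^ 2 + v 3 ^ 2) ≤ b ^ 2 * v 0 ^ 2 := by nlinarith [sq_nonneg a]
      exact le_of_mul_le_mul_left h6 hb2
  · obtain ⟨h1, h2, h3⟩ := hv
    have e0 := e 0
    have e1 := e 1
    have e3 := e 3
    simp only [patchCentre, PiLp.toLp_apply, Matrix.cons_val, mul_zero, zero_add, mul_one]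
      at e0 e1 e3
    have hs := side_ineq (x := -v 0) (y := v 1) ha hb hab h1 (by linarith) (by rw [neg_sq]; exact h3)
    have hp := hpos (-v 0) (by linarith)
    refine ⟨by rw [patchCentre, e3]; exact hpos _ h1, ?_, ?_⟩
    · rw [patchCentre, e0]; linarith
    · rw [patchCentre, e0, e1, e3]
      nlinarith
  · obtain ⟨h1, h2, h3⟩ := hv
    have e0 := e 0
    have e1 := e 1
    have e3 := e 3
    simp only [patchCentre, PiLp.toLp_apply, Matrix.cons_val, mul_zero, zero_add, mul_one]
      at e0 e1 e3
    have hs := side_ineq ha hb hab h1 h2 h3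
    have hp := hpos _ h2
    refine ⟨by rw [patchCentre, e3]; exact hpos _ h1, ?_, ?_⟩
    · rw [patchCentre, e0]; linarith
    · rw [patchCentre, e0, e1, e3]
      nlinarith
  · have e0 := e 0
    have e1 := e 1
    have e2 := e 2
    have e3 := e 3
    simp only [patchCentre, PiLp.toLp_apply, Matrix.cons_val, mul_zero, zero_add, mul_neg, mul_one]
      at e0 e1 e2 e3
    by_cases hlt : -a + b * v 3 < 0
    · left; rw [patchCentre, e3]; exact hlt
    · right
      have hb0 : 0 < b := by
        refine lt_of_le_of_ne hb ?_
        rintro rfl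
        exact hlt (by linarith)
      have hv3 : 0 ≤ v 3 := by
        by_contra hc
        exact hlt (by nlinarith [mul_pos_of_neg_of_neg (neg_lt_zero.2 hb0) (not_le.1 hc)])
      obtain ⟨h1, h2⟩ := hv.resolve_left (not_lt.2 hv3)
      constructor
      · have : firstThree (a • patchCentre .lower + b • v) = b • firstThree v := by
          simp only [patchCentre, firstThree, e0, e1, e2]
          rfl
        rw [this]
        exact outerCone_smul h1 hb0
      · rw [patchCentre, e0, e1, e2, e3]
        rintro ⟨h3, h4, h5⟩
        have hb2 : 0 < b ^ 2 := by positivity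
        refine h2 ⟨(mul_eq_zero.1 h3).resolve_left hb0.ne', ?_, ?_⟩
        · rw [mul_pow, mul_pow] at h4
          exact le_of_mul_le_mul_left h4 hb2
        · have h6 : (-a + b * v 3) ^ 2 ≤ (b * v 3) ^ 2 :=
            pow_le_pow_left₀ (not_lt.1 hlt) (by linarith) 2
          have h7 : b ^ 2 * v 0 ^ 2 ≤ b ^ 2 * (v 1 ^ 2 + v 3 ^ 2) := by nlinarith
          exact le_of_mul_le_mul_left h7 hb2

end

/-! ### Simple patches, subdivision of paths and holonomy -/

section

open Topology unitInterval

variable {X : Type*} [TopologicalSpace X]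

/-- A set in which any two points are joined by a path, and whose paths with given ends are
homotopic to each other in the ambient space. -/
structure IsSimplePatch (U : Set X) : Prop where
  exists_path : ∀ x ∈ U, ∀ y ∈ U, ∃ γ : Path x y, ∀ t, γ t ∈ U
  homotopic : ∀ {x y : X} (γ γ' : Path x y), (∀ t, γ t ∈ U) → (∀ t, γ' t ∈ U) → γ.Homotopic γ'

/-- Paths are sent to C by i, joined or deformed there, and brought back by r. The homotopy is only
needed in the ambient space. -/
theorem IsSimplePatch.of_retract {U : Set X} {C : Type*} [TopologicalSpace C]
    [SimplyConnectedSpace C] {i : U → C} {r : C → X} (hi : Continuous i) (hr : Continuous r)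
    (hri : ∀ u, r (i u) = u) (hrU : ∀ c, r c ∈ U) : IsSimplePatch U where
  exists_path x hx y hy := by
    obtain ⟨δ⟩ := PathConnectedSpace.joined (i ⟨x, hx⟩) (i ⟨y, hy⟩)
    exact ⟨(δ.map hr).cast (hri ⟨x, hx⟩).symm (hri ⟨y, hy⟩).symm, fun t => hrU _⟩
  homotopic {x y} γ γ' h h' := by
    have hx : x ∈ U := by simpa using h 0
    have hy : y ∈ U := by simpa using h 1
    let lift : ∀ δ : Path x y, (∀ t, δ t ∈ U) → Path (i ⟨x, hx⟩) (i ⟨y, hy⟩) := fun δ hδ =>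
      { toFun := fun t => i ⟨δ t, hδ t⟩
        continuous_toFun := hi.comp (δ.continuous.subtype_mk _)
        source' := by simp
        target' := by simp }
    have key : ∀ (δ : Path x y) (hδ : ∀ t, δ t ∈ U),
        ((lift δ hδ).map hr).cast (hri ⟨x, hx⟩).symm (hri ⟨y, hy⟩).symm = δ := fun δ hδ => by
      ext t
      exact hri ⟨δ t, hδ t⟩
    have := ((SimplyConnectedSpace.paths_homotopic (lift γ h) (lift γ' h')).map ⟨r, hr⟩).pathCast
      (hri ⟨x, hx⟩).symm (hri ⟨y, hy⟩).symm
    rw [← key γ h, ← key γ' h']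
    exact this

/-- A property of classes of paths that start at `b` holds for all of them if it survives the
extension by paths that stay inside a single member of an open cover. -/
theorem Path.Homotopic.Quotient.cover_induction {ι : Type*} {U : ι → Set X}
    (hU : ∀ i, IsOpen (U i)) (hcov : ∀ x, ∃ i, x ∈ U i) {b : X}
    {S : ∀ y, Path.Homotopic.Quotient b y → Prop} (h0 : S b (.refl b))
    (hstep : ∀ i y z (a : Path.Homotopic.Quotient b y) (γ : Path y z), (∀ t, γ t ∈ U i) →
      S y a → S z (a.trans (.mk γ))) (y : X) (a : Path.Homotopic.Quotient b y) : S y a := by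
  induction a using Path.Homotopic.Quotient.ind with
  | mk γ =>
  -- A Lebesgue subdivision; the property is carried along the initial segments of γ that end at the
  -- division points.
  obtain ⟨t, t0, tm, ⟨n, hn⟩, hc⟩ := exists_monotone_Icc_subset_open_cover_unitInterval
    (fun i => (hU i).preimage γ.continuous)
    (fun s _ => Set.mem_iUnion.2 (hcov (γ s)))
  have key : ∀ k, S (γ (t k)) (.mk ((γ.subpath 0 (t k)).cast γ.source.symm rfl)) := by
    intro k
    induction k with
    | zero =>
      have h1 : ∀ s : I, s = 0 → S (γ s) (.mk ((γ.subpath 0 s).cast γ.source.symm rfl)) := by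
        rintro s rfl
        have h2 : ∀ z (hz : z = b), S z (.mk ((Path.refl b).cast rfl hz)) := by
          rintro z rfl
          exact h0
        convert h2 (γ 0) γ.source using 2
        ext s
        simp
      exact h1 _ t0
    | succ k ih =>
      obtain ⟨i, hi⟩ := hc k
      have := hstep i _ _ _ (γ.subpath (t k) (t (k + 1))) (fun s => by
        have h1 : γ.subpath (t k) (t (k + 1)) s ∈ Set.range (γ.subpath (t k) (t (k + 1))) :=
          ⟨s, rfl⟩
        rw [Path.range_subpath_of_le _ _ _ (tm (Nat.le_succ k))] at h1
        obtain ⟨s', hs', e⟩ := h1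
        rw [← e]
        exact hi hs') ih
      rw [← Path.Homotopic.Quotient.mk_trans] at this
      convert this using 1
      refine Path.Homotopic.Quotient.eq.2 ?_
      exact (Path.Homotopic.pathCast ⟨Path.Homotopy.subpathTransSubpath γ 0 (t k) (t (k + 1))⟩
        γ.source.symm rfl).symm
  have e1 : t n = 1 := hn n le_rfl
  have : ∀ (s : I) (z : X) (_ : s = 1) (hz : z = γ s),
      S (γ s) (.mk ((γ.subpath 0 s).cast γ.source.symm rfl)) →
      S z (.mk ((γ.subpath 0 s).cast γ.source.symm hz)) := by
    rintro s z hs rfl h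
    exact h
  have h := this _ y e1 (by simp [e1]) (key n)
  convert h using 2
  ext s
  simp [e1, Path.subpath]

/-- A family of functions to a group whose quotients are locally constant on the overlaps of an
open cover defines a holonomy along paths. -/
theorem exists_holonomy {ι G : Type*} [Group G] {U : ι → Set X} (hU : ∀ i, IsOpen (U i))
    (hcov : ∀ x, ∃ i, x ∈ U i) (τ : ι → X → G)
    (hτ : ∀ i j, ∀ x ∈ U i ∩ U j, ∀ᶠ y in 𝓝 x, τ i y * (τ j y)⁻¹ = τ i x * (τ j x)⁻¹) :
    ∃ h : ∀ {x y : X}, Path.Homotopic.Quotient x y → G → G,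
      (∀ {x y z : X} (α : Path.Homotopic.Quotient x y) (β : Path.Homotopic.Quotient y z) (a : G),
        h (α.trans β) a = h β (h α a)) ∧
      ∀ (i : ι) {x y : X} (γ : Path x y), (∀ t, γ t ∈ U i) → ∀ a : G,
        h (.mk γ) a = a * (τ i x)⁻¹ * τ i y := by
  -- With the discrete fibre G, local constancy of τ i · (τ j)⁻¹ is continuity of the coordinate
  -- changes. The glued bundle is then a covering, whose monodromy gives the holonomy.
  let _ : TopologicalSpace G := ⊥
  have : DiscreteTopology G := ⟨rfl⟩
  choose idx hidx using hcov
  let Z : FiberBundleCore ι X G :=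
    { baseSet := U
      isOpen_baseSet := hU
      indexAt := idx
      mem_baseSet_at := hidx
      coordChange := fun i j x v => v * τ i x * (τ j x)⁻¹
      coordChange_self := fun i x _ v => by group
      continuousOn_coordChange := fun i j => by
        rintro ⟨x, v⟩ ⟨hx, -⟩
        refine ContinuousAt.continuousWithinAt ?_
        have : ∀ᶠ p : X × G in 𝓝 (x, v), v * τ i x * (τ j x)⁻¹ = p.2 * τ i p.1 * (τ j p.1)⁻¹ := by
          rw [nhds_prod_eq, nhds_discrete G, Filter.prod_pure, Filter.eventually_map]
          filter_upwards [hτ i j x hx] with y hy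
          rw [mul_assoc, mul_assoc, hy]
        exact (continuousAt_const (y := v * τ i x * (τ j x)⁻¹)).congr this
      coordChange_comp := fun i j k x _ v => by group }
  have cov : IsCoveringMap Z.proj :=
    IsCoveringMap.mk _ (fun _ => G) (fun x => Z.localTrivAt x) (fun x => Z.mem_localTrivAt_baseSet x)
  -- Multiplying by the τ of the chart chosen at a point cancels the choice of chart. In the chart i
  -- a lift has constant coordinate c, hence value c · τ i along the path.
  let val : Z.TotalSpace → G := fun e => id (α := G) e.2 * τ (idx e.1) e.1
  let A : ∀ y, Z.proj ⁻¹' {y} → G := fun y e => val e.1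
  let B : ∀ y, G → Z.proj ⁻¹' {y} := fun y a => ⟨⟨y, a * (τ (idx y) y)⁻¹⟩, rfl⟩
  have hBA : ∀ y e, B y (A y e) = e := by
    rintro y ⟨⟨y', v⟩, rfl : y' = y⟩
    refine Subtype.ext ?_
    refine congrArg (Bundle.TotalSpace.mk y') ?_
    exact mul_inv_cancel_right (G := G) v _
  refine ⟨fun {x y} γ a => A y (cov.monodromy γ (B x a)), fun α β a => ?_, fun i x y γ hγ a => ?_⟩
  · simp only [cov.monodromy_trans_apply, hBA]
  · have hc : ∀ t, (γ t, a * (τ i x)⁻¹) ∈ (Z.localTriv i).target := fun t =>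
      (Z.mem_localTriv_target i _).2 (hγ t)
    let Γ : C(I, Z.TotalSpace) :=
      ⟨fun t => (Z.localTriv i).toOpenPartialHomeomorph.symm (γ t, a * (τ i x)⁻¹),
        (Z.localTriv i).toOpenPartialHomeomorph.continuousOn_symm.comp_continuous
          (by fun_prop) hc⟩
    have h0 : (γ : C(I, X)) 0 = Z.proj (B x a).1 := γ.source
    have hΓ : Γ = cov.liftPath γ (B x a).1 h0 := by
      refine (cov.eq_liftPath_iff' _).2 ⟨rfl, ?_⟩
      change (⟨γ 0, a * (τ i x)⁻¹ * τ i (γ 0) * (τ (idx (γ 0)) (γ 0))⁻¹⟩ : Z.TotalSpace) = _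
      rw [γ.source, inv_mul_cancel_right]
    have h1 : (cov.monodromy (.mk γ) (B x a)).1 = Γ 1 := by
      rw [hΓ]
      rfl
    change val (cov.monodromy (.mk γ) (B x a)).1 = _
    rw [h1]
    change a * (τ i x)⁻¹ * τ i (γ 1) * (τ (idx (γ 1)) (γ 1))⁻¹ * τ (idx (γ 1)) (γ 1) = _
    rw [γ.target, inv_mul_cancel_right]

end

/-! ### The word read along the annulus -/

/-- The letter of the crossing with number `k`. -/
def crossingLetter (k : ℕ) : FreeGroup (Fin 2) := if Even k then letterX else letterX'

/-- The product of the letters of the first `k` crossings. -/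
def crossingWord (p q k : ℕ) : FreeGroup (Fin 2) :=
  ((List.range k).map fun j => crossingLetter j ^ schubertSign p q j).prod

theorem crossingWord_zero (p q : ℕ) : crossingWord p q 0 = 1 := rfl

theorem crossingWord_succ (p q k : ℕ) :
    crossingWord p q (k + 1) = crossingWord p q k * crossingLetter k ^ schubertSign p q k := by
  simp [crossingWord, List.range_succ]

section

variable {p q : ℕ}

theorem schubertLetters_reverse (hcop : Nat.Coprime q (2 * p)) :
    ((List.range (2 * p - 1)).map fun j =>
      crossingLetter (j + 1) ^ schubertSign p q (j + 1)).reverse =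
    (List.range (2 * p - 1)).map fun j => crossingLetter (j + 1) ^ schubertSign p q (j + 1) := by
  have h : (schubertList p q).map (fun l => FreeGroup.mk [l]) =
      (List.range (2 * p - 1)).map fun j => crossingLetter (j + 1) ^ schubertSign p q (j + 1) := by
    rw [schubertList, List.map_map]
    refine List.map_congr_left fun j _ => ?_
    have hX : FreeGroup.mk [((0 : Fin 2), false)] = letterX⁻¹ := rfl
    have hY : FreeGroup.mk [((1 : Fin 2), false)] = letterX'⁻¹ := rfl
    have hx : FreeGroup.mk [((0 : Fin 2), true)] = letterX := rfl
    have hy : FreeGroup.mk [((1 : Fin 2), true)] = letterX' := rfl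
    simp only [Function.comp, crossingLetter, schubertSign]
    by_cases h1 : Even (j + 1) <;> by_cases h2 : Even ((j + 1) * q / (2 * p)) <;>
      simp [h1, h2, hX, hY, hx, hy]
    all_goals simp [Nat.not_even_iff_odd.1 h2]
  rw [← h, ← List.map_reverse, schubertList_reverse hcop]

theorem crossingWord_half (hp : 0 < p) :
    crossingWord p q (2 * p) = letterX * schubertWord p q := by
  obtain ⟨n, hn⟩ : ∃ n, 2 * p = n + 1 := ⟨2 * p - 1, by omega⟩
  rw [crossingWord, schubertWord, show 2 * p - 1 = n by omega, hn, List.range_succ_eq_map,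
    List.map_cons, List.prod_cons, List.map_map]
  congr 1
  simp [crossingLetter, schubertSign]

theorem crossingLetter_add (j : ℕ) : crossingLetter (2 * p + j) = crossingLetter j := by
  simp [crossingLetter, Nat.even_add]

theorem schubertSign_add (hp : 0 < p) (hcop : Nat.Coprime q (2 * p)) (j : ℕ) :
    schubertSign p q (2 * p + j) = -schubertSign p q j := by
  have hq := odd_of_coprime_two_mul hcop
  rw [schubertSign, schubertSign, add_mul, Nat.add_comm, Nat.add_mul_div_left _ _ (by omega),
    pow_add, hq.neg_one_pow, mul_neg_one]

/-- The first half of the period reads xw. Since q is odd, ε_{2p+j} = −ε_j, so the second half reads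
the inverse letters in the same order; as w is a palindrome, this is x⁻¹w⁻¹. -/
theorem crossingWord_period (hp : 0 < p) (hcop : Nat.Coprime q (2 * p)) :
    crossingWord p q (4 * p) =
      letterX * schubertWord p q * letterX⁻¹ * (schubertWord p q)⁻¹ := by
  rw [← crossingWord_half hp, mul_assoc, ← mul_inv_rev]
  have h : ∀ k, crossingWord p q (2 * p + k) = crossingWord p q (2 * p) *
      ((List.range k).map fun j => (crossingLetter j ^ schubertSign p q j)⁻¹).prod := by
    intro k
    induction k with
    | zero => simp
    | succ k ih =>
      rw [← add_assoc, crossingWord_succ, ih, crossingLetter_add, schubertSign_add hp hcop,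
        List.range_succ, List.map_append, List.prod_append, zpow_neg, mul_assoc]
      simp
  rw [show 4 * p = 2 * p + 2 * p by ring, h, mul_inv_rev]
  congr 1
  obtain ⟨n, hn⟩ : ∃ n, 2 * p = n + 1 := ⟨2 * p - 1, by omega⟩
  have hr := schubertLetters_reverse hcop
  rw [schubertWord, List.prod_inv_reverse, show 2 * p - 1 = n by omega] at *
  have hr' : ((List.range n).map fun j =>
      (if Even (j + 1) then letterX else letterX') ^ schubertSign p q (j + 1)).reverse =
      (List.range n).map fun j => crossingLetter (j + 1) ^ schubertSign p q (j + 1) := hr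
  rw [← List.map_reverse, hr', hn, List.range_succ_eq_map, List.map_cons, List.prod_cons,
    List.map_map, List.map_map]
  congr 1
  simp [crossingLetter, schubertSign]

end

/-! ### Paths over cones and the two halves of a side patch -/

/-- A cone without apex that does not meet the cone over the link. -/
structure IsLinkCone (p q : ℕ) (C : Set (EuclideanSpace ℝ (Fin 4))) : Prop where
  zero_notMem : (0 : EuclideanSpace ℝ (Fin 4)) ∉ C
  smul_mem : ∀ v ∈ C, ∀ r : ℝ, 0 < r → r • v ∈ C
  notMem_link : ∀ x : Sphere3, x.1 ∈ C → x ∉ twoBridgeLink p q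

/-- The part of the complement of the link over a cone. -/
def conePatch (p q : ℕ) (C : Set (EuclideanSpace ℝ (Fin 4))) : Set (LinkComplement p q) :=
  {x | x.1.1 ∈ C}

/-- The open sets that cover the complement of the link. -/
abbrev linkPatch (p q : ℕ) (i : Patch) : Set (LinkComplement p q) := conePatch p q (patchCone p q i)

section

variable {p q : ℕ} {C : Set (EuclideanSpace ℝ (Fin 4))}

theorem IsLinkCone.inter (h : IsLinkCone p q C) {D : Set (EuclideanSpace ℝ (Fin 4))}
    (hD : ∀ v ∈ D, ∀ r : ℝ, 0 < r → r • v ∈ D) : IsLinkCone p q (C ∩ D) where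
  zero_notMem := fun h' => h.zero_notMem h'.1
  smul_mem := fun v hv r hr => ⟨h.smul_mem v hv.1 r hr, hD v hv.2 r hr⟩
  notMem_link := fun x hx => h.notMem_link x hx.1

theorem isLinkCone_patchCone (hq : 0 < q) (hcop : Nat.Coprime q (2 * p)) (i : Patch) :
    IsLinkCone p q (patchCone p q i) where
  zero_notMem := by
    intro h
    cases i
    · exact lt_irrefl _ h.1
    · exact lt_irrefl _ h.1
    · exact lt_irrefl _ h.1
    · rcases h with h | ⟨⟨k, h, -⟩, -⟩
      · exact lt_irrefl _ h
      · exact h.ne_zero rfl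
  smul_mem := fun v hv r hr => smul_mem_patchCone hv hr
  notMem_link := fun x hx => notMem_twoBridgeLink_of_mem_patchCone hq hcop hx

theorem IsLinkCone.norm_pos (h : IsLinkCone p q C) (v : C) : 0 < ‖v.1‖ :=
  norm_pos_iff.2 fun h0 => h.zero_notMem (h0 ▸ v.2)

/-- The radial projection of a cone to the complement of the link. -/
noncomputable def IsLinkCone.proj (h : IsLinkCone p q C) (v : C) : LinkComplement p q :=
  ⟨⟨‖v.1‖⁻¹ • v.1, by
    rw [mem_sphere_zero_iff_norm, norm_smul, norm_inv, norm_norm,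
      inv_mul_cancel₀ (h.norm_pos v).ne']⟩,
    h.notMem_link _ (h.smul_mem _ v.2 _ (inv_pos.2 (h.norm_pos v)))⟩

theorem IsLinkCone.proj_mem (h : IsLinkCone p q C) (v : C) : h.proj v ∈ conePatch p q C :=
  h.smul_mem _ v.2 _ (inv_pos.2 (h.norm_pos v))

theorem IsLinkCone.continuous_proj (h : IsLinkCone p q C) : Continuous h.proj := by
  refine Continuous.subtype_mk (Continuous.subtype_mk ?_ _) _
  exact (continuous_subtype_val.norm.inv₀ fun v => (h.norm_pos v).ne').smul continuous_subtype_val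

theorem IsLinkCone.proj_eq (h : IsLinkCone p q C) {v : C} {x : LinkComplement p q} {c : ℝ}
    (hc : 0 < c) (hx : x.1.1 = c • v.1) : h.proj v = x := by
  have h1 := sphere3_norm x.1
  rw [hx, norm_smul, Real.norm_of_nonneg hc.le] at h1
  refine Subtype.ext (Subtype.ext ?_)
  rw [hx]
  change ‖v.1‖⁻¹ • v.1 = c • v.1
  rw [inv_eq_of_mul_eq_one_left h1]

theorem IsLinkCone.isSimplePatch (h : IsLinkCone p q C) {c : EuclideanSpace ℝ (Fin 4)} (hc : c ∈ C)
    (hC : StarConvex ℝ c C) : IsSimplePatch (conePatch p q C) := by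
  have : ContractibleSpace C := hC.contractibleSpace ⟨c, hc⟩
  refine IsSimplePatch.of_retract (C := C) (i := fun x => ⟨x.1.1.1, x.2⟩) (r := h.proj)
    (by fun_prop) h.continuous_proj (fun u => ?_) h.proj_mem
  exact h.proj_eq one_pos (one_smul _ _).symm

theorem IsLinkCone.exists_path (h : IsLinkCone p q C) {f : ℝ → EuclideanSpace ℝ (Fin 4)}
    (hf : Continuous f) (hfC : ∀ t ∈ Set.Icc (0 : ℝ) 1, f t ∈ C) {x y : LinkComplement p q}
    {a b : ℝ} (ha : 0 < a) (hb : 0 < b) (hx : x.1.1 = a • f 0) (hy : y.1.1 = b • f 1) :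
    ∃ γ : Path x y, ∀ t, γ t ∈ conePatch p q C :=
  ⟨{ toFun := fun t => h.proj ⟨f t, hfC t t.2⟩
     continuous_toFun := h.continuous_proj.comp
       ((hf.comp continuous_subtype_val).subtype_mk _)
     source' := h.proj_eq ha hx
     target' := h.proj_eq hb hy }, fun _ => h.proj_mem _⟩

theorem IsLinkCone.exists_path_of_convex (h : IsLinkCone p q C) (hC : Convex ℝ C)
    {x y : LinkComplement p q} (hx : x ∈ conePatch p q C) (hy : y ∈ conePatch p q C) :
    ∃ γ : Path x y, ∀ t, γ t ∈ conePatch p q C := by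
  refine h.exists_path (f := AffineMap.lineMap x.1.1 y.1.1)
    AffineMap.lineMap_continuous (fun t ht => ?_) one_pos one_pos (by simp) (by simp)
  exact hC.lineMap_mem hx hy ht

theorem isOpen_linkPatch (hcop : Nat.Coprime q (2 * p)) (i : Patch) : IsOpen (linkPatch p q i) :=
  (isOpen_patchCone hcop i).preimage (continuous_subtype_val.comp continuous_subtype_val)

theorem exists_mem_linkPatch (hq : 0 < q) (hcop : Nat.Coprime q (2 * p)) (x : LinkComplement p q) :
    ∃ i, x ∈ linkPatch p q i :=
  exists_mem_patchCone hq hcop x.2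

theorem isSimplePatch_linkPatch (hq : 0 < q) (hcop : Nat.Coprime q (2 * p)) (i : Patch) :
    IsSimplePatch (linkPatch p q i) :=
  (isLinkCone_patchCone hq hcop i).isSimplePatch (patchCentre_mem i) (starConvex_patchCone i)

/-- The patch through which one passes the crossing with number `k`. -/
def crossingPatch (k : ℕ) : Patch := if Even k then .left else .right

/-- On which side of the disc that the inner arc cobounds with the crossing with number `k`. -/
def crossingHeight (k : ℕ) (x : LinkComplement p q) : ℝ := -(-1) ^ k * x.1.1 2

theorem continuous_crossingHeight (k : ℕ) :
    Continuous (crossingHeight k : LinkComplement p q → ℝ) := by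
  unfold crossingHeight
  have : Continuous fun x : LinkComplement p q => x.1.1 2 :=
    (PiLp.continuous_apply 2 _ 2).comp (continuous_subtype_val.comp continuous_subtype_val)
  fun_prop

theorem crossingHeight_ne_zero_iff {k : ℕ} {x : LinkComplement p q} :
    crossingHeight k x ≠ 0 ↔ x.1.1 2 ≠ 0 := by
  simp [crossingHeight]

theorem mem_crossingPatch_iff {k : ℕ} {v : EuclideanSpace ℝ (Fin 4)} :
    v ∈ patchCone p q (crossingPatch k) ↔
      0 < v 3 ∧ (-1) ^ k * v 0 < 0 ∧ v 1 ^ 2 + v 3 ^ 2 < v 0 ^ 2 := by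
  rcases Nat.even_or_odd k with h | h
  · simp [crossingPatch, h, patchCone]
  · simp [crossingPatch, Nat.not_even_iff_odd.2 h, patchCone, h.neg_one_pow]

theorem mem_upper_of_mem_crossingPatch {k : ℕ} {x : LinkComplement p q}
    (hx : x ∈ linkPatch p q (crossingPatch k)) (h : crossingHeight k x ≠ 0) :
    x ∈ linkPatch p q .upper :=
  ⟨(mem_crossingPatch_iff.1 hx).1, fun h' => crossingHeight_ne_zero_iff.1 h h'.1⟩

theorem crossingHeight_ne_zero {k : ℕ} {x : LinkComplement p q}
    (hx : x ∈ linkPatch p q (crossingPatch k)) (h : x ∈ linkPatch p q .upper) :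
    crossingHeight k x ≠ 0 := by
  rw [crossingHeight_ne_zero_iff]
  intro h'
  exact h.2 ⟨h', (mem_crossingPatch_iff.1 hx).2.2.le⟩

/-- Cauchy–Schwarz on the spacelike part; this makes the solid Lorentz cone convex. -/
theorem lorentz_ineq {a b c x y z : ℝ} (ha : 0 < a) (hx : 0 < x) (h : b ^ 2 + c ^ 2 < a ^ 2)
    (h' : y ^ 2 + z ^ 2 < x ^ 2) : b * y + c * z < a * x := by
  refine lt_of_pow_lt_pow_left₀ 2 (by positivity) ?_
  have h1 : (b * y + c * z) ^ 2 ≤ (b ^ 2 + c ^ 2) * (y ^ 2 + z ^ 2) := by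
    nlinarith [sq_nonneg (b * z - c * y)]
  have h2 : (b ^ 2 + c ^ 2) * (y ^ 2 + z ^ 2) ≤ (b ^ 2 + c ^ 2) * x ^ 2 := by gcongr
  have h3 : (b ^ 2 + c ^ 2) * x ^ 2 < a ^ 2 * x ^ 2 := by gcongr
  nlinarith

theorem convex_crossingPatch_half (k : ℕ) (e : ℝ) :
    Convex ℝ (patchCone p q (crossingPatch k) ∩ {v | 0 < e * v 2}) := by
  rintro v ⟨hv, hv2⟩ w ⟨hw, hw2⟩ a b ha hb hab
  rw [mem_crossingPatch_iff] at hv hw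
  obtain ⟨v3, v0, v1⟩ := hv
  obtain ⟨w3, w0, w1⟩ := hw
  have hl := lorentz_ineq (neg_pos.2 v0) (neg_pos.2 w0) (b := v 1) (c := v 3) (y := w 1) (z := w 3)
    (by rw [neg_sq, mul_pow, ← pow_mul, mul_comm k, pow_mul]; simpa using v1)
    (by rw [neg_sq, mul_pow, ← pow_mul, mul_comm k, pow_mul]; simpa using w1)
  have hl' : v 1 * w 1 + v 3 * w 3 < v 0 * w 0 := by
    have : ((-1 : ℝ) ^ k) ^ 2 = 1 := by rw [← pow_mul, mul_comm k, pow_mul]; simp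
    have e2 : -((-1) ^ k * v 0) * -((-1) ^ k * w 0) = ((-1 : ℝ) ^ k) ^ 2 * (v 0 * w 0) := by ring
    rw [e2, this, one_mul] at hl
    exact hl
  have e : ∀ j, (a • v + b • w) j = a * v j + b * w j := fun j => rfl
  have hpos : ∀ s t : ℝ, 0 < s → 0 < t → 0 < a * s + b * t := fun s t hs ht => by
    rcases ha.eq_or_lt with rfl | ha
    · have : b = 1 := by linarith
      subst this
      linarith
    · have := mul_pos ha hs
      have := mul_nonneg hb ht.le
      linarith
  refine ⟨mem_crossingPatch_iff.2 ⟨?_, ?_, ?_⟩, ?_⟩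
  · rw [e]; exact hpos _ _ v3 w3
  · rw [e]; have := hpos _ _ (neg_pos.2 v0) (neg_pos.2 w0); linarith
  · rw [e, e, e]
    have := hpos (a * (v 0 ^ 2 - v 1 ^ 2 - v 3 ^ 2) + b * (v 0 * w 0 - v 1 * w 1 - v 3 * w 3))
      (a * (v 0 * w 0 - v 1 * w 1 - v 3 * w 3) + b * (w 0 ^ 2 - w 1 ^ 2 - w 3 ^ 2))
      (hpos _ _ (by linarith) (by linarith)) (hpos _ _ (by linarith) (by linarith))
    nlinarith
  · change 0 < _ * (a * v 2 + b * w 2)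
    have := hpos _ _ hv2 hw2
    linarith

/-- The disc cuts a side patch into two convex halves, distinguished by the sign of the height. They
are the components of the intersection with the upper patch. -/
theorem exists_path_crossingPatch_half (hq : 0 < q) (hcop : Nat.Coprime q (2 * p)) {k : ℕ}
    {x y : LinkComplement p q} (hx : x ∈ linkPatch p q (crossingPatch k))
    (hy : y ∈ linkPatch p q (crossingPatch k)) (h : 0 < crossingHeight k x * crossingHeight k y) :
    ∃ γ : Path x y, ∀ t, γ t ∈ linkPatch p q (crossingPatch k) ∧ γ t ∈ linkPatch p q .upper := by
  set e := -(-1) ^ k * crossingHeight k x with he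
  have hC := (isLinkCone_patchCone hq hcop (crossingPatch k)).inter (D := {v | 0 < e * v 2})
    (fun v hv r hr => by
      change 0 < e * (r * v 2)
      have := mul_pos hr hv
      linarith)
  have hx0 : crossingHeight k x ≠ 0 := fun h0 => by simp [h0] at h
  have h1 : e * x.1.1 2 = crossingHeight k x * crossingHeight k x := by
    rw [he]; unfold crossingHeight; ring
  have h2 : e * y.1.1 2 = crossingHeight k x * crossingHeight k y := by
    rw [he]; unfold crossingHeight; ring
  obtain ⟨γ, hγ⟩ := hC.exists_path_of_convex (convex_crossingPatch_half k e) (x := x) (y := y)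
    ⟨hx, by rw [Set.mem_ofPred_eq, h1]; exact mul_self_pos.2 hx0⟩ ⟨hy, by rw [Set.mem_ofPred_eq, h2]; exact h⟩
  refine ⟨γ, fun t => ⟨(hγ t).1, mem_upper_of_mem_crossingPatch (hγ t).1 ?_⟩⟩
  rw [crossingHeight_ne_zero_iff]
  intro h0
  have := (hγ t).2
  rw [Set.mem_ofPred_eq, h0, mul_zero] at this
  exact lt_irrefl _ this

end

/-! ### Points over the strip and the crossings with the discs -/

/-- The point over the point `k` of the pillowcase at the height `h`. -/
noncomputable def pillowAt (k : ℝ × ℝ) (h : ℝ) : EuclideanSpace ℝ (Fin 4) :=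
  !₂[Real.cos (Real.pi * k.1), Real.cos (Real.pi * k.2),
    Real.sin (Real.pi * k.1) * Real.sin (Real.pi * k.2), h]

theorem continuous_pillowAt : Continuous fun a : (ℝ × ℝ) × ℝ => pillowAt a.1 a.2 := by
  refine (PiLp.continuous_toLp 2 _).comp (continuous_pi fun k => ?_)
  fin_cases k <;> simp <;> fun_prop

theorem OnRay.exists_eq_smul_pillowAt {v : EuclideanSpace ℝ (Fin 4)} {k : ℝ × ℝ}
    (h : OnRay (firstThree v) k) : ∃ c : ℝ, 0 < c ∧ v = c • pillowAt k (v 3 / c) := by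
  obtain ⟨c, hc, e⟩ := h
  refine ⟨c, hc, ?_⟩
  have e0 := congrArg Prod.fst e
  have e1 := congrArg (fun v => v.2.1) e
  have e2 := congrArg (fun v => v.2.2) e
  ext j
  fin_cases j
  · exact e0
  · exact e1
  · exact e2
  · exact (mul_div_cancel₀ (v 3) hc.ne').symm

/-- The points of the open strip between the lines that cover the outer arcs. -/
def InStrip (p q : ℕ) (k : ℝ × ℝ) : Prop := 0 < pillowLevel p q k ∧ pillowLevel p q k < 1

theorem isOpen_setOf_inStrip (p q : ℕ) : IsOpen {k | InStrip p q k} :=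
  (isOpen_lt continuous_const (continuous_pillowLevel p q)).inter
    (isOpen_lt (continuous_pillowLevel p q) continuous_const)

theorem convex_setOf_inStrip (p q : ℕ) : Convex ℝ {k | InStrip p q k} := by
  rintro k ⟨h0, h1⟩ l ⟨h0', h1'⟩ a b ha hb hab
  have e : pillowLevel p q (a • k + b • l) = a * pillowLevel p q k + b * pillowLevel p q l := by
    simp only [pillowLevel, Prod.fst_add, Prod.snd_add, Prod.smul_fst, Prod.smul_snd, smul_eq_mul]
    linear_combination (-q : ℝ) * hab
  constructor
  · rw [e]
    rcases ha.eq_or_lt with rfl | ha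
    · have : b = 1 := by linarith
      subst this
      linarith
    · have := mul_pos ha h0
      have := mul_nonneg hb h0'.le
      linarith
  · rw [e]
    rcases ha.eq_or_lt with rfl | ha
    · have : b = 1 := by linarith
      subst this
      linarith
    · have := mul_lt_mul_of_pos_left h1 ha
      have := mul_le_mul_of_nonneg_left h1'.le hb
      linarith

section

variable {p q : ℕ}

theorem sin_pi_mul_ne_zero_of_lt {n : ℕ} {s : ℝ} (h0 : (n : ℝ) < s) (h1 : s < n + 1) :
    Real.sin (Real.pi * s) ≠ 0 := by
  intro h
  obtain ⟨m, rfl⟩ := sin_pi_mul_eq_zero h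
  have h0' : (n : ℤ) < m := by exact_mod_cast h0
  have h1' : m < n + 1 := by exact_mod_cast h1
  omega

theorem pillowAt_mem_upper {k : ℝ × ℝ} (hs : Real.sin (Real.pi * k.1) ≠ 0) {h : ℝ} (hh : 0 < h) :
    pillowAt k h ∈ patchCone p q .upper := by
  refine ⟨hh, fun ⟨h2, h1⟩ => ?_⟩
  change Real.sin _ * Real.sin _ = 0 at h2
  change Real.cos _ ^ 2 + h ^ 2 ≤ Real.cos _ ^ 2 at h1
  have ht := (mul_eq_zero.1 h2).resolve_left hs
  have e1 := Real.sin_sq_add_cos_sq (Real.pi * k.1)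
  have e2 := Real.sin_sq_add_cos_sq (Real.pi * k.2)
  rw [ht] at e2
  nlinarith [sq_nonneg (Real.sin (Real.pi * k.1)), sq_nonneg h]

theorem pillowAt_mem_lower {k : ℝ × ℝ} (hk : InStrip p q k) (hs : Real.sin (Real.pi * k.1) ≠ 0)
    (h : ℝ) : pillowAt k h ∈ patchCone p q .lower := by
  refine .inr ⟨⟨k, onRay_pillowPoint k, hk⟩, fun ⟨h2, h1, _⟩ => ?_⟩
  change Real.sin _ * Real.sin _ = 0 at h2
  change Real.cos _ ^ 2 ≤ Real.cos _ ^ 2 at h1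
  have ht := (mul_eq_zero.1 h2).resolve_left hs
  have e1 := Real.sin_sq_add_cos_sq (Real.pi * k.1)
  have e2 := Real.sin_sq_add_cos_sq (Real.pi * k.2)
  rw [ht] at e2
  have := sq_pos_of_ne_zero hs
  nlinarith

/-- Over the strip, the upper and lower patches meet away from the vertical lines s ∈ ℤ. Each piece
n < s < n + 1 of the strip is convex, and so is the range of positive heights. -/
theorem exists_path_strip (hq : 0 < q) (hcop : Nat.Coprime q (2 * p)) {x y : LinkComplement p q}
    {k l : ℝ × ℝ} (hx : OnRay (firstThree x.1.1) k) (hy : OnRay (firstThree y.1.1) l)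
    (hk : InStrip p q k) (hl : InStrip p q l) (hx3 : 0 < x.1.1 3) (hy3 : 0 < y.1.1 3) {n : ℕ}
    (hk0 : (n : ℝ) < k.1) (hk1 : k.1 < n + 1) (hl0 : (n : ℝ) < l.1) (hl1 : l.1 < n + 1) :
    ∃ γ : Path x y, ∀ t, γ t ∈ linkPatch p q .upper ∧ γ t ∈ linkPatch p q .lower := by
  obtain ⟨a, ha, ex⟩ := hx.exists_eq_smul_pillowAt
  obtain ⟨b, hb, ey⟩ := hy.exists_eq_smul_pillowAt
  have hcont : Continuous fun t : ℝ => ((AffineMap.lineMap k l t : ℝ × ℝ),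
      (AffineMap.lineMap (x.1.1 3 / a) (y.1.1 3 / b) t : ℝ)) :=
    AffineMap.lineMap_continuous.prodMk AffineMap.lineMap_continuous
  have hC := (isLinkCone_patchCone hq hcop .upper).inter (D := patchCone p q .lower)
    (fun v hv r hr => smul_mem_patchCone hv hr)
  have hmem : ∀ t ∈ Set.Icc (0 : ℝ) 1, pillowAt (AffineMap.lineMap k l t)
      (AffineMap.lineMap (x.1.1 3 / a) (y.1.1 3 / b) t) ∈
        patchCone p q .upper ∩ patchCone p q .lower := by
    intro t ht
    have h1 : AffineMap.lineMap k l t ∈ {k | InStrip p q k} :=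
      (convex_setOf_inStrip p q).lineMap_mem hk hl ht
    have h2 : AffineMap.lineMap (x.1.1 3 / a) (y.1.1 3 / b) t ∈ Set.Ioi (0 : ℝ) :=
      (convex_Ioi 0).lineMap_mem (div_pos hx3 ha) (div_pos hy3 hb) ht
    have h3 : AffineMap.lineMap k.1 l.1 t ∈ Set.Ioo (n : ℝ) (n + 1) :=
      (convex_Ioo _ _).lineMap_mem ⟨hk0, hk1⟩ ⟨hl0, hl1⟩ ht
    have h4 : (AffineMap.lineMap k l t : ℝ × ℝ).1 = AffineMap.lineMap k.1 l.1 t := by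
      simp [AffineMap.lineMap_apply]
    have hs : Real.sin (Real.pi * (AffineMap.lineMap k l t : ℝ × ℝ).1) ≠ 0 := by
      rw [h4]
      exact sin_pi_mul_ne_zero_of_lt h3.1 h3.2
    exact ⟨pillowAt_mem_upper hs h2, pillowAt_mem_lower h1 hs _⟩
  obtain ⟨γ, hγ⟩ := hC.exists_path (continuous_pillowAt.comp hcont) hmem ha hb (x := x) (y := y)
    (by simpa only [Function.comp, AffineMap.lineMap_apply_zero] using ex)
    (by simpa only [Function.comp, AffineMap.lineMap_apply_one] using ey)
  exact ⟨γ, fun t => ⟨(hγ t).1, (hγ t).2⟩⟩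

/-- A fundamental domain for the deck translation (4p, 2q). It starts at s = 1 because the crossing
with number k lies at s = k + 1. -/
theorem exists_onRay_strip (hp : 0 < p) {v : ℝ × ℝ × ℝ} (hv : v ∈ outerCone p q) :
    ∃ k, OnRay v k ∧ InStrip p q k ∧ 1 ≤ k.1 ∧ k.1 < 4 * p + 1 := by
  obtain ⟨k, hk, h0, h1⟩ := hv
  have hp' : (0 : ℝ) < 4 * p := by positivity
  set a := ⌊(k.1 - 1) / (4 * p)⌋ with ha
  have e1 := Int.floor_le ((k.1 - 1) / (4 * p))
  have e2 := Int.lt_floor_add_one ((k.1 - 1) / (4 * p))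
  rw [← ha, le_div_iff₀ hp'] at e1
  rw [← ha, div_lt_iff₀ hp'] at e2
  have e : pillowLevel p q (k.1 - 4 * p * a, k.2 - 2 * q * a) = pillowLevel p q k := by
    simp only [pillowLevel]; ring
  refine ⟨(k.1 - 4 * p * a, k.2 - 2 * q * a), hk.congr ⟨-(2 * p * a), -(q * a), .inl ⟨?_, ?_⟩⟩,
    ⟨by rwa [e], by rwa [e]⟩, ?_, ?_⟩
  · push_cast; ring
  · push_cast; ring
  · change 1 ≤ k.1 - 4 * p * a
    linarith
  · change k.1 - 4 * p * a < 4 * p + 1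
    linarith

theorem OnRay.strip_unique (hp : 0 < p) (hcop : Nat.Coprime q (2 * p)) {v : ℝ × ℝ × ℝ}
    {k l : ℝ × ℝ} (hk : OnRay v k) (hl : OnRay v l) (hks : InStrip p q k) (hls : InStrip p q l) :
    ∃ a : ℤ, l.1 = k.1 + 4 * p * a ∧ l.2 = k.2 + 2 * q * a :=
  pillowEquiv_strip_unique hp hcop (hk.pillowEquiv hl) hks.1 hks.2 hls.1 hls.2

theorem mem_outerCone_of_mem_lower {x : LinkComplement p q} (hx : x ∈ linkPatch p q .lower)
    (h3 : 0 < x.1.1 3) : firstThree x.1.1 ∈ outerCone p q :=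
  (hx.resolve_left (not_lt.2 h3.le)).1

/-- Over a line s ∈ ℤ the points at or below the inner arc lie in a disc or on its rim, which the
upper patch omits; those at or above it are omitted by the lower patch. -/
theorem sin_ne_zero_of_mem {x : LinkComplement p q} (hx : x ∈ linkPatch p q .upper)
    (hx' : x ∈ linkPatch p q .lower) {k : ℝ × ℝ} (hk : OnRay (firstThree x.1.1) k) :
    Real.sin (Real.pi * k.1) ≠ 0 := by
  intro h
  obtain ⟨c, hc, e⟩ := hk
  have e0 : x.1.1 0 = c * Real.cos (Real.pi * k.1) := congrArg Prod.fst e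
  have e1 : x.1.1 1 = c * Real.cos (Real.pi * k.2) := congrArg (fun v => v.2.1) e
  have e2 : x.1.1 2 = c * (Real.sin (Real.pi * k.1) * Real.sin (Real.pi * k.2)) :=
    congrArg (fun v => v.2.2) e
  rw [h, zero_mul, mul_zero] at e2
  obtain ⟨h3, h4⟩ := hx
  have h5 := (hx'.resolve_left (not_lt.2 h3.le)).2
  have h6 : x.1.1 0 ^ 2 < x.1.1 1 ^ 2 + x.1.1 3 ^ 2 := by
    by_contra hc
    exact h4 ⟨e2, not_lt.1 hc⟩
  refine h5 ⟨e2, ?_, h6.le⟩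
  have := Real.sin_sq_add_cos_sq (Real.pi * k.1)
  have := Real.cos_sq_le_one (Real.pi * k.2)
  rw [e0, e1, mul_pow, mul_pow]
  refine mul_le_mul_of_nonneg_left ?_ (sq_nonneg c)
  nlinarith

/-- Inside the strip the crossing with number `k` lies in the unit square with number
`⌊k q / 2 p⌋`. -/
theorem InStrip.mem_square (hp : 0 < p) {k : ℕ} {t : ℝ} (h : InStrip p q (k + 1, t)) :
    ((k * q / (2 * p) : ℕ) : ℝ) < t ∧ t < (k * q / (2 * p) : ℕ) + 1 := by
  obtain ⟨h0, h1⟩ := h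
  simp only [pillowLevel, add_sub_cancel_right] at h0 h1
  have hp' : (0 : ℝ) < 2 * p := by positivity
  have e1 : 2 * p * (k * q / (2 * p)) ≤ k * q := Nat.mul_div_le _ _
  have e2 : k * q + 1 ≤ 2 * p * (k * q / (2 * p) + 1) := Nat.lt_mul_div_succ _ (by omega)
  have e1' : (2 * p * (k * q / (2 * p) : ℕ) : ℝ) ≤ k * q := by exact_mod_cast e1
  have e2' : (k * q + 1 : ℝ) ≤ 2 * p * ((k * q / (2 * p) : ℕ) + 1) := by exact_mod_cast e2
  constructor
  · exact lt_of_mul_lt_mul_left (by linarith) hp'.le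
  · exact lt_of_mul_lt_mul_left (by linarith) hp'.le

theorem sin_pi_mul_eq (n : ℕ) (s : ℝ) :
    Real.sin (Real.pi * s) = (-1) ^ n * Real.sin (Real.pi * (s - n)) := by
  rw [show Real.pi * s = Real.pi * (s - n) + n * Real.pi by ring, Real.sin_add_nat_mul_pi]

theorem sin_pi_mul_pos {t : ℝ} (h0 : 0 < t) (h1 : t < 1) : 0 < Real.sin (Real.pi * t) :=
  Real.sin_pos_of_pos_of_lt_pi (by have := Real.pi_pos; positivity)
    (by have := Real.pi_pos; nlinarith)

/-- The sign of the height near the crossing with number `k`. -/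
theorem exists_crossingHeight_eq {k : ℕ} {x : LinkComplement p q} {l : ℝ × ℝ}
    (hl : OnRay (firstThree x.1.1) l) (h0 : ((k * q / (2 * p) : ℕ) : ℝ) < l.2)
    (h1 : l.2 < (k * q / (2 * p) : ℕ) + 1) :
    ∃ c : ℝ, 0 < c ∧ crossingHeight k x =
      schubertSign p q k * (c * Real.sin (Real.pi * (l.1 - (k + 1)))) := by
  obtain ⟨c, hc, e⟩ := hl
  have e2 : x.1.1 2 = c * (Real.sin (Real.pi * l.1) * Real.sin (Real.pi * l.2)) :=
    congrArg (fun v => v.2.2) e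
  have hpos := sin_pi_mul_pos (t := l.2 - (k * q / (2 * p) : ℕ)) (by linarith) (by linarith)
  refine ⟨c * Real.sin (Real.pi * (l.2 - (k * q / (2 * p) : ℕ))), by positivity, ?_⟩
  rw [crossingHeight, e2, sin_pi_mul_eq (k + 1) l.1, sin_pi_mul_eq (k * q / (2 * p)) l.2,
    schubertSign]
  have : ((-1 : ℝ) ^ k) ^ 2 = 1 := by rw [← pow_mul, mul_comm k, pow_mul]; simp
  push_cast
  rw [pow_succ]
  linear_combination (c * (-1) ^ (k * q / (2 * p)) * Real.sin (Real.pi * (l.1 - (k + 1))) *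
    Real.sin (Real.pi * (l.2 - (k * q / (2 * p) : ℕ)))) * this

theorem schubertSign_eq (p q k : ℕ) : schubertSign p q k = 1 ∨ schubertSign p q k = -1 :=
  neg_one_pow_eq_or ℤ _

theorem sin_pi_mul_neg {t : ℝ} (h0 : t < 0) (h1 : -1 < t) : Real.sin (Real.pi * t) < 0 := by
  have := sin_pi_mul_pos (t := -t) (by linarith) (by linarith)
  rw [mul_neg, Real.sin_neg] at this
  linarith

/-- The strip is a covering of the annulus, hence an open map onto it: nearby points have lifts near
a given lift. -/
theorem onRay_eventually (hp : 0 < p) (hcop : Nat.Coprime q (2 * p)) {x : LinkComplement p q}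
    {k : ℝ × ℝ} (hk : OnRay (firstThree x.1.1) k) {V : Set (ℝ × ℝ)} (hV : V ∈ nhds k)
    (hks : InStrip p q k) :
    ∀ᶠ y : LinkComplement p q in nhds x, ∃ l ∈ V, InStrip p q l ∧ OnRay (firstThree y.1.1) l := by
  obtain ⟨W, hWV, hW, hkW⟩ := mem_nhds_iff.1 hV
  have hA : IsOpen {v : ℝ × ℝ × ℝ | ∃ l ∈ W, InStrip p q l ∧ OnRay v l} := by
    refine isOpen_of_isOpen_strip hcop ?_ ?_ ?_
    · rintro v ⟨l, -, hl, h⟩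
      exact ⟨l, h, hl⟩
    · rintro v ⟨l, hlW, hl, h⟩ r hr
      exact ⟨l, hlW, hl, h.smul hr⟩
    · rintro m h0 h1 ⟨l, hlW, hl, h⟩
      obtain ⟨a, e1, e2⟩ := (onRay_pillowPoint m).strip_unique hp hcop h ⟨h0, h1⟩ hl
      have hc : Continuous fun m' : ℝ × ℝ => (m'.1 + 4 * p * a, m'.2 + 2 * q * a) := by fun_prop
      have hm : ((m.1 + 4 * p * a, m.2 + 2 * q * a) : ℝ × ℝ) = l := Prod.ext e1.symm e2.symm
      have hO : IsOpen (W ∩ {k | InStrip p q k}) := hW.inter (isOpen_setOf_inStrip p q)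
      filter_upwards [hc.continuousAt.preimage_mem_nhds
        (hO.mem_nhds (show _ ∈ W ∩ {k | InStrip p q k} from hm ▸ ⟨hlW, hl⟩))] with m' hm'
      refine ⟨_, hm'.1, hm'.2, (onRay_pillowPoint m').congr ⟨2 * p * a, q * a, .inl ⟨?_, ?_⟩⟩⟩
      · push_cast; ring
      · push_cast; ring
  have hc : Continuous fun y : LinkComplement p q => firstThree y.1.1 :=
    continuous_firstThree.comp (continuous_subtype_val.comp continuous_subtype_val)
  filter_upwards [hc.continuousAt.preimage_mem_nhds (hA.mem_nhds ⟨k, hkW, hks, hk⟩)] with y hy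
  obtain ⟨l, hl, h⟩ := hy
  exact ⟨l, hWV hl, h⟩

end

section

variable {p q : ℕ}

theorem mem_lower_of_mem_crossingPatch {k : ℕ} {v : EuclideanSpace ℝ (Fin 4)}
    (hv : v ∈ patchCone p q (crossingPatch k)) (h : firstThree v ∈ outerCone p q) :
    v ∈ patchCone p q .lower :=
  .inr ⟨h, fun h' => not_lt.2 h'.2.2 (mem_crossingPatch_iff.1 hv).2.2⟩

/-- A point of the pillowcase in the intersection of two patches can be moved along the strip. -/
theorem exists_pillowAt_mem (hcop : Nat.Coprime q (2 * p)) {k : ℕ} {s t h : ℝ}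
    (hv : pillowAt (s, t) h ∈ patchCone p q (crossingPatch k)) (hs : InStrip p q (s, t)) :
    ∃ e : ℝ, 0 < e ∧ e < 1 ∧ ∀ u : ℝ, |u| ≤ e → InStrip p q (s + u, t) ∧
      pillowAt (s + u, t) h ∈ patchCone p q (crossingPatch k) ∩ patchCone p q .lower := by
  have hc : Continuous fun u : ℝ => ((s + u, t) : ℝ × ℝ) := by fun_prop
  have hc' : Continuous fun u : ℝ => pillowAt (s + u, t) h := by
    have h0 : Continuous fun u : ℝ => (((s + u, t), h) : (ℝ × ℝ) × ℝ) := by fun_prop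
    have h1 := continuous_pillowAt.comp h0
    exact h1
  have h1 : ∀ᶠ u in nhds (0 : ℝ), InStrip p q (s + u, t) :=
    ((isOpen_setOf_inStrip p q).preimage hc).eventually_mem (x := 0)
      (by rw [Set.mem_preimage, add_zero]; exact hs)
  have h2 : ∀ᶠ u in nhds (0 : ℝ), pillowAt (s + u, t) h ∈ patchCone p q (crossingPatch k) :=
    ((isOpen_patchCone hcop _).preimage hc').eventually_mem (x := 0)
      (by rw [Set.mem_preimage, add_zero]; exact hv)
  obtain ⟨e, he, hball⟩ := Metric.eventually_nhds_iff.1 (h1.and h2)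
  refine ⟨min (e / 2) (1 / 2), by positivity, by
    have := min_le_right (e / 2) (1 / 2 : ℝ); linarith, fun u hu => ?_⟩
  have hlt : dist u 0 < e := by
    rw [Real.dist_0_eq_abs]
    have := min_le_left (e / 2) (1 / 2 : ℝ)
    linarith
  obtain ⟨h3, h4⟩ := hball hlt
  exact ⟨h3, h4, mem_lower_of_mem_crossingPatch h4 ⟨_, onRay_pillowPoint _, h3⟩⟩

theorem exists_path_pillowAt (hq : 0 < q) (hcop : Nat.Coprime q (2 * p)) {i j : Patch}
    {s s' t h : ℝ} (hmem : ∀ u ∈ Set.uIcc s s',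
      pillowAt (u, t) h ∈ patchCone p q i ∩ patchCone p q j)
    {x y : LinkComplement p q} {a b : ℝ} (ha : 0 < a) (hb : 0 < b)
    (hx : x.1.1 = a • pillowAt (s, t) h) (hy : y.1.1 = b • pillowAt (s', t) h) :
    ∃ γ : Path x y, ∀ t, γ t ∈ linkPatch p q i ∧ γ t ∈ linkPatch p q j := by
  have hC := (isLinkCone_patchCone hq hcop i).inter (D := patchCone p q j)
    (fun v hv r hr => smul_mem_patchCone hv hr)
  have hc : Continuous fun u : ℝ => (((AffineMap.lineMap s s' u : ℝ), t), h) :=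
    (AffineMap.lineMap_continuous.prodMk continuous_const).prodMk continuous_const
  have hm : ∀ u ∈ Set.Icc (0 : ℝ) 1, pillowAt (AffineMap.lineMap s s' u, t) h ∈
      patchCone p q i ∩ patchCone p q j := fun u hu => by
    refine hmem _ ?_
    exact (convex_uIcc s s').lineMap_mem Set.left_mem_uIcc Set.right_mem_uIcc hu
  obtain ⟨γ, hγ⟩ := hC.exists_path (continuous_pillowAt.comp hc) hm ha hb (x := x) (y := y)
    (by simpa only [Function.comp, AffineMap.lineMap_apply_zero] using hx)
    (by simpa only [Function.comp, AffineMap.lineMap_apply_one] using hy)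
  exact ⟨γ, fun t => ⟨(hγ t).1, (hγ t).2⟩⟩

theorem exists_smul_pillowAt (hq : 0 < q) (hcop : Nat.Coprime q (2 * p)) {i : Patch} {k : ℝ × ℝ}
    {h : ℝ} (hv : pillowAt k h ∈ patchCone p q i) :
    ∃ (x : LinkComplement p q) (a : ℝ), 0 < a ∧ x.1.1 = a • pillowAt k h ∧ x ∈ linkPatch p q i ∧
      OnRay (firstThree x.1.1) k := by
  have hC := isLinkCone_patchCone hq hcop i
  have hn := inv_pos.2 (hC.norm_pos ⟨_, hv⟩)
  refine ⟨hC.proj ⟨_, hv⟩, _, hn, rfl, hC.proj_mem _, _, hn, rfl⟩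

/-- A path through the crossing with number `k`. -/
theorem exists_crossing_path (hp : 0 < p) (hq : 0 < q) (hcop : Nat.Coprime q (2 * p)) (k : ℕ) :
    ∃ (x y : LinkComplement p q) (l m : ℝ × ℝ) (γ : Path x y),
      (∀ t, γ t ∈ linkPatch p q (crossingPatch k) ∧ γ t ∈ linkPatch p q .lower) ∧
      (OnRay (firstThree x.1.1) l ∧ InStrip p q l ∧ (k : ℝ) < l.1 ∧ l.1 < k + 1) ∧
      (OnRay (firstThree y.1.1) m ∧ InStrip p q m ∧ (k + 1 : ℝ) < m.1 ∧ m.1 < k + 1 + 1) ∧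
      schubertSign p q k * crossingHeight k x < 0 ∧ 0 < schubertSign p q k * crossingHeight k y := by
  have hp' : (0 : ℝ) < 2 * p := by positivity
  -- The level 1/2, the middle of the strip, on the line s = k + 1.
  obtain ⟨t, ht⟩ : ∃ t : ℝ, t = (1 / 2 + q * k) / (2 * p) := ⟨_, rfl⟩
  have hlev : pillowLevel p q (k + 1, t) = 1 / 2 := by
    simp only [pillowLevel, ht]
    field_simp
    ring
  have hs : InStrip p q (k + 1, t) := by
    constructor <;> rw [hlev] <;> norm_num
  obtain ⟨t0, t1⟩ := hs.mem_square hp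
  have hst := sin_pi_mul_ne_zero_of_lt t0 t1
  -- Over this point the inner arc has height |sin πt|; half of it lies inside the disc.
  obtain ⟨h, hh⟩ : ∃ h : ℝ, h = |Real.sin (Real.pi * t)| / 2 := ⟨_, rfl⟩
  have hh0 : 0 < h := by rw [hh]; have := abs_pos.2 hst; positivity
  have hcos : Real.cos (Real.pi * (k + 1)) = -(-1) ^ k := by
    rw [show Real.pi * (k + 1 : ℝ) = (k + 1 : ℕ) * Real.pi by push_cast; ring,
      Real.cos_nat_mul_pi, pow_succ, mul_neg_one]
  have hsq : ((-1 : ℝ) ^ k) ^ 2 = 1 := by rw [← pow_mul, mul_comm k, pow_mul]; simp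
  have hv : pillowAt (k + 1, t) h ∈ patchCone p q (crossingPatch k) := by
    refine mem_crossingPatch_iff.2 ⟨hh0, ?_, ?_⟩
    · change (-1) ^ k * Real.cos (Real.pi * (k + 1)) < 0
      rw [hcos]
      nlinarith
    · change Real.cos (Real.pi * t) ^ 2 + h ^ 2 < Real.cos (Real.pi * (k + 1)) ^ 2
      rw [hcos, neg_sq, hsq, hh, div_pow, sq_abs]
      have := Real.sin_sq_add_cos_sq (Real.pi * t)
      have := sq_pos_of_ne_zero hst
      linarith
  obtain ⟨e, e0, e1, hmem⟩ := exists_pillowAt_mem hcop hv hs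
  have ha := hmem (-e) (by rw [abs_neg, abs_of_pos e0])
  have hb := hmem e (by rw [abs_of_pos e0])
  obtain ⟨x, a, a0, hx, -, hxr⟩ := exists_smul_pillowAt hq hcop ha.2.1
  obtain ⟨y, b, b0, hy, -, hyr⟩ := exists_smul_pillowAt hq hcop hb.2.1
  obtain ⟨γ, hγ⟩ := exists_path_pillowAt hq hcop (i := crossingPatch k) (j := .lower)
    (fun u hu => by
      rw [Set.uIcc_of_le (by linarith)] at hu
      have := (hmem (u - (k + 1)) (abs_le.2 ⟨by linarith [hu.1], by linarith [hu.2]⟩)).2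
      rwa [add_sub_cancel] at this) a0 b0 hx hy
  obtain ⟨c, c0, hcx⟩ := exists_crossingHeight_eq hxr t0 t1
  obtain ⟨d, d0, hdy⟩ := exists_crossingHeight_eq hyr t0 t1
  have hsign : (schubertSign p q k : ℝ) * schubertSign p q k = 1 := by
    rcases schubertSign_eq p q k with h | h <;> simp [h]
  refine ⟨x, y, _, _, γ, hγ, ⟨hxr, ha.1, ?_, ?_⟩, ⟨hyr, hb.1, ?_, ?_⟩, ?_, ?_⟩
  · change (k : ℝ) < k + 1 + -e
    linarith
  · change (k : ℝ) + 1 + -e < k + 1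
    linarith
  · change (k : ℝ) + 1 < k + 1 + e
    linarith
  · change (k : ℝ) + 1 + e < k + 1 + 1
    linarith
  · rw [hcx, ← mul_assoc, hsign, one_mul]
    refine mul_neg_of_pos_of_neg c0 (sin_pi_mul_neg ?_ ?_)
    · change (k : ℝ) + 1 + -e - (k + 1) < 0
      linarith
    · change -1 < (k : ℝ) + 1 + -e - (k + 1)
      linarith
  · rw [hdy, ← mul_assoc, hsign, one_mul]
    refine mul_pos d0 (sin_pi_mul_pos ?_ ?_)
    · change 0 < (k : ℝ) + 1 + e - (k + 1)
      linarith
    · change (k : ℝ) + 1 + e - (k + 1) < 1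
      linarith

theorem sin_ne_zero_of_mem_crossingPatch {k : ℕ} {x : LinkComplement p q}
    (hx : x ∈ linkPatch p q (crossingPatch k)) {l : ℝ × ℝ} (hl : OnRay (firstThree x.1.1) l) :
    Real.sin (Real.pi * l.2) ≠ 0 := by
  intro h
  obtain ⟨c, hc, e⟩ := hl
  have e0 : x.1.1 0 = c * Real.cos (Real.pi * l.1) := congrArg Prod.fst e
  have e1 : x.1.1 1 = c * Real.cos (Real.pi * l.2) := congrArg (fun v => v.2.1) e
  obtain ⟨h3, -, h4⟩ := mem_crossingPatch_iff.1 hx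
  have h5 := Real.sin_sq_add_cos_sq (Real.pi * l.2)
  have h6 := Real.cos_sq_le_one (Real.pi * l.1)
  rw [h] at h5
  have h7 : Real.cos (Real.pi * l.2) ^ 2 = 1 := by linarith
  rw [e0, e1, mul_pow, mul_pow, h7] at h4
  nlinarith [sq_nonneg (x.1.1 3), mul_le_mul_of_nonneg_left h6 (sq_nonneg c)]

/-- On the intersection of a side patch with the lower patch one can leave the discs. -/
theorem exists_path_leaving (hq : 0 < q) (hcop : Nat.Coprime q (2 * p)) {k : ℕ}
    {x : LinkComplement p q} (hx : x ∈ linkPatch p q (crossingPatch k))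
    (hx' : x ∈ linkPatch p q .lower) :
    ∃ (y : LinkComplement p q) (γ : Path x y),
      (∀ t, γ t ∈ linkPatch p q (crossingPatch k) ∧ γ t ∈ linkPatch p q .lower) ∧
      y ∈ linkPatch p q .upper := by
  by_cases h : crossingHeight k x = 0
  · obtain ⟨⟨s, t⟩, hr, hs⟩ := mem_outerCone_of_mem_lower hx' (mem_crossingPatch_iff.1 hx).1
    have hst := sin_ne_zero_of_mem_crossingPatch hx hr
    obtain ⟨a, a0, e⟩ := hr.exists_eq_smul_pillowAt
    have hs0 : Real.sin (Real.pi * s) = 0 := by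
      obtain ⟨c, hc, e⟩ := hr
      have e2 : x.1.1 2 = c * (Real.sin (Real.pi * s) * Real.sin (Real.pi * t)) :=
        congrArg (fun v => v.2.2) e
      have h0 : x.1.1 2 = 0 := by
        by_contra h'
        exact crossingHeight_ne_zero_iff.2 h' h
      rw [h0] at e2
      exact (mul_eq_zero.1 ((mul_eq_zero.1 e2.symm).resolve_left hc.ne')).resolve_right hst
    have hv : pillowAt (s, t) (x.1.1 3 / a) ∈ patchCone p q (crossingPatch k) := by
      have := smul_mem_patchCone (show x.1.1 ∈ patchCone p q (crossingPatch k) from hx)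
        (inv_pos.2 a0)
      rwa [e, smul_smul, inv_mul_cancel₀ a0.ne', one_smul] at this
    obtain ⟨d, d0, d1, hmem⟩ := exists_pillowAt_mem hcop hv hs
    have hd := hmem d (by rw [abs_of_pos d0])
    obtain ⟨y, b, b0, hy, hyU, hyr⟩ := exists_smul_pillowAt hq hcop hd.2.1
    obtain ⟨γ, hγ⟩ := exists_path_pillowAt hq hcop (i := crossingPatch k) (j := .lower)
      (fun u hu => by
        rw [Set.uIcc_of_le (by linarith)] at hu
        have := (hmem (u - s) (abs_le.2 ⟨by linarith [hu.1], by linarith [hu.2]⟩)).2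
        rwa [add_sub_cancel] at this) a0 b0 e hy
    refine ⟨y, γ, hγ, mem_upper_of_mem_crossingPatch hyU (crossingHeight_ne_zero_iff.2 ?_)⟩
    have e2 : y.1.1 2 = b * (Real.sin (Real.pi * (s + d)) * Real.sin (Real.pi * t)) := by
      rw [hy]; rfl
    have h1 := Real.sin_sq_add_cos_sq (Real.pi * s)
    rw [hs0] at h1
    rw [e2, mul_add, Real.sin_add, hs0, zero_mul, zero_add]
    refine mul_ne_zero b0.ne' (mul_ne_zero (mul_ne_zero ?_ (sin_pi_mul_pos d0 d1).ne') hst)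
    intro h2
    rw [h2] at h1
    norm_num at h1
  · exact ⟨x, Path.refl x, fun t => ⟨hx, hx'⟩, mem_upper_of_mem_crossingPatch hx h⟩

theorem Path.exists_eq_trans {X : Type*} [TopologicalSpace X] {x y : X} (γ : Path x y)
    {t₁ t₂ : unitInterval} (h : t₁ ≤ t₂) :
    ∃ (a : Path x (γ t₁)) (b : Path (γ t₁) (γ t₂)) (c : Path (γ t₂) y),
      γ.Homotopic (a.trans (b.trans c)) ∧ (∀ s, ∃ u ≤ t₁, γ u = a s) ∧
      (∀ s, ∃ u, t₁ ≤ u ∧ u ≤ t₂ ∧ γ u = b s) ∧ ∀ s, ∃ u, t₂ ≤ u ∧ γ u = c s := by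
  have hr : ∀ {r r' : unitInterval} (_ : r ≤ r') (s), ∃ u, r ≤ u ∧ u ≤ r' ∧ γ u = γ.subpath r r' s :=
    fun {r r'} hrr s => by
      have h1 : γ.subpath r r' s ∈ Set.range (γ.subpath r r') := ⟨s, rfl⟩
      rw [Path.range_subpath_of_le _ _ _ hrr] at h1
      obtain ⟨u, hu, e⟩ := h1
      exact ⟨u, hu.1, hu.2, e⟩
  refine ⟨(γ.subpath 0 t₁).cast γ.source.symm rfl, γ.subpath t₁ t₂,
    (γ.subpath t₂ 1).cast rfl γ.target.symm, ?_, fun s => ?_, fun s => hr h s, fun s => ?_⟩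
  · have h1 : ((γ.subpath 0 t₁).trans ((γ.subpath t₁ t₂).trans (γ.subpath t₂ 1))).Homotopic
        (γ.subpath 0 1) :=
      (Path.Homotopic.hcomp (Path.Homotopic.refl _) ⟨Path.Homotopy.subpathTransSubpath γ t₁ t₂ 1⟩).trans
        ⟨Path.Homotopy.subpathTransSubpath γ 0 t₁ 1⟩
    have h2 := (h1.pathCast γ.source.symm γ.target.symm).symm
    rw [Path.subpath_zero_one] at h2
    exact h2
  · obtain ⟨u, -, hu, e⟩ := hr unitInterval.nonneg' s
    exact ⟨u, hu, e⟩
  · obtain ⟨u, hu, -, e⟩ := hr unitInterval.le_one' s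
    exact ⟨u, hu, e⟩

end

/-! ### Transport in the fundamental groupoid -/

open CategoryTheory

/-- The class of a path as an arrow of the fundamental groupoid. -/
def pathClass {X : Type*} [TopologicalSpace X] {x y : X} (γ : Path x y) :
    FundamentalGroupoid.mk x ⟶ FundamentalGroupoid.mk y :=
  Path.Homotopic.Quotient.mk γ

/-- Compatible classes of paths from `b` to the points of `U`. -/
def IsTransport {X : Type*} [TopologicalSpace X] {b : X} (U : Set X)
    (c : ∀ x, x ∈ U → (FundamentalGroupoid.mk b ⟶ FundamentalGroupoid.mk x)) : Prop :=
  ∀ {x y : X} (hx : x ∈ U) (hy : y ∈ U) (γ : Path x y), (∀ t, γ t ∈ U) →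
    c x hx ≫ pathClass γ = c y hy

section

variable {X : Type*} [TopologicalSpace X]

theorem pathClass_refl (x : X) : pathClass (Path.refl x) = 𝟙 _ := rfl

theorem pathClass_trans {x y z : X} (γ : Path x y) (δ : Path y z) :
    pathClass (γ.trans δ) = pathClass γ ≫ pathClass δ := rfl

theorem pathClass_symm {x y : X} (γ : Path x y) : pathClass γ.symm = Groupoid.inv (pathClass γ) :=
  rfl

theorem pathClass_surjective {x y : X} (α : FundamentalGroupoid.mk x ⟶ FundamentalGroupoid.mk y) :
    ∃ γ : Path x y, pathClass γ = α :=
  Path.Homotopic.Quotient.mk_surjective α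

theorem Path.Homotopic.pathClass_eq {x y : X} {γ δ : Path x y} (h : γ.Homotopic δ) :
    pathClass γ = pathClass δ := Path.Homotopic.Quotient.eq.2 h

theorem IsSimplePatch.exists_isTransport {U : Set X} (h : IsSimplePatch U) {a b : X} (ha : a ∈ U)
    (α : FundamentalGroupoid.mk b ⟶ FundamentalGroupoid.mk a) :
    ∃ c : ∀ x, x ∈ U → (FundamentalGroupoid.mk b ⟶ FundamentalGroupoid.mk x),
      IsTransport U c ∧ c a ha = α := by
  choose δ hδ using h.exists_path a ha
  refine ⟨fun x hx => α ≫ pathClass (δ x hx), fun {x y} hx hy γ hγ => ?_, ?_⟩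
  · rw [Category.assoc, ← pathClass_trans]
    congr 1
    refine (h.homotopic _ _ (fun t => ?_) (hδ y hy)).pathClass_eq
    have h1 : ((δ x hx).trans γ) t ∈ Set.range ((δ x hx).trans γ) := ⟨t, rfl⟩
    rw [Path.trans_range] at h1
    rcases h1 with ⟨s, e⟩ | ⟨s, e⟩
    · rw [← e]; exact hδ x hx s
    · rw [← e]; exact hγ s
  · have h1 := (h.homotopic (δ a ha) (Path.refl a) (hδ a ha) fun _ => ha).pathClass_eq
    change α ≫ pathClass (δ a ha) = α
    rw [h1, pathClass_refl, Category.comp_id]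

end

/-! ### The small circles and the patches -/

section

variable {p q : ℕ}

theorem smallCircle_coord_sq (i : Fin 2) (θ : ℝ) :
    ((sideSign i * (√2 / 2) + Real.cos (2 * Real.pi * θ) / 4)) ^ 2 =
      1 / 2 + √2 / 4 * (sideSign i * Real.cos (2 * Real.pi * θ)) +
        Real.cos (2 * Real.pi * θ) ^ 2 / 16 := by
  have h2 : √2 ^ 2 = (2 : ℝ) := Real.sq_sqrt (by norm_num)
  have hs : sideSign i ^ 2 = 1 := by unfold sideSign; split_ifs <;> norm_num
  linear_combination (sideSign i ^ 2 / 4) * h2 + 1 / 2 * hs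

/-- The half of the circle that faces the plane x₀ = 0 stays off the disc; the opposite half lies in
the side patch. -/
theorem smallCircle_mem_upper {i : Fin 2} {t : unitInterval}
    (h : sideSign i * Real.cos (2 * Real.pi * t) ≤ 0) :
    smallCircle p q i t ∈ linkPatch p q .upper := by
  have hpos := smallCircleHeight_pos i t
  refine ⟨Real.sqrt_pos.2 hpos, ?_⟩
  change ¬(Real.sin (2 * Real.pi * t) / 4 = 0 ∧ 0 ^ 2 + √(smallCircleHeight i t) ^ 2 ≤
    (sideSign i * (√2 / 2) + Real.cos (2 * Real.pi * t) / 4) ^ 2)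
  rintro ⟨h1, h2⟩
  rw [Real.sq_sqrt hpos.le, smallCircleHeight, smallCircle_coord_sq, h1] at h2
  have h3 := Real.sin_sq_add_cos_sq (2 * Real.pi * t)
  have h4 : Real.sin (2 * Real.pi * t) = 0 := by linarith
  rw [h4] at h3
  have hs : sideSign i ^ 2 = 1 := by unfold sideSign; split_ifs <;> norm_num
  have h5 : (sideSign i * Real.cos (2 * Real.pi * t)) ^ 2 = 1 := by
    rw [mul_pow, hs]; linarith
  have h6 : sideSign i * Real.cos (2 * Real.pi * t) = -1 := by nlinarith
  have h7 : (1 : ℝ) ≤ √2 := Real.one_le_sqrt.2 (by norm_num)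
  rw [h6] at h2
  nlinarith

theorem neg_one_pow_val (i : Fin 2) : (-1 : ℝ) ^ i.val = -sideSign i := by
  fin_cases i <;> simp [sideSign]

theorem smallCircle_mem_side {i : Fin 2} {t : unitInterval}
    (h : 0 ≤ sideSign i * Real.cos (2 * Real.pi * t)) :
    smallCircle p q i t ∈ linkPatch p q (crossingPatch i.val) := by
  have hpos := smallCircleHeight_pos i t
  have hs : sideSign i ^ 2 = 1 := by unfold sideSign; split_ifs <;> norm_num
  have h2 : 0 < √(2 : ℝ) := Real.sqrt_pos.2 (by norm_num)
  refine mem_crossingPatch_iff.2 ⟨Real.sqrt_pos.2 hpos, ?_, ?_⟩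
  · change (-1) ^ i.val * (sideSign i * (√2 / 2) + Real.cos (2 * Real.pi * t) / 4) < 0
    rw [neg_one_pow_val]
    nlinarith
  · change 0 ^ 2 + √(smallCircleHeight i t) ^ 2 <
      (sideSign i * (√2 / 2) + Real.cos (2 * Real.pi * t) / 4) ^ 2
    rw [Real.sq_sqrt hpos.le, smallCircleHeight, smallCircle_coord_sq]
    have h3 := Real.sin_sq_add_cos_sq (2 * Real.pi * t)
    have h4 := mul_nonneg h2.le h
    nlinarith [sq_nonneg (Real.cos (2 * Real.pi * t))]

theorem smallCircle_height (i : Fin 2) (t : unitInterval) :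
    crossingHeight i.val (smallCircle p q i t) = sideSign i * (Real.sin (2 * Real.pi * t) / 4) := by
  rw [crossingHeight, neg_one_pow_val, neg_neg]
  rfl

/-- The points of a small circle that are at a quarter and at three quarters. -/
noncomputable def quarterPoint (u : Bool) : unitInterval :=
  if u then ⟨1 / 4, by norm_num, by norm_num⟩ else ⟨3 / 4, by norm_num, by norm_num⟩

theorem cos_quarterPoint (u : Bool) : Real.cos (2 * Real.pi * quarterPoint u) = 0 := by
  cases u
  · change Real.cos (2 * Real.pi * (3 / 4)) = 0
    rw [show 2 * Real.pi * (3 / 4) = Real.pi / 2 + Real.pi by ring, Real.cos_add_pi,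
      Real.cos_pi_div_two, neg_zero]
  · change Real.cos (2 * Real.pi * (1 / 4)) = 0
    rw [show 2 * Real.pi * (1 / 4) = Real.pi / 2 by ring, Real.cos_pi_div_two]

theorem sin_quarterPoint (u : Bool) :
    Real.sin (2 * Real.pi * quarterPoint u) = if u then 1 else -1 := by
  cases u
  · change Real.sin (2 * Real.pi * (3 / 4)) = -1
    rw [show 2 * Real.pi * (3 / 4) = Real.pi / 2 + Real.pi by ring, Real.sin_add_pi,
      Real.sin_pi_div_two]
  · change Real.sin (2 * Real.pi * (1 / 4)) = 1
    rw [show 2 * Real.pi * (1 / 4) = Real.pi / 2 by ring, Real.sin_pi_div_two]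

theorem cos_nonneg_outside {t : unitInterval} (h : t ≤ quarterPoint true ∨ quarterPoint false ≤ t) :
    0 ≤ Real.cos (2 * Real.pi * t) := by
  have hpi := Real.pi_pos
  have h0 := t.2.1
  have h1 := t.2.2
  rcases h with h | h
  · have h' : (t : ℝ) ≤ 1 / 4 := h
    exact Real.cos_nonneg_of_mem_Icc ⟨by nlinarith, by nlinarith⟩
  · have h' : (3 / 4 : ℝ) ≤ t := h
    rw [← Real.cos_two_pi_sub]
    exact Real.cos_nonneg_of_mem_Icc ⟨by nlinarith, by nlinarith⟩

theorem cos_nonpos_inside {t : unitInterval} (h : quarterPoint true ≤ t)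
    (h' : t ≤ quarterPoint false) : Real.cos (2 * Real.pi * t) ≤ 0 := by
  have hpi := Real.pi_pos
  have h1 : (1 / 4 : ℝ) ≤ t := h
  have h2 : (t : ℝ) ≤ 3 / 4 := h'
  exact Real.cos_nonpos_of_pi_div_two_le_of_le (by nlinarith) (by nlinarith)

theorem smallCircle_quarterPoint_mem (i : Fin 2) (u : Bool) :
    smallCircle p q i (quarterPoint u) ∈ linkPatch p q .upper ∧
      smallCircle p q i (quarterPoint u) ∈ linkPatch p q (crossingPatch i.val) :=
  ⟨smallCircle_mem_upper (by rw [cos_quarterPoint, mul_zero]),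
    smallCircle_mem_side (by rw [cos_quarterPoint, mul_zero])⟩

theorem smallCircle_quarterPoint_height (i : Fin 2) (u : Bool) :
    crossingHeight i.val (smallCircle p q i (quarterPoint u)) =
      sideSign i * ((if u then 1 else -1) / 4) := by
  rw [smallCircle_height, sin_quarterPoint]

/-- The point where a small circle starts. -/
noncomputable abbrev smallCircleBase (p q : ℕ) (i : Fin 2) : LinkComplement p q :=
  ⟨⟨smallCirclePoint i 0, smallCirclePoint_mem i 0⟩, smallCirclePoint_notMem p q i 0⟩

/-- A small circle passes once through the disc in a side patch and otherwise runs in the upper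
patch. -/
theorem exists_smallCircle_loop {b : LinkComplement p q} (i : Fin 2)
    {c : ∀ x, x ∈ linkPatch p q .upper → (FundamentalGroupoid.mk b ⟶ FundamentalGroupoid.mk x)}
    (hc : IsTransport (linkPatch p q .upper) c) :
    ∃ (γ : FundamentalGroupoid.mk b ⟶ FundamentalGroupoid.mk (smallCircleBase p q i))
      (x y : LinkComplement p q) (hx : x ∈ linkPatch p q .upper) (hy : y ∈ linkPatch p q .upper)
      (δ : Path x y), (∀ t, δ t ∈ linkPatch p q (crossingPatch i.val)) ∧
      crossingHeight i.val x < 0 ∧ 0 < crossingHeight i.val y ∧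
      γ ≫ pathClass (smallCircle p q i) ≫ Groupoid.inv γ =
        c x hx ≫ pathClass δ ≫ Groupoid.inv (c y hy) := by
  have hle : quarterPoint true ≤ quarterPoint false := by
    change (1 / 4 : ℝ) ≤ 3 / 4
    norm_num
  obtain ⟨α, β, δ, e, hα, hβ, hδ⟩ := (smallCircle p q i).exists_eq_trans hle
  have hq := fun u => (smallCircle_quarterPoint_mem (p := p) (q := q) i u).1
  have hh := fun u => smallCircle_quarterPoint_height (p := p) (q := q) i u
  have hcirc : pathClass (smallCircle p q i) = pathClass α ≫ pathClass β ≫ pathClass δ := by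
    rw [e.pathClass_eq, pathClass_trans, pathClass_trans]
  rw [hcirc]
  obtain rfl | rfl : i = 0 ∨ i = 1 := by omega
  -- The left circle starts on the half that faces x₀ = 0, so its middle portion β is the one that
  -- crosses the disc.
  · have hs : sideSign 0 = -1 := rfl
    have hα' : ∀ t, α t ∈ linkPatch p q .upper := fun t => by
      obtain ⟨u, hu, e⟩ := hα t
      have := cos_nonneg_outside (.inl hu)
      rw [← e]
      exact smallCircle_mem_upper (by rw [hs]; linarith)
    have hδ' : ∀ t, δ t ∈ linkPatch p q .upper := fun t => by
      obtain ⟨u, hu, e⟩ := hδ t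
      have := cos_nonneg_outside (.inr hu)
      rw [← e]
      exact smallCircle_mem_upper (by rw [hs]; linarith)
    have h0 : smallCircleBase p q 0 ∈ linkPatch p q .upper := by
      have := hα' 0
      rwa [α.source] at this
    have h1 := hc h0 (hq true) α hα'
    have h2 := hc (hq false) h0 δ hδ'
    refine ⟨c _ h0, _, _, hq true, hq false, β, fun t => ?_, ?_, ?_, ?_⟩
    · obtain ⟨u, hu, hu', e⟩ := hβ t
      have := cos_nonpos_inside hu hu'
      rw [← e]
      exact smallCircle_mem_side (by rw [hs]; linarith)
    · rw [hh, hs]; norm_num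
    · rw [hh, hs]; norm_num
    · rw [← h1, ← h2]
      simp
  · have hs : sideSign 1 = 1 := rfl
    have hβ' : ∀ t, β t ∈ linkPatch p q .upper := fun t => by
      obtain ⟨u, hu, hu', e⟩ := hβ t
      have := cos_nonpos_inside hu hu'
      rw [← e]
      exact smallCircle_mem_upper (by rw [hs]; linarith)
    have h1 := hc (hq true) (hq false) β hβ'
    -- The right circle starts in the side patch instead, so the portion that crosses the disc is
    -- the end followed by the beginning. The path to its base point must therefore run through δ.
    refine ⟨c _ (hq false) ≫ pathClass δ, _, _, hq false, hq true, δ.trans α, fun t => ?_, ?_, ?_, ?_⟩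
    · have ht : (δ.trans α) t ∈ Set.range (δ.trans α) := ⟨t, rfl⟩
      rw [Path.trans_range] at ht
      obtain ⟨u, hu, e⟩ : ∃ u, (u ≤ quarterPoint true ∨ quarterPoint false ≤ u) ∧
          smallCircle p q 1 u = (δ.trans α) t := by
        rcases ht with ⟨s, e⟩ | ⟨s, e⟩
        · obtain ⟨u, hu, e'⟩ := hδ s
          exact ⟨u, .inr hu, e'.trans e⟩
        · obtain ⟨u, hu, e'⟩ := hα s
          exact ⟨u, .inl hu, e'.trans e⟩
      have := cos_nonneg_outside hu
      rw [← e]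
      exact smallCircle_mem_side (by rw [hs]; linarith)
    · rw [hh, hs]; norm_num
    · rw [hh, hs]; norm_num
    · rw [pathClass_trans, ← h1]
      simp

end

/-! ### Generation by the two letters and the relation -/

/-- Classes of paths from `b` to all points, patch by patch, together with a loop for each word. They
differ on the intersections of the patches by the loops that run through the discs. -/
structure LinkTransport (p q : ℕ) (b : LinkComplement p q) where
  /-- The classes of paths. -/
  arrow : ∀ i x, x ∈ linkPatch p q i → (FundamentalGroupoid.mk b ⟶ FundamentalGroupoid.mk x)
  /-- The loop of a word. -/
  loop : FreeGroup (Fin 2) → (FundamentalGroupoid.mk b ⟶ FundamentalGroupoid.mk b)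
  isTransport : ∀ i, IsTransport (linkPatch p q i) (arrow i)
  loop_one : loop 1 = 𝟙 _
  loop_mul : ∀ g h, loop (g * h) = loop g ≫ loop h
  base_mem : b ∈ linkPatch p q .upper
  arrow_base : arrow .upper b base_mem = 𝟙 _
  arrow_neg : ∀ k x (hx : x ∈ linkPatch p q (crossingPatch k)) (hx' : x ∈ linkPatch p q .upper),
    crossingHeight k x < 0 → arrow _ x hx = arrow _ x hx'
  arrow_pos : ∀ k x (hx : x ∈ linkPatch p q (crossingPatch k)) (hx' : x ∈ linkPatch p q .upper),
    0 < crossingHeight k x → arrow _ x hx = loop (crossingLetter k) ≫ arrow _ x hx'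
  arrow_strip : ∀ x (hx : x ∈ linkPatch p q .lower) (hx' : x ∈ linkPatch p q .upper) (l : ℝ × ℝ),
    OnRay (firstThree x.1.1) l → InStrip p q l → 0 < l.1 → l.1 < 1 → arrow _ x hx = arrow _ x hx'

theorem Patch.eq_or (i : Patch) : i = .upper ∨ i = .lower ∨ ∃ k, i = crossingPatch k := by
  cases i
  · exact .inl rfl
  · exact .inr (.inr ⟨0, rfl⟩)
  · exact .inr (.inr ⟨1, rfl⟩)
  · exact .inr (.inl rfl)

theorem crossingPatch_eq_of_neg_one_pow {k k' : ℕ} (h : (0 : ℝ) < (-1) ^ k * (-1) ^ k') :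
    crossingPatch k = crossingPatch k' := by
  unfold crossingPatch
  rcases Nat.even_or_odd k with h1 | h1 <;> rcases Nat.even_or_odd k' with h2 | h2 <;>
    rw [h1.neg_one_pow, h2.neg_one_pow] at h
  · rw [if_pos h1, if_pos h2]
  · norm_num at h
  · norm_num at h
  · rw [if_neg (Nat.not_even_iff_odd.2 h1), if_neg (Nat.not_even_iff_odd.2 h2)]

theorem crossingPatch_eq_of_mem {p q k k' : ℕ} {x : LinkComplement p q}
    (hi : x ∈ linkPatch p q (crossingPatch k)) (hj : x ∈ linkPatch p q (crossingPatch k')) :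
    crossingPatch k = crossingPatch k' := by
  have h1 := (mem_crossingPatch_iff.1 hi).2.1
  have h2 := (mem_crossingPatch_iff.1 hj).2.1
  have h3 := mul_pos_of_neg_of_neg h1 h2
  refine crossingPatch_eq_of_neg_one_pow (pos_of_mul_pos_left (b := x.1.1 0 ^ 2) ?_ (sq_nonneg _))
  linarith

namespace LinkTransport

variable {p q : ℕ} {b : LinkComplement p q} (T : LinkTransport p q b)

theorem loop_inv_comp (g : FreeGroup (Fin 2)) : T.loop g⁻¹ ≫ T.loop g = 𝟙 _ := by
  rw [← T.loop_mul, inv_mul_cancel, T.loop_one]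

/-- Between the pieces n and n + 1 of the strip a path crosses one disc inside the lower patch. The
lower class is transported along it, while the comparison through the side patch changes the upper
class by the letter with exponent ε_n. -/
theorem arrow_lower (hp : 0 < p) (hq : 0 < q) (hcop : Nat.Coprime q (2 * p)) (n : ℕ) :
    ∀ (x : LinkComplement p q) (hx : x ∈ linkPatch p q .lower) (hx' : x ∈ linkPatch p q .upper)
      (l : ℝ × ℝ), OnRay (firstThree x.1.1) l → InStrip p q l → (n : ℝ) < l.1 → l.1 < n + 1 →
      T.arrow _ x hx = T.loop (crossingWord p q n) ≫ T.arrow _ x hx' := by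
  induction n with
  | zero =>
    intro x hx hx' l hl hs h0 h1
    rw [crossingWord_zero, T.loop_one, Category.id_comp]
    exact T.arrow_strip x hx hx' l hl hs (by simpa using h0) (by simpa using h1)
  | succ n ih =>
    intro x hx hx' l hl hs h0 h1
    obtain ⟨y, z, ly, lz, γ, hγ, ⟨y1, y2, y3, y4⟩, ⟨z1, z2, z3, z4⟩, hy, hz⟩ :=
      exists_crossing_path hp hq hcop n
    have hyS := (hγ 0).1
    have hyW := (hγ 0).2
    have hzS := (hγ 1).1
    have hzW := (hγ 1).2
    rw [γ.source] at hyS hyW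
    rw [γ.target] at hzS hzW
    have hyU := mem_upper_of_mem_crossingPatch hyS fun h => by rw [h, mul_zero] at hy; exact hy.false
    have hzU := mem_upper_of_mem_crossingPatch hzS fun h => by rw [h, mul_zero] at hz; exact hz.false
    have eW := T.isTransport _ hyW hzW γ fun t => (hγ t).2
    have eS := T.isTransport _ hyS hzS γ fun t => (hγ t).1
    have ey := ih y hyW hyU ly y1 y2 y3 y4
    obtain ⟨δ, hδ⟩ := exists_path_strip hq hcop (n := n + 1) z1 hl z2 hs hzU.1 hx'.1
      (by push_cast; exact z3) (by push_cast; exact z4) h0 h1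
    rw [← T.isTransport _ hzW hx δ fun t => (hδ t).2, ← T.isTransport _ hzU hx' δ fun t => (hδ t).1,
      ← eW, ey, crossingWord_succ, T.loop_mul]
    simp only [Category.assoc]
    rw [← Category.assoc, ← Category.assoc, ← Category.assoc (T.loop (crossingLetter n ^ _))]
    rw [← Category.assoc (T.loop (crossingWord p q n))]
    congr 1
    rw [Category.assoc]
    congr 1
    rcases schubertSign_eq p q n with h | h <;> rw [h] at hy hz ⊢ <;>
      simp only [Int.cast_one, one_mul, Int.cast_neg, neg_mul, Left.neg_neg_iff,
        Left.neg_pos_iff] at hy hz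
    · rw [T.arrow_neg n y hyS hyU hy, T.arrow_pos n z hzS hzU hz] at eS
      rw [eS, zpow_one]
    · rw [T.arrow_pos n y hyS hyU hy, T.arrow_neg n z hzS hzU hz] at eS
      rw [← eS, zpow_neg_one, Category.assoc, ← Category.assoc, T.loop_inv_comp, Category.id_comp]

/-- A point of the annulus has lifts at s and at s + 4p. Comparing the lower with the upper class
through both lifts gives the empty word and the word of a whole period, and the lower class is the
same. -/
theorem loop_relator (hp : 0 < p) (hq : 0 < q) (hcop : Nat.Coprime q (2 * p)) :
    T.loop (letterX * schubertWord p q * letterX⁻¹ * (schubertWord p q)⁻¹) = 𝟙 _ := by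
  obtain ⟨x, y, l, m, γ, hγ, ⟨h1, h2, h3, h4⟩, -, hx, -⟩ := exists_crossing_path hp hq hcop 0
  have hxS := (hγ 0).1
  have hxW := (hγ 0).2
  rw [γ.source] at hxS hxW
  have hxU := mem_upper_of_mem_crossingPatch hxS fun h => by rw [h, mul_zero] at hx; exact hx.false
  have e1 := T.arrow_lower hp hq hcop 0 x hxW hxU l h1 h2 h3 h4
  have e : pillowLevel p q (l.1 + 4 * p, l.2 + 2 * q) = pillowLevel p q l := by
    simp only [pillowLevel]; ring
  rw [Nat.cast_zero] at h3 h4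
  have e2 := T.arrow_lower hp hq hcop (4 * p) x hxW hxU (l.1 + 4 * p, l.2 + 2 * q)
    (h1.congr ⟨2 * p, q, .inl ⟨by push_cast; ring, by push_cast; ring⟩⟩)
    (by unfold InStrip; rw [e]; exact h2) (by push_cast; linarith) (by push_cast; linarith)
  rw [crossingWord_zero, T.loop_one, Category.id_comp] at e1
  rw [e1, crossingWord_period hp hcop] at e2
  rw [← cancel_mono (T.arrow _ x hxU), ← e2, Category.id_comp]

/-- Two patches are linked at a point if the classes of paths differ by the loop of a word. -/
def Linked (i j : Patch) (x : LinkComplement p q) : Prop :=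
  ∀ (hi : x ∈ linkPatch p q i) (hj : x ∈ linkPatch p q j),
    ∃ g, T.arrow i x hi = T.loop g ≫ T.arrow j x hj

variable {T}

theorem Linked.symm {i j : Patch} {x : LinkComplement p q} (h : T.Linked i j x) :
    T.Linked j i x := fun hj hi => by
  obtain ⟨g, e⟩ := h hi hj
  exact ⟨g⁻¹, by rw [e, ← Category.assoc, T.loop_inv_comp, Category.id_comp]⟩

theorem Linked.trans {i j k : Patch} {x : LinkComplement p q} (h : T.Linked i j x)
    (h' : T.Linked j k x) (hj : x ∈ linkPatch p q j) : T.Linked i k x := fun hi hk => by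
  obtain ⟨g, e⟩ := h hi hj
  obtain ⟨g', e'⟩ := h' hj hk
  exact ⟨g * g', by rw [e, e', T.loop_mul, Category.assoc]⟩

theorem Linked.of_path {i j : Patch} {x y : LinkComplement p q} (h : T.Linked i j y)
    (γ : Path x y) (hγ : ∀ t, γ t ∈ linkPatch p q i ∧ γ t ∈ linkPatch p q j) : T.Linked i j x :=
  fun hi hj => by
    have hi' := (hγ 1).1
    have hj' := (hγ 1).2
    rw [γ.target] at hi' hj'
    obtain ⟨g, e⟩ := h hi' hj'
    rw [← T.isTransport i hi hi' γ fun t => (hγ t).1, ← T.isTransport j hj hj' γ fun t => (hγ t).2,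
      ← Category.assoc] at e
    refine ⟨g, ?_⟩
    rwa [cancel_mono] at e

variable (T)

theorem linked_crossing_upper (k : ℕ) (x : LinkComplement p q) :
    T.Linked (crossingPatch k) .upper x := fun hi hj => by
  rcases lt_or_gt_of_ne (crossingHeight_ne_zero hi hj) with h | h
  · exact ⟨1, by rw [T.arrow_neg k x hi hj h, T.loop_one, Category.id_comp]⟩
  · exact ⟨_, T.arrow_pos k x hi hj h⟩

theorem linked_lower_upper (hp : 0 < p) (hq : 0 < q) (hcop : Nat.Coprime q (2 * p))
    (x : LinkComplement p q) : T.Linked .lower .upper x := fun hi hj => by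
  obtain ⟨l, hl, hs, h1, -⟩ := exists_onRay_strip hp (mem_outerCone_of_mem_lower hi hj.1)
  have hne := sin_ne_zero_of_mem hj hi hl
  refine ⟨_, T.arrow_lower hp hq hcop ⌊l.1⌋₊ x hi hj l hl hs ?_ (Nat.lt_floor_add_one _)⟩
  refine lt_of_le_of_ne (Nat.floor_le (by linarith)) fun h => hne ?_
  rw [← h, mul_comm, Real.sin_nat_mul_pi]

theorem linked_crossing_lower (hp : 0 < p) (hq : 0 < q) (hcop : Nat.Coprime q (2 * p)) (k : ℕ)
    (x : LinkComplement p q) : T.Linked (crossingPatch k) .lower x := fun hi hj => by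
  obtain ⟨y, γ, hγ, hy⟩ := exists_path_leaving hq hcop hi hj
  exact Linked.of_path ((T.linked_crossing_upper k y).trans (T.linked_lower_upper hp hq hcop y).symm
    hy) γ hγ hi hj

theorem linked (hp : 0 < p) (hq : 0 < q) (hcop : Nat.Coprime q (2 * p)) (i j : Patch)
    (x : LinkComplement p q) : T.Linked i j x := by
  have hrefl : ∀ i, T.Linked i i x := fun i _ _ => ⟨1, by rw [T.loop_one, Category.id_comp]⟩
  obtain rfl | rfl | ⟨k, rfl⟩ := i.eq_or <;> obtain rfl | rfl | ⟨k', rfl⟩ := j.eq_or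
  · exact hrefl _
  · exact (T.linked_lower_upper hp hq hcop x).symm
  · exact (T.linked_crossing_upper k' x).symm
  · exact T.linked_lower_upper hp hq hcop x
  · exact hrefl _
  · exact (T.linked_crossing_lower hp hq hcop k' x).symm
  · exact T.linked_crossing_upper k x
  · exact T.linked_crossing_lower hp hq hcop k x
  · intro hi hj
    have h : ∀ i j, i = j → T.Linked i j x := by
      rintro i _ rfl
      exact hrefl i
    exact h _ _ (crossingPatch_eq_of_mem hi hj) hi hj

/-- The property that a class is a word followed by a patch arrow survives every path inside one
patch, because patch arrows at a common point differ only by words. At b the upper arrow is the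
identity. -/
theorem loop_surjective (hp : 0 < p) (hq : 0 < q) (hcop : Nat.Coprime q (2 * p)) :
    Function.Surjective T.loop := by
  have key := Path.Homotopic.Quotient.cover_induction (b := b) (isOpen_linkPatch hcop)
    (exists_mem_linkPatch hq hcop)
    (S := fun y a => ∃ i, ∃ hy : y ∈ linkPatch p q i, ∃ g, a = T.loop g ≫ T.arrow i y hy)
    ⟨.upper, T.base_mem, 1, by
      rw [T.arrow_base, T.loop_one]
      exact (Category.id_comp (𝟙 (FundamentalGroupoid.mk b))).symm⟩
    (fun i y z a γ hγ => by
      rintro ⟨j, hy, g, e⟩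
      have hy' := hγ 0
      have hz := hγ 1
      rw [γ.source] at hy'
      rw [γ.target] at hz
      obtain ⟨g', e'⟩ := T.linked hp hq hcop j i y hy hy'
      refine ⟨i, hz, g * g', ?_⟩
      rw [← T.isTransport i hy' hz γ hγ, T.loop_mul, Category.assoc, ← Category.assoc (T.loop g'),
        ← e', ← Category.assoc, ← e]
      rfl)
  intro α
  obtain ⟨i, hi, g, e⟩ := key b α
  obtain ⟨g', e'⟩ := T.linked hp hq hcop i .upper b hi T.base_mem
  refine ⟨g * g', ?_⟩
  rw [T.loop_mul]
  have e2 : α = T.loop g ≫ T.arrow i b hi := e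
  rw [e2, e', T.arrow_base, Category.comp_id]

end LinkTransport

/-! ### The cocycle in the presented group: no further relations -/

/-- The group with the generators and the relator of the presentation. -/
abbrev SchubertGroup (p q : ℕ) : Type :=
  FreeGroup (Fin 2) ⧸ Subgroup.normalClosure
    ({letterX * schubertWord p q * letterX⁻¹ * (schubertWord p q)⁻¹} : Set (FreeGroup (Fin 2)))

/-- The value of a word in the presented group. -/
def schubertMk (p q : ℕ) : FreeGroup (Fin 2) →* SchubertGroup p q := QuotientGroup.mk' _

/-- The number of crossings that lie before the coordinate `s` along the strip; a crossing with
positive sign is not counted at its own coordinate. -/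
noncomputable def crossingIndex (p q : ℕ) (s : ℝ) : ℕ :=
  if s = ⌊s⌋₊ ∧ schubertSign p q (⌊s⌋₊ - 1) = 1 then ⌊s⌋₊ - 1 else ⌊s⌋₊

open Classical in
/-- The transition function from the upper patch to the given patch. -/
noncomputable def patchCocycle (p q : ℕ) : Patch → LinkComplement p q → SchubertGroup p q
  | .upper, _ => 1
  | .left, x => if 0 < crossingHeight 0 x then schubertMk p q (crossingLetter 0) else 1
  | .right, x => if 0 < crossingHeight 1 x then schubertMk p q (crossingLetter 1) else 1
  | .lower, x =>
    if h : ∃ l : ℝ × ℝ, OnRay (firstThree x.1.1) l ∧ InStrip p q l ∧ 1 ≤ l.1 ∧ l.1 < 4 * p + 1 then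
      schubertMk p q (crossingWord p q (crossingIndex p q h.choose.1)) else 1

section

variable {p q : ℕ}

theorem patchCocycle_crossing (k : ℕ) (x : LinkComplement p q) :
    patchCocycle p q (crossingPatch k) x =
      if 0 < crossingHeight k x then schubertMk p q (crossingLetter k) else 1 := by
  rcases Nat.even_or_odd k with h | h
  · have h1 : crossingPatch k = .left := by simp [crossingPatch, h]
    have h2 : crossingHeight k x = crossingHeight 0 x := by simp [crossingHeight, h.neg_one_pow]
    have h3 : crossingLetter k = crossingLetter 0 := by simp [crossingLetter, h]
    rw [h1, h2, h3]
    rfl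
  · have h1 : crossingPatch k = .right := by simp [crossingPatch, Nat.not_even_iff_odd.2 h]
    have h2 : crossingHeight k x = crossingHeight 1 x := by simp [crossingHeight, h.neg_one_pow]
    have h3 : crossingLetter k = crossingLetter 1 := by
      simp [crossingLetter, Nat.not_even_iff_odd.2 h]
    rw [h1, h2, h3]
    rfl

theorem patchCocycle_lower (hp : 0 < p) (hcop : Nat.Coprime q (2 * p)) {x : LinkComplement p q}
    {l : ℝ × ℝ} (hl : OnRay (firstThree x.1.1) l) (hs : InStrip p q l) (h1 : 1 ≤ l.1)
    (h2 : l.1 < 4 * p + 1) :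
    patchCocycle p q .lower x = schubertMk p q (crossingWord p q (crossingIndex p q l.1)) := by
  have h : ∃ l : ℝ × ℝ, OnRay (firstThree x.1.1) l ∧ InStrip p q l ∧ 1 ≤ l.1 ∧ l.1 < 4 * p + 1 :=
    ⟨l, hl, hs, h1, h2⟩
  obtain ⟨e1, e2, e3, e4⟩ := h.choose_spec
  obtain ⟨a, ha, -⟩ := hl.strip_unique hp hcop e1 hs e2
  have hp' : (0 : ℝ) < 4 * p := by positivity
  have ha0 : a = 0 := by
    have h3 : (a : ℝ) < 1 := by
      by_contra! hc
      nlinarith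
    have h4 : (-1 : ℝ) < a := by
      by_contra! hc
      nlinarith
    have h3' : a < 1 := by exact_mod_cast h3
    have h4' : -1 < a := by exact_mod_cast h4
    omega
  rw [ha0, Int.cast_zero, mul_zero, add_zero] at ha
  rw [patchCocycle, dif_pos h, ha]

theorem schubertMk_crossingWord_period (hp : 0 < p) (hcop : Nat.Coprime q (2 * p)) :
    schubertMk p q (crossingWord p q (4 * p)) = 1 := by
  rw [crossingWord_period hp hcop]
  exact (QuotientGroup.eq_one_iff _).2 (Subgroup.subset_normalClosure rfl)

/-- For n = 0 the lift lies outside the chosen domain 1 ≤ s < 4p + 1 and is moved by a whole period.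
The value there is the word of the period, which is trivial in the presented group: this is where
the cocycle closes up. -/
theorem patchCocycle_lower_of_lt (hp : 0 < p) (hcop : Nat.Coprime q (2 * p))
    {x : LinkComplement p q} {l : ℝ × ℝ} (hl : OnRay (firstThree x.1.1) l) (hs : InStrip p q l)
    {n : ℕ} (hn : n ≤ 4 * p) (h0 : (n : ℝ) < l.1) (h1 : l.1 < n + 1) :
    patchCocycle p q .lower x = schubertMk p q (crossingWord p q n) := by
  have key : ∀ {l : ℝ × ℝ} (_ : OnRay (firstThree x.1.1) l) (_ : InStrip p q l)
      {n : ℕ} (_ : n ≤ 4 * p) (_ : (n : ℝ) < l.1) (_ : l.1 < n + 1) (_ : n ≠ 0),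
      patchCocycle p q .lower x = schubertMk p q (crossingWord p q n) := by
    intro l hl hs n hn h0 h1 hn0
    have h2 : (1 : ℝ) ≤ n := by exact_mod_cast Nat.one_le_iff_ne_zero.2 hn0
    have h3 : (n : ℝ) ≤ 4 * p := by exact_mod_cast hn
    rw [patchCocycle_lower hp hcop hl hs (by linarith) (by linarith), crossingIndex]
    have hf : ⌊l.1⌋₊ = n := (Nat.floor_eq_iff (by linarith)).2 ⟨h0.le, h1⟩
    rw [hf, if_neg fun h => h0.ne' h.1]
  rcases eq_or_ne n 0 with rfl | hn0
  · have e : pillowLevel p q (l.1 + 4 * p, l.2 + 2 * q) = pillowLevel p q l := by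
      simp only [pillowLevel]; ring
    rw [Nat.cast_zero] at h0 h1
    rw [key (l := (l.1 + 4 * p, l.2 + 2 * q)) (n := 4 * p)
      (hl.congr ⟨2 * p, q, .inl ⟨by push_cast; ring, by push_cast; ring⟩⟩)
      (by unfold InStrip; rw [e]; exact hs) le_rfl (by push_cast; linarith)
      (by push_cast; linarith) (by omega), schubertMk_crossingWord_period hp hcop,
      crossingWord_zero, map_one]
  · exact key hl hs hn h0 h1 hn0

theorem patchCocycle_lower_of_eq (hp : 0 < p) (hcop : Nat.Coprime q (2 * p))
    {x : LinkComplement p q} {l : ℝ × ℝ} (hl : OnRay (firstThree x.1.1) l) (hs : InStrip p q l)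
    {k : ℕ} (hk : k < 4 * p) (h : l.1 = k + 1) :
    patchCocycle p q .lower x = schubertMk p q
      (crossingWord p q (if schubertSign p q k = 1 then k else k + 1)) := by
  have h3 : (k : ℝ) + 1 ≤ 4 * p := by exact_mod_cast hk
  have h4 : (0 : ℝ) ≤ k := Nat.cast_nonneg k
  rw [patchCocycle_lower hp hcop hl hs (by linarith) (by linarith), crossingIndex]
  have hf : ⌊l.1⌋₊ = k + 1 := by
    rw [h, show (k : ℝ) + 1 = (k + 1 : ℕ) by push_cast; rfl, Nat.floor_natCast]
  rw [hf, Nat.add_sub_cancel]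
  have he : l.1 = (k + 1 : ℕ) := by rw [h]; push_cast; rfl
  simp only [he, true_and]

theorem eventually_patchCocycle_crossing {k : ℕ} {x : LinkComplement p q}
    (hx : x ∈ linkPatch p q (crossingPatch k)) (hx' : x ∈ linkPatch p q .upper) :
    ∀ᶠ y in nhds x, patchCocycle p q (crossingPatch k) y = patchCocycle p q (crossingPatch k) x := by
  have hc := (continuous_crossingHeight (p := p) (q := q) k).continuousAt (x := x)
  rcases lt_or_gt_of_ne (crossingHeight_ne_zero hx hx') with h | h
  · filter_upwards [hc.eventually (gt_mem_nhds h)] with y hy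
    rw [patchCocycle_crossing, patchCocycle_crossing, if_neg hy.not_gt, if_neg h.not_gt]
  · filter_upwards [hc.eventually (lt_mem_nhds h)] with y hy
    rw [patchCocycle_crossing, patchCocycle_crossing, if_pos hy, if_pos h]

theorem eventually_patchCocycle_lower (hp : 0 < p) (hcop : Nat.Coprime q (2 * p))
    {x : LinkComplement p q} (hx : x ∈ linkPatch p q .lower) (hx' : x ∈ linkPatch p q .upper) :
    ∀ᶠ y in nhds x, patchCocycle p q .lower y = patchCocycle p q .lower x := by
  obtain ⟨l, hl, hs, h1, h2⟩ := exists_onRay_strip hp (mem_outerCone_of_mem_lower hx hx'.1)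
  have hne := sin_ne_zero_of_mem hx' hx hl
  have h3 : (⌊l.1⌋₊ : ℝ) < l.1 := by
    refine lt_of_le_of_ne (Nat.floor_le (by linarith)) fun h => hne ?_
    rw [← h, mul_comm, Real.sin_nat_mul_pi]
  have h4 := Nat.lt_floor_add_one l.1
  have h5 : ⌊l.1⌋₊ ≤ 4 * p := by
    have : (⌊l.1⌋₊ : ℝ) < (4 * p + 1 : ℕ) := by push_cast; linarith
    have := Nat.cast_lt.1 this
    omega
  have hV : {m : ℝ × ℝ | (⌊l.1⌋₊ : ℝ) < m.1 ∧ m.1 < ⌊l.1⌋₊ + 1} ∈ nhds l :=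
    ((isOpen_lt continuous_const continuous_fst).inter
      (isOpen_lt continuous_fst continuous_const)).mem_nhds ⟨h3, h4⟩
  filter_upwards [onRay_eventually hp hcop hl hV hs] with y ⟨m, hm, hms, hmr⟩
  rw [patchCocycle_lower_of_lt hp hcop hmr hms h5 hm.1 hm.2,
    patchCocycle_lower_of_lt hp hcop hl hs h5 h3 h4]

/-- Across a disc the side function jumps by a letter and the lower one by the same jump, so their
quotient stays constant. On the disc itself the side function takes its value from negative height;
`crossingIndex` is defined so that the lower function does the same, which is before the crossing if
ε = 1 and after it if ε = −1. -/
theorem eventually_patchCocycle_crossing_lower (hp : 0 < p) (hcop : Nat.Coprime q (2 * p)) {k : ℕ}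
    {x : LinkComplement p q} (hx : x ∈ linkPatch p q (crossingPatch k))
    (hx' : x ∈ linkPatch p q .lower) :
    ∀ᶠ y in nhds x, patchCocycle p q (crossingPatch k) y * (patchCocycle p q .lower y)⁻¹ =
      patchCocycle p q (crossingPatch k) x * (patchCocycle p q .lower x)⁻¹ := by
  by_cases h : crossingHeight k x = 0
  · have h3 := (mem_crossingPatch_iff.1 hx).1
    obtain ⟨⟨s, t⟩, hl, hs, h1, h2⟩ := exists_onRay_strip hp (mem_outerCone_of_mem_lower hx' h3)
    have hst := sin_ne_zero_of_mem_crossingPatch hx hl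
    obtain ⟨c, hc, e⟩ := id hl
    have e0 : x.1.1 0 = c * Real.cos (Real.pi * s) := congrArg Prod.fst e
    have e2 : x.1.1 2 = c * (Real.sin (Real.pi * s) * Real.sin (Real.pi * t)) :=
      congrArg (fun v => v.2.2) e
    have hz : x.1.1 2 = 0 := by
      by_contra h'
      exact crossingHeight_ne_zero_iff.2 h' h
    rw [hz] at e2
    obtain ⟨n, rfl⟩ := sin_pi_mul_eq_zero
      ((mul_eq_zero.1 ((mul_eq_zero.1 e2.symm).resolve_left hc.ne')).resolve_right hst)
    have hn1 : 1 ≤ n := by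
      have h4 : (1 : ℝ) ≤ n := h1
      exact_mod_cast h4
    obtain ⟨k', rfl⟩ : ∃ k' : ℕ, n = k' + 1 := ⟨(n - 1).toNat, by omega⟩
    have hk4 : k' < 4 * p := by
      have : ((k' + 1 : ℕ) : ℝ) < (4 * p + 1 : ℕ) := by
        have h4 : (((k' : ℤ) + 1 : ℤ) : ℝ) < 4 * p + 1 := h2
        push_cast at h4 ⊢
        exact h4
      have := Nat.cast_lt.1 this
      omega
    push_cast at hl hs e0
    have hkk : crossingPatch k = crossingPatch k' := by
      have h4 := (mem_crossingPatch_iff.1 hx).2.1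
      rw [e0, show Real.pi * ((k' : ℝ) + 1) = (k' + 1 : ℕ) * Real.pi by push_cast; ring,
        Real.cos_nat_mul_pi, pow_succ] at h4
      refine crossingPatch_eq_of_neg_one_pow (pos_of_mul_pos_left (b := c) ?_ hc.le)
      linarith
    obtain ⟨t0, t1⟩ := hs.mem_square hp
    have hV : {m : ℝ × ℝ | ((k' : ℝ) < m.1 ∧ m.1 < k' + 1 + 1) ∧
        (((k' * q / (2 * p) : ℕ) : ℝ) < m.2 ∧ m.2 < (k' * q / (2 * p) : ℕ) + 1)} ∈
        nhds (((k' : ℝ) + 1, t) : ℝ × ℝ) :=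
      (((isOpen_lt continuous_const continuous_fst).inter
        (isOpen_lt continuous_fst continuous_const)).inter
        ((isOpen_lt continuous_const continuous_snd).inter
        (isOpen_lt continuous_snd continuous_const))).mem_nhds
        ⟨⟨by simp, by simp⟩, t0, t1⟩
    rw [hkk]
    filter_upwards [onRay_eventually hp hcop hl hV hs] with y ⟨m, ⟨⟨m0, m1⟩, m2, m3⟩, hms, hmr⟩
    obtain ⟨d, hd, hy⟩ := exists_crossingHeight_eq hmr m2 m3
    have hx0 : ¬0 < crossingHeight k' x := by simp [crossingHeight, hz]
    rw [patchCocycle_crossing, patchCocycle_crossing, if_neg hx0,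
      patchCocycle_lower_of_eq hp hcop hl hs hk4 rfl]
    rcases lt_trichotomy m.1 (k' + 1) with hm | hm | hm
    · have hsin : Real.sin (Real.pi * (m.1 - (k' + 1))) < 0 :=
        sin_pi_mul_neg (by linarith) (by linarith)
      rw [patchCocycle_lower_of_lt hp hcop hmr hms hk4.le m0 hm]
      rcases schubertSign_eq p q k' with hsg | hsg
      · rw [if_pos hsg, if_neg]
        rw [hy, hsg, Int.cast_one, one_mul]
        exact not_lt.2 (mul_neg_of_pos_of_neg hd hsin).le
      · have hsg' : ¬schubertSign p q k' = 1 := by rw [hsg]; decide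
        rw [if_neg hsg', if_pos, crossingWord_succ, hsg]
        · simp
        · rw [hy, hsg]
          push_cast
          have := mul_neg_of_pos_of_neg hd hsin
          linarith
    · rw [patchCocycle_lower_of_eq hp hcop hmr hms hk4 hm, if_neg]
      rw [hy, hm]
      simp
    · have hsin : 0 < Real.sin (Real.pi * (m.1 - (k' + 1))) :=
        sin_pi_mul_pos (by linarith) (by linarith)
      rw [patchCocycle_lower_of_lt hp hcop hmr hms (n := k' + 1) hk4 (by push_cast; exact hm)
        (by push_cast; exact m1)]
      rcases schubertSign_eq p q k' with hsg | hsg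
      · rw [if_pos hsg, if_pos, crossingWord_succ, hsg]
        · simp
        · rw [hy, hsg, Int.cast_one, one_mul]
          exact mul_pos hd hsin
      · have hsg' : ¬schubertSign p q k' = 1 := by rw [hsg]; decide
        rw [if_neg hsg', if_neg]
        rw [hy, hsg]
        push_cast
        have := mul_pos hd hsin
        linarith
  · have hU := mem_upper_of_mem_crossingPatch hx h
    filter_upwards [eventually_patchCocycle_crossing hx hU,
      eventually_patchCocycle_lower hp hcop hx' hU] with y h1 h2
    rw [h1, h2]

theorem eventually_patchCocycle (hp : 0 < p) (hcop : Nat.Coprime q (2 * p)) (i j : Patch)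
    (x : LinkComplement p q) (hx : x ∈ linkPatch p q i ∩ linkPatch p q j) :
    ∀ᶠ y in nhds x, patchCocycle p q i y * (patchCocycle p q j y)⁻¹ =
      patchCocycle p q i x * (patchCocycle p q j x)⁻¹ := by
  have hrefl : ∀ i, ∀ᶠ y in nhds x, patchCocycle p q i y * (patchCocycle p q i y)⁻¹ =
      patchCocycle p q i x * (patchCocycle p q i x)⁻¹ := fun i => by simp
  have hsymm : ∀ {i j}, (∀ᶠ y in nhds x, patchCocycle p q i y * (patchCocycle p q j y)⁻¹ =
      patchCocycle p q i x * (patchCocycle p q j x)⁻¹) →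
      ∀ᶠ y in nhds x, patchCocycle p q j y * (patchCocycle p q i y)⁻¹ =
      patchCocycle p q j x * (patchCocycle p q i x)⁻¹ := fun h => by
    filter_upwards [h] with y hy
    simpa using congrArg (·⁻¹) hy
  have hupper : ∀ {i}, (∀ᶠ y in nhds x, patchCocycle p q i y = patchCocycle p q i x) →
      ∀ᶠ y in nhds x, patchCocycle p q i y * (patchCocycle p q .upper y)⁻¹ =
      patchCocycle p q i x * (patchCocycle p q .upper x)⁻¹ := fun h => by
    filter_upwards [h] with y hy
    rw [hy]
    rfl
  obtain rfl | rfl | ⟨k, rfl⟩ := i.eq_or <;> obtain rfl | rfl | ⟨k', rfl⟩ := j.eq_or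
  · exact hrefl _
  · exact hsymm (hupper (eventually_patchCocycle_lower hp hcop hx.2 hx.1))
  · exact hsymm (hupper (eventually_patchCocycle_crossing hx.2 hx.1))
  · exact hupper (eventually_patchCocycle_lower hp hcop hx.1 hx.2)
  · exact hrefl _
  · exact hsymm (eventually_patchCocycle_crossing_lower hp hcop hx.2 hx.1)
  · exact hupper (eventually_patchCocycle_crossing hx.1 hx.2)
  · exact eventually_patchCocycle_crossing_lower hp hcop hx.1 hx.2
  · rw [crossingPatch_eq_of_mem hx.1 hx.2]
    exact hrefl _

/-- The holonomy along the loop of z is right multiplication by the class of z in the presented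
group; this is checked on the letters, whose loops cross one disc. A trivial loop has trivial
holonomy. -/
theorem LinkTransport.mem_of_loop_eq_id {b : LinkComplement p q} (T : LinkTransport p q b)
    (hp : 0 < p) (hq : 0 < q) (hcop : Nat.Coprime q (2 * p)) {g : FreeGroup (Fin 2)}
    (hg : T.loop g = 𝟙 _) :
    g ∈ Subgroup.normalClosure
      ({letterX * schubertWord p q * letterX⁻¹ * (schubertWord p q)⁻¹} : Set (FreeGroup (Fin 2))) := by
  obtain ⟨h, hmul, hh⟩ := exists_holonomy (isOpen_linkPatch hcop) (exists_mem_linkPatch hq hcop)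
    (patchCocycle p q) (eventually_patchCocycle hp hcop)
  have hcomp : ∀ {x y z : LinkComplement p q} (α : FundamentalGroupoid.mk x ⟶ .mk y)
      (β : FundamentalGroupoid.mk y ⟶ .mk z) (a : SchubertGroup p q),
      h (α ≫ β) a = h β (h α a) := fun α β a => hmul α β a
  have hpath : ∀ (i : Patch) {x y : LinkComplement p q} (γ : Path x y),
      (∀ t, γ t ∈ linkPatch p q i) → ∀ a : SchubertGroup p q,
      h (pathClass γ) a = a * (patchCocycle p q i x)⁻¹ * patchCocycle p q i y := fun i _ _ γ => hh i γ
  have hid : ∀ a, h (𝟙 (FundamentalGroupoid.mk b)) a = a := fun a => by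
    rw [← pathClass_refl, hpath .upper (Path.refl b) fun _ => T.base_mem]
    simp
  have hup : ∀ y (hy : y ∈ linkPatch p q .upper), ∃ γ : Path b y,
      (∀ t, γ t ∈ linkPatch p q .upper) ∧ T.arrow .upper y hy = pathClass γ := fun y hy => by
    obtain ⟨γ, hγ⟩ := (isSimplePatch_linkPatch hq hcop .upper).exists_path b T.base_mem y hy
    refine ⟨γ, hγ, ?_⟩
    rw [← T.isTransport _ T.base_mem hy γ hγ, T.arrow_base, Category.id_comp]
  have hletter : ∀ (i : Fin 2) (a : SchubertGroup p q),
      h (T.loop (crossingLetter i.val)) a = a * schubertMk p q (crossingLetter i.val) := by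
    intro i a
    obtain ⟨u, v, hu, hv⟩ : ∃ u v : Bool,
        crossingHeight i.val (smallCircle p q i (quarterPoint u)) < 0 ∧
        0 < crossingHeight i.val (smallCircle p q i (quarterPoint v)) := by
      simp only [smallCircle_quarterPoint_height]
      obtain rfl | rfl : i = 0 ∨ i = 1 := by omega
      · exact ⟨true, false, by norm_num [sideSign], by norm_num [sideSign]⟩
      · exact ⟨false, true, by norm_num [sideSign], by norm_num [sideSign]⟩
    obtain ⟨huU, huS⟩ := smallCircle_quarterPoint_mem (p := p) (q := q) i u
    obtain ⟨hvU, hvS⟩ := smallCircle_quarterPoint_mem (p := p) (q := q) i v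
    obtain ⟨δ, hδ⟩ := (isSimplePatch_linkPatch hq hcop (crossingPatch i.val)).exists_path _ huS _ hvS
    have e := T.isTransport _ huS hvS δ hδ
    rw [T.arrow_neg _ _ huS huU hu, T.arrow_pos _ _ hvS hvU hv] at e
    obtain ⟨α, hα, eα⟩ := hup _ huU
    obtain ⟨β, hβ, eβ⟩ := hup _ hvU
    have e1 : T.loop (crossingLetter i.val) = pathClass α ≫ pathClass δ ≫ pathClass β.symm := by
      rw [pathClass_symm, ← Category.assoc, ← eα, e, Category.assoc, eβ]
      simp
    have hβ' : ∀ t, β.symm t ∈ linkPatch p q .upper := fun t => hβ _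
    rw [e1, hcomp, hcomp, hpath _ α hα, hpath _ δ hδ, hpath _ β.symm hβ', patchCocycle_crossing,
      patchCocycle_crossing, if_neg hu.not_gt, if_pos hv]
    simp [patchCocycle]
  have hinv : ∀ z : FreeGroup (Fin 2), (∀ a, h (T.loop z) a = a * schubertMk p q z) →
      ∀ a, h (T.loop z⁻¹) a = a * schubertMk p q z⁻¹ := fun z hz a => by
    have e := hz (h (T.loop z⁻¹) a)
    rw [← hcomp, T.loop_inv_comp, hid] at e
    rw [map_inv, eq_mul_inv_iff_mul_eq, ← e]
  have hpure : ∀ (i : Fin 2) a, h (T.loop (FreeGroup.of i)) a = a * schubertMk p q (.of i) := by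
    intro i
    obtain rfl | rfl : i = 0 ∨ i = 1 := by omega
    · exact hletter 0
    · exact hletter 1
  have key : ∀ (z : FreeGroup (Fin 2)) a, h (T.loop z) a = a * schubertMk p q z := by
    intro z
    induction z using FreeGroup.induction_on with
    | C1 => intro a; rw [T.loop_one, hid, map_one, mul_one]
    | of i => exact hpure i
    | inv_of i ih => exact hinv _ ih
    | mul x y hx hy => intro a; rw [T.loop_mul, hcomp, hx, hy, map_mul, mul_assoc]
  have e := key g 1
  rw [hg, hid, one_mul] at e
  exact (QuotientGroup.eq_one_iff g).1 e.symm

end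

/-! ### Meridians and the presentation of the link group -/

section

variable {p q : ℕ}

theorem isMeridian_of_eq {b : LinkComplement p q} {i : Fin 2}
    {g : FundamentalGroup (LinkComplement p q) b}
    (γ : FundamentalGroupoid.mk b ⟶ FundamentalGroupoid.mk (smallCircleBase p q i))
    (h : g = γ ≫ Groupoid.inv (pathClass (smallCircle p q i)) ≫ Groupoid.inv γ) :
    IsMeridian p q b i g := by
  obtain ⟨γ, rfl⟩ := pathClass_surjective γ
  refine ⟨γ, .inr ?_⟩
  rw [h, ← Category.assoc, ← pathClass_symm, ← pathClass_symm, ← pathClass_trans, ← pathClass_trans]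
  rfl

theorem exists_fin_two_crossing (k : ℕ) : ∃ i : Fin 2, crossingPatch k = crossingPatch i.val ∧
    crossingLetter k = crossingLetter i.val ∧
    ∀ x : LinkComplement p q, crossingHeight k x = crossingHeight i.val x := by
  rcases Nat.even_or_odd k with h | h
  · refine ⟨0, ?_, ?_, fun x => ?_⟩
    · simp [crossingPatch, h]
    · simp [crossingLetter, h]
    · simp [crossingHeight, h.neg_one_pow]
  · have h' := Nat.not_even_iff_odd.2 h
    refine ⟨1, ?_, ?_, fun x => ?_⟩
    · simp [crossingPatch, h']
    · simp [crossingLetter, h']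
    · simp [crossingHeight, h.neg_one_pow]

/-- There is a transport for which the loops of the letters are conjugates of the small circles. -/
theorem exists_linkTransport (hp : 0 < p) (hq : 0 < q) (hcop : Nat.Coprime q (2 * p)) :
    ∃ (T : LinkTransport p q (smallCircleBase p q 0))
      (m : Fin 2 → FundamentalGroup (LinkComplement p q) (smallCircleBase p q 0)),
      (∀ g, T.loop g = FreeGroup.lift m g⁻¹) ∧ ∀ i, ∃ γ : FundamentalGroupoid.mk _ ⟶ .mk _,
        m i = γ ≫ Groupoid.inv (pathClass (smallCircle p q i)) ≫ Groupoid.inv γ := by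
  have hN : smallCircleBase p q 0 ∈ linkPatch p q .upper := by
    have h : sideSign 0 * Real.cos (2 * Real.pi * (0 : unitInterval)) ≤ 0 := by
      simp [sideSign]
    have := smallCircle_mem_upper (p := p) (q := q) h
    rwa [(smallCircle p q 0).source] at this
  obtain ⟨c, hc, hcN⟩ := (isSimplePatch_linkPatch hq hcop .upper).exists_isTransport hN (𝟙 _)
  choose γ x y hx hy δ hδ hneg hpos hloop using fun i => exists_smallCircle_loop i hc
  have hxS : ∀ i, x i ∈ linkPatch p q (crossingPatch i.val) := fun i => by
    have := hδ i 0
    rwa [(δ i).source] at this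
  have hyS : ∀ i, y i ∈ linkPatch p q (crossingPatch i.val) := fun i => by
    have := hδ i 1
    rwa [(δ i).target] at this
  choose s hs hsx using fun i : Fin 2 => (isSimplePatch_linkPatch hq hcop
    (crossingPatch i.val)).exists_isTransport (hxS i) (c (x i) (hx i))
  obtain ⟨z, z', l, l', ζ, hζ, ⟨z1, z2, z3, z4⟩, -, hz, -⟩ := exists_crossing_path hp hq hcop 0
  have hzS := (hζ 0).1
  have hzW := (hζ 0).2
  rw [ζ.source] at hzS hzW
  have hzU := mem_upper_of_mem_crossingPatch hzS fun h => by rw [h, mul_zero] at hz; exact hz.false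
  -- The lower transport is normalised to agree with the upper one at z, in the piece 0 < s < 1 of
  -- the strip, where the word read is empty.
  obtain ⟨w, hw, hwz⟩ :=
    (isSimplePatch_linkPatch hq hcop .lower).exists_isTransport hzW (c z hzU)
  let arrow : ∀ i x, x ∈ linkPatch p q i →
      (FundamentalGroupoid.mk (smallCircleBase p q 0) ⟶ FundamentalGroupoid.mk x)
    | .upper => c
    | .left => s 0
    | .right => s 1
    | .lower => w
  have harrow : ∀ i : Fin 2, arrow (crossingPatch i.val) = s i := by
    intro i
    obtain rfl | rfl : i = 0 ∨ i = 1 := by omega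
    · rfl
    · rfl
  -- The circles are reversed here to cancel the inversion in `loop` below: the loop of a letter
  -- then runs along its circle in the given direction.
  let m : Fin 2 → FundamentalGroup (LinkComplement p q) (smallCircleBase p q 0) := fun i =>
    γ i ≫ Groupoid.inv (pathClass (smallCircle p q i)) ≫ Groupoid.inv (γ i)
  have hletter : ∀ i : Fin 2, FreeGroup.lift m (crossingLetter i.val)⁻¹ =
      γ i ≫ pathClass (smallCircle p q i) ≫ Groupoid.inv (γ i) := by
    intro i
    have h1 : FreeGroup.lift m (crossingLetter i.val) = m i := by
      obtain rfl | rfl : i = 0 ∨ i = 1 := by omega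
      · exact FreeGroup.lift_apply_of
      · exact FreeGroup.lift_apply_of
    rw [map_inv, h1]
    refine inv_eq_of_mul_eq_one_right ?_
    change (γ i ≫ pathClass (smallCircle p q i) ≫ Groupoid.inv (γ i)) ≫
      γ i ≫ Groupoid.inv (pathClass (smallCircle p q i)) ≫ Groupoid.inv (γ i) = 𝟙 _
    simp
  have hsneg : ∀ (i : Fin 2) (x) (hx : x ∈ linkPatch p q (crossingPatch i.val))
      (hx' : x ∈ linkPatch p q .upper), crossingHeight i.val x < 0 → s i x hx = c x hx' := by
    intro i u hu hu' h
    obtain ⟨η, hη⟩ := exists_path_crossingPatch_half hq hcop (hxS i) hu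
      (mul_pos_of_neg_of_neg (hneg i) h)
    rw [← hs i (hxS i) hu η fun t => (hη t).1, hsx, hc (hx i) hu' η fun t => (hη t).2]
  have hspos : ∀ (i : Fin 2) (x) (hx : x ∈ linkPatch p q (crossingPatch i.val))
      (hx' : x ∈ linkPatch p q .upper), 0 < crossingHeight i.val x →
      s i x hx = (γ i ≫ pathClass (smallCircle p q i) ≫ Groupoid.inv (γ i)) ≫ c x hx' := by
    intro i u hu hu' h
    obtain ⟨η, hη⟩ := exists_path_crossingPatch_half hq hcop (hyS i) hu (mul_pos (hpos i) h)
    rw [← hs i (hyS i) hu η fun t => (hη t).1, ← hs i (hxS i) (hyS i) (δ i) (hδ i), hsx,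
      ← hc (hy i) hu' η fun t => (hη t).2, hloop]
    simp
  let T : LinkTransport p q (smallCircleBase p q 0) :=
    { arrow := arrow
      -- Multiplication in `FundamentalGroup` is opposite to composition of arrows; the inversion
      -- turns products of words into composites in the same order.
      loop := fun g => FreeGroup.lift m g⁻¹
      isTransport := by
        rintro (_ | _ | _ | _)
        · exact hc
        · exact hs 0
        · exact hs 1
        · exact hw
      loop_one := by rw [inv_one, map_one]; rfl
      loop_mul := fun g h => by rw [mul_inv_rev, map_mul]; rfl
      base_mem := hN
      arrow_base := hcN
      arrow_neg := fun k => by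
        obtain ⟨i, h1, -, h3⟩ := exists_fin_two_crossing (p := p) (q := q) k
        rw [h1]
        intro x hx hx' h
        rw [h3] at h
        rw [harrow]
        exact hsneg i x hx hx' h
      arrow_pos := fun k => by
        obtain ⟨i, h1, h2, h3⟩ := exists_fin_two_crossing (p := p) (q := q) k
        rw [h1, h2]
        intro x hx hx' h
        rw [h3] at h
        rw [harrow, hletter]
        exact hspos i x hx hx' h
      arrow_strip := fun x hx hx' m hm hms h0 h1 => by
        obtain ⟨η, hη⟩ := exists_path_strip hq hcop (n := 0) z1 hm z2 hms hzU.1 hx'.1 z3 z4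
          (by simpa using h0) (by simpa using h1)
        change w x hx = c x hx'
        rw [← hw hzW hx η fun t => (hη t).2, ← hc hzU hx' η fun t => (hη t).1, hwz] }
  exact ⟨T, m, fun g => rfl, fun i => ⟨γ i, rfl⟩⟩

/-- Every link group of a two-bridge link has Schubert's presentation by two meridians. -/
theorem exists_isSchubertPresentation (hp : 0 < p) (hq : 0 < q)
    (hcop : Nat.Coprime q (2 * p)) (b : LinkComplement p q) :
    ∃ m m' : FundamentalGroup (LinkComplement p q) b,
      IsMeridian p q b 0 m ∧ IsMeridian p q b 1 m' ∧ IsSchubertPresentation p q m m' := by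
  obtain ⟨T, m, hT, hm⟩ := exists_linkTransport hp hq hcop
  obtain ⟨i, hi⟩ := exists_mem_linkPatch hq hcop b
  set β := T.arrow i b hi
  -- Conjugation by a patch arrow moves the base point to b; it keeps meridians meridians.
  let e : FundamentalGroup (LinkComplement p q) (smallCircleBase p q 0) ≃*
      FundamentalGroup (LinkComplement p q) b := ((Groupoid.isoEquivHom _ _).symm β).conj
  have he : ∀ g, e g = Groupoid.inv β ≫ g ≫ β := fun g => rfl
  have hmer : ∀ i, IsMeridian p q b i (e (m i)) := fun i => by
    obtain ⟨γ, h⟩ := hm i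
    refine isMeridian_of_eq (Groupoid.inv β ≫ γ) ?_
    rw [he, h]
    simp
  have hlift : FreeGroup.lift ![e (m 0), e (m 1)] = e.toMonoidHom.comp (FreeGroup.lift m) := by
    ext j
    fin_cases j <;> simp
  refine ⟨e (m 0), e (m 1), hmer 0, hmer 1, ?_, ?_⟩
  · rw [hlift]
    refine e.surjective.comp fun α => ?_
    obtain ⟨g, hg⟩ := T.loop_surjective hp hq hcop α
    exact ⟨g⁻¹, by rw [← hT, hg]⟩
  · rw [hlift]
    refine le_antisymm (fun g hg => ?_) (Subgroup.normalClosure_le_normal ?_)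
    · have h1 : FreeGroup.lift m g = 1 := by
        rw [MonoidHom.mem_ker] at hg
        exact (map_eq_one_iff e e.injective).1 hg
      have h2 : T.loop g⁻¹ = 𝟙 _ := by
        rw [hT, inv_inv, h1]
        rfl
      exact inv_mem_iff.1 (T.mem_of_loop_eq_id hp hq hcop h2)
    · rintro _ rfl
      have h1 := T.loop_relator hp hq hcop
      rw [hT, map_inv] at h1
      refine (map_eq_one_iff e e.injective).2 ?_
      exact inv_eq_one.1 h1

end

theorem corollary3 (p q : ℕ) (hq : 1 ≤ q) (hqp : q < 2 * p) (hcop : Nat.Coprime q (2 * p)) :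
    (∀ z : FreeGroup (Fin 2), ∃! P : MvPolynomial (Fin 3) ℂ, IsTracePolynomial z P) ∧
    ∀ P Q η : MvPolynomial (Fin 3) ℂ,
      IsTracePolynomial (letterX⁻¹ * schubertWord p q * letterX * letterX'⁻¹) P →
      IsTracePolynomial (schubertWord p q * letterX'⁻¹) Q →
      η = P - Q →
      (MvPolynomial.degreeOf 2 η = p + 1 ∧
        ∃ c : ℂ, (c = 1 ∨ c = -1) ∧
          MvPolynomial.degreeOf 2
            (η - MvPolynomial.C c * MvPolynomial.X 2 ^ (p + 1)) < p + 1) ∧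
      ∀ b : LinkComplement p q, ∃ m m' : FundamentalGroup (LinkComplement p q) b,
        IsMeridian p q b 0 m ∧ IsMeridian p q b 1 m' ∧
        IsSchubertPresentation p q m m' ∧
        (∃ Φ : (MvPolynomial (Fin 3) ℂ ⧸ Ideal.span {η}) ≃ₐ[ℂ]
            CharacterRing (FundamentalGroup (LinkComplement p q) b),
          Φ (Ideal.Quotient.mk _ (MvPolynomial.X 0)) = -traceFunction m ∧
          Φ (Ideal.Quotient.mk _ (MvPolynomial.X 1)) = -traceFunction m' ∧
          Φ (Ideal.Quotient.mk _ (MvPolynomial.X 2)) = -traceFunction (m * m')) ∧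
        (∃ Ψ : (MvPolynomial (Fin 3) ℂ ⧸ Ideal.span {η}) ≃ₐ[ℂ]
            UniversalCharacterRing (FundamentalGroup (LinkComplement p q) b),
          Ψ (Ideal.Quotient.mk _ (MvPolynomial.X 0)) = -universalTrace m ∧
          Ψ (Ideal.Quotient.mk _ (MvPolynomial.X 1)) = -universalTrace m' ∧
          Ψ (Ideal.Quotient.mk _ (MvPolynomial.X 2)) = -universalTrace (m * m')) := by
  have hp : 0 < p := by omega
  refine ⟨fun z => existsUnique_isTracePolynomial z, ?_⟩
  rintro P Q η hP hQ rfl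
  rw [hP.eq_tracePoly, hQ.eq_tracePoly, tracePoly_sub_eq hcop]
  refine ⟨degreeOf_schubertPoly hp q, fun b => ?_⟩
  obtain ⟨m, m', h1, h2, h⟩ := exists_isSchubertPresentation hp hq hcop b
  exact ⟨m, m', h1, h2, h, h.exists_algEquiv_characterRing hp hcop,
    h.exists_algEquiv_universalCharacterRing hcop⟩
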